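/- Let $V$ be a model of ZF, let $\mathcal A=(A,B,\prec,\bot\!\!\!\bot)$ be a realizability algebra in $V$ ($A,B\in V$, $B\neq\emptyset$), with set $\Lambda$ of closed $\lambda_c$-terms, set $\Pi$ of stacks, class $N$ of names (sets that are hereditarily sets of pairs (name, stack)) and set $\mathcal R\subseteq\Lambda$ of realizers (closed $\lambda_c$-terms without continuation constants). Write $\mathcal N\Vdash\varphi$ if some $t\in\mathcal R$ realizes $\varphi$ in the sense of Krivine's classical realizability interpretation of the language of $\mathrm{ZF}_\varepsilon$ (primitive relations $\not\varepsilon,\neq,\notin,\subseteq$; $x\simeq y$ abbreviates $x\subseteq y\wedge y\subseteq x$, and $x=y$ is strict equality, the negation of $\neq$). Let $\mathtt{op}$ be the canonical pairing function on names, and for $x\in V$ let $ℸx=\{(ℸy,\pi): y\in x,\ \pi\in\Pi\}$ be the recursive (reish) name. For a name $c=\mathrm{dom}(c)\times\Pi$ let $\forall x^{c}\varphi(x)$ be the bounded quantifier with falsity value $\bigcup_{b\in\mathrm{dom}(c)}\|\varphi(b)\|$, and $\exists x^c\varphi:=\neg\forall x^c\neg\varphi$. Let $\varepsilon\text{-}\mathrm{Fun}(f,a)$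 be the formula $\forall x\,\varepsilon\, a\,\forall y,y'\,(\mathtt{op}(x,y)\,\varepsilon\, f\wedge \mathtt{op}(x,y')\,\varepsilon\, f\to y=y')$. Let $\delta$ be, in $V$, an infinite regular cardinal with $|\Lambda|<\delta$. Then: 1. $\mathcal N\Vdash \forall f\,\forall a^{ℸ\delta}\,\exists b^{ℸ\delta}\,\big(\varepsilon\text{-}\mathrm{Fun}(f,a)\to\forall y^{a}\,\forall z^{ℸ\delta}\,(\mathtt{op}(y,z)\,\varepsilon\, f\to z\,\varepsilon\, b)\big)$. 2. That is, $\mathcal N$ realizes: for every $a\,\varepsilon\,ℸ\delta$, every $\varepsilon$-function $f\colon a\to ℸ\delta$ (total on the $\varepsilon$-elements of $a$, satisfying $\varepsilon\text{-}\mathrm{Fun}(f,a)$, with values that are $\varepsilon$-elements of $ℸ\delta$) is bounded: there is $b\,\varepsilon\,ℸ\delta$ such that $z\,\varepsilon\, b$ whenever $y\,\varepsilon\, a$ and $\mathtt{op}(y,z)\,\varepsilon\, f$. 3. Let NEAC (the non-extensional axiom of choice) be the statement that for every $r$ there is $f$ such that: $\mathtt{op}(x,y)\,\varepsilon\, f$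 and $\mathtt{op}(x,y')\,\varepsilon\, f$ imply $y=y'$; every $\varepsilon$-element of $f$ is an $\varepsilon$-element of $r$; and for all $x,y$ there is $y'$ such that $\mathtt{op}(x,y)\,\varepsilon\, r$ implies $\mathtt{op}(x,y')\,\varepsilon\, f$. If $\mathcal N\Vdash\mathrm{NEAC}$, then $\mathcal N\Vdash$ "$ℸ\delta$ is a regular $\in$-cardinal", that is, in terms of $\in$ and $\simeq$ only, $ℸ\delta$ is an infinite ordinal, no function from an element of $ℸ\delta$ to $ℸ\delta$ is surjective, and every such function is bounded in $ℸ\delta$. -/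

import Mathlib

/-! # Classical realizability models over an arbitrary model of ZF -/

namespace ClassicalRealizability

universe u

/-! ## Models of ZF -/

/-- The only symbol of the language of set theory is a binary relation symbol. -/
inductive SetRel : ℕ → Type
  | mem : SetRel 2

/-- The first-order language of set theory. -/
def setLang : FirstOrder.Language.{0, 0} := ⟨fun _ => Empty, SetRel⟩

section Ground

variable {M : Type u} [setLang.Structure M]

/-- The membership relation of a structure for the language of set theory. -/
def Mem (x y : M) : Prop :=
  FirstOrder.Language.Structure.RelMap (L := setLang) SetRel.mem ![x, y]

infix:50 " ∊ " => Mem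

end Ground

/-- `M` is a (first-order, not necessarily well-founded) model of ZF. In the two schemas
"definable" means: definable in `M` by a first-order formula of the language of set theory,
with parameters from `M`. -/
class ModelZF (M : Type u) [setLang.Structure M] : Prop where
  extensionality : ∀ x y : M, (∀ z, z ∊ x ↔ z ∊ y) → x = y
  foundation : ∀ x : M, (∃ y, y ∊ x) → ∃ y, y ∊ x ∧ ∀ z, z ∊ y → ¬ z ∊ x
  pairing : ∀ x y : M, ∃ p, ∀ w, w ∊ p ↔ w = x ∨ w = y
  union : ∀ x : M, ∃ v, ∀ w, w ∊ v ↔ ∃ y, y ∊ x ∧ w ∊ y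
  powerset : ∀ x : M, ∃ p, ∀ w, w ∊ p ↔ ∀ z, z ∊ w → z ∊ x
  infinity : ∃ x : M, (∃ e, e ∊ x ∧ ∀ z, ¬ z ∊ e) ∧
    ∀ y, y ∊ x → ∃ s, s ∊ x ∧ ∀ z, z ∊ s ↔ z ∊ y ∨ z = y
  separation : ∀ D : Set M, (Set.univ : Set M).Definable₁ setLang D →
    ∀ x : M, ∃ y, ∀ z, z ∊ y ↔ z ∊ x ∧ z ∈ D
  replacement : ∀ R : Set (M × M), (Set.univ : Set M).Definable₂ setLang R →
    ∀ x : M, (∀ y, y ∊ x → ∃! z, (y, z) ∈ R) → ∃ v, ∀ z, z ∊ v ↔ ∃ y, y ∊ x ∧ (y, z) ∈ R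

section Ground

variable {M : Type u} [setLang.Structure M] [ModelZF M]

/-! ## Elementary set theory inside the model -/

variable (M) in
theorem nonempty_model : Nonempty M :=
  let ⟨x, _⟩ := ModelZF.infinity (M := M)
  ⟨x⟩

/-- The element `{x | D x}` of `M` (an arbitrary element if the class `D` is not a set of `M`). -/
noncomputable def compr (D : M → Prop) : M :=
  haveI := nonempty_model M
  Classical.epsilon fun b => ∀ x, x ∊ b ↔ D x

theorem mem_compr {D : M → Prop} (h : ∃ b : M, ∀ x, x ∊ b ↔ D x) (x : M) :
    x ∊ compr D ↔ D x :=
  Classical.epsilon_spec h x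

/-- The empty set. -/
noncomputable def empty : M := compr fun _ => False

/-- The unordered pair `{x, y}`. -/
noncomputable def upair (x y : M) : M := compr fun w => w = x ∨ w = y

/-- The (Kuratowski) ordered pair. -/
noncomputable def pair (x y : M) : M := upair (upair x x) (upair x y)

/-- The ordered triple. -/
noncomputable def triple (x y z : M) : M := pair x (pair y z)

/-- The successor `x ∪ {x}`. -/
noncomputable def succ (x : M) : M := compr fun z => z ∊ x ∨ z = x

/-- The standard von Neumann numerals of the model, used as tags for syntax. -/
noncomputable def num : ℕ → M
  | 0 => empty
  | n + 1 => succ (num n)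

/-- `n` is a natural number of the model. -/
def IsNat (n : M) : Prop :=
  ∀ S : M, empty ∊ S → (∀ x, x ∊ S → succ x ∊ S) → n ∊ S

/-- `a` is an ordinal of the model: a transitive set of transitive sets. -/
def IsOrd (a : M) : Prop :=
  (∀ x y, x ∊ a → y ∊ x → y ∊ a) ∧ ∀ x y z, x ∊ a → y ∊ x → z ∊ y → z ∊ x

/-- `f` is (in the model) a function from `X` to `Y`. -/
def IsFunction (f X Y : M) : Prop :=
  (∀ z, z ∊ f → ∃ x y, x ∊ X ∧ y ∊ Y ∧ z = pair x y) ∧ ∀ x, x ∊ X → ∃! y, pair x y ∊ f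

/-- `f` is (in the model) a bijection from `X` onto `Y`. -/
def IsBijection (f X Y : M) : Prop :=
  IsFunction f X Y ∧ ∀ y, y ∊ Y → ∃! x, pair x y ∊ f

/-- `δ` is a cardinal of the model (an initial ordinal). -/
def IsCardinal (δ : M) : Prop :=
  IsOrd δ ∧ ∀ β f, β ∊ δ → ¬ IsBijection f β δ

/-- `δ` is (in the model) an infinite regular cardinal: every function from an element of `δ`
to `δ` is bounded in `δ`. (A cardinal is infinite iff it is a nonzero limit ordinal.) -/
def IsRegularCardinal (δ : M) : Prop :=
  IsCardinal δ ∧ (empty ∊ δ ∧ ∀ β, β ∊ δ → succ β ∊ δ) ∧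
    ∀ β f, β ∊ δ → IsFunction f β δ → ∃ γ, γ ∊ δ ∧ ∀ x y, pair x y ∊ f → y ∊ γ

/-- `|X| < δ` for a cardinal `δ` of the model: the cardinality `κ` of `X`
(an initial ordinal equinumerous with `X`) is an element of `δ`. -/
def CardLT (X δ : M) : Prop :=
  ∃ κ f, κ ∊ δ ∧ IsCardinal κ ∧ IsBijection f X κ

/-! ## `λ_c`-terms and stacks

Terms modulo `α`-equivalence are represented by de Bruijn terms, coded as sets of the model;
the variable bound by the innermost abstraction has index `0`. -/

noncomputable def tVar (n : M) : M := pair (num 0) n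
noncomputable def tApp (t s : M) : M := pair (num 1) (pair t s)
noncomputable def tLam (t : M) : M := pair (num 2) t
/-- call-with-current-continuation -/
noncomputable def tCC : M := pair (num 3) empty
/-- The continuation constant `k_π`. -/
noncomputable def tCont (π : M) : M := pair (num 4) π
/-- The special instruction `ξ_α`. -/
noncomputable def tInstr (α : M) : M := pair (num 5) α
/-- The stack bottom `ω_β`. -/
noncomputable def sBottom (β : M) : M := pair (num 6) β
/-- The stack `t . π`. -/
noncomputable def sPush (t π : M) : M := pair (num 7) (pair t π)

/-- `T` is closed under the formation rules of terms other than continuation constants;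
`⟨n, t⟩ ∊ T` is read "`t` is a term whose free variables have index less than `n`". -/
def PureTermClosed (A T : M) : Prop :=
  (∀ n k, IsNat n → k ∊ n → pair n (tVar k) ∊ T) ∧
  (∀ n t s, pair n t ∊ T → pair n s ∊ T → pair n (tApp t s) ∊ T) ∧
  (∀ n t, IsNat n → pair (succ n) t ∊ T → pair n (tLam t) ∊ T) ∧
  (∀ n, IsNat n → pair n tCC ∊ T) ∧
  (∀ n α, IsNat n → α ∊ A → pair n (tInstr α) ∊ T)

/-- `(T, P)` is closed under the simultaneous formation rules of terms and of stacks. -/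
def GrammarClosed (A B T P : M) : Prop :=
  PureTermClosed A T ∧
  (∀ n π, IsNat n → π ∊ P → pair n (tCont π) ∊ T) ∧
  (∀ β, β ∊ B → sBottom β ∊ P) ∧
  (∀ t π, pair empty t ∊ T → π ∊ P → sPush t π ∊ P)

/-- The set `Λ` of closed `λ_c`-terms: what every pair closed under the formation rules contains. -/
noncomputable def Lam (A B : M) : M :=
  compr fun t => ∀ T P, GrammarClosed A B T P → pair empty t ∊ T

/-- The set `Π` of stacks. -/
noncomputable def Stk (A B : M) : M :=
  compr fun π => ∀ T P, GrammarClosed A B T P → π ∊ P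

/-- `t` is a realizer: a closed `λ_c`-term without continuation constants. -/
def IsRealizer (A t : M) : Prop :=
  ∀ T, PureTermClosed A T → pair empty t ∊ T

/-- Closure under the recursive clauses of the substitution of the closed term `s` for the variable
of index `k` in a term whose free variables have index at most `k`, with result `r`:
`⟨k, t, r⟩ ∊ S`. Since `s` is closed, nothing has to be shifted. -/
def SubstClosed (A B s S : M) : Prop :=
  (∀ k, IsNat k → triple k (tVar k) s ∊ S) ∧
  (∀ k j, IsNat k → j ∊ k → triple k (tVar j) (tVar j) ∊ S) ∧
  (∀ k t r t' r', triple k t r ∊ S → triple k t' r' ∊ S →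
    triple k (tApp t t') (tApp r r') ∊ S) ∧
  (∀ k t r, IsNat k → triple (succ k) t r ∊ S → triple k (tLam t) (tLam r) ∊ S) ∧
  (∀ k, IsNat k → triple k tCC tCC ∊ S) ∧
  (∀ k π, IsNat k → π ∊ Stk A B → triple k (tCont π) (tCont π) ∊ S) ∧
  (∀ k α, IsNat k → α ∊ A → triple k (tInstr α) (tInstr α) ∊ S)

/-- `r = t[u := s]`, where `λu. t` is closed (so `u` is the variable of index `0`). -/
def IsSubst (A B t s r : M) : Prop :=
  ∀ S, SubstClosed A B s S → triple empty t r ∊ S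

/-- `p` is a process `t ⋆ π` (coded as the pair of `t` and `π`). -/
def IsProcess (A B p : M) : Prop :=
  ∃ t π, t ∊ Lam A B ∧ π ∊ Stk A B ∧ p = pair t π

end Ground

/-! ## Realizability algebras -/

/-- A realizability algebra in the model `M` of ZF. All its components are elements of `M`.
A preorder extends the evaluation preorder (the least preorder satisfying the four rules) iff it
satisfies the four rules. -/
structure RealizabilityAlgebra (M : Type u) [setLang.Structure M] [ModelZF M] where
  /-- indices of the special instructions -/
  A : M
  /-- indices of the stack bottoms -/
  B : M
  nonempty_B : ∃ β, β ∊ B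
  /-- the evaluation relation; `⟨p, q⟩ ∊ red` is read `p ≻ q` -/
  red : M
  red_sub : ∀ z, z ∊ red → ∃ p q, IsProcess A B p ∧ IsProcess A B q ∧ z = pair p q
  red_refl : ∀ p, IsProcess A B p → pair p p ∊ red
  red_trans : ∀ p q r, pair p q ∊ red → pair q r ∊ red → pair p r ∊ red
  red_push : ∀ t s π, t ∊ Lam A B → s ∊ Lam A B → π ∊ Stk A B →
    pair (pair (tApp t s) π) (pair t (sPush s π)) ∊ red
  red_grab : ∀ t s r π, tLam t ∊ Lam A B → s ∊ Lam A B → π ∊ Stk A B → IsSubst A B t s r →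
    pair (pair (tLam t) (sPush s π)) (pair r π) ∊ red
  red_save : ∀ t π, t ∊ Lam A B → π ∊ Stk A B →
    pair (pair tCC (sPush t π)) (pair t (sPush (tCont π) π)) ∊ red
  red_restore : ∀ t π σ, t ∊ Lam A B → π ∊ Stk A B → σ ∊ Stk A B →
    pair (pair (tCont σ) (sPush t π)) (pair t σ) ∊ red
  /-- the pole -/
  pole : M
  pole_sub : ∀ p, p ∊ pole → IsProcess A B p
  pole_up : ∀ p q, pair p q ∊ red → q ∊ pole → p ∊ pole

/-! ## Formulas -/

/-- Closed formulas of the language with primitive symbols `⊤, ⊥, →, ∀` and `ε̸, ≠, ∉, ⊆`, with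
parameters. A formula `φ(x)` with a free variable is given by its instances, so definable functions
such as `op` may simply be applied to variables. `allDom c φ` is the bounded quantifier
`∀ x^c φ(x)`, for names `c` of the form `dom(c) × Π`. -/
inductive Fml (N : Type u) : Type u
  | top : Fml N
  | bot : Fml N
  | neps (a b : N) : Fml N
  | ne (a b : N) : Fml N
  | nin (a b : N) : Fml N
  | sub (a b : N) : Fml N
  | imp (φ ψ : Fml N) : Fml N
  | all (φ : N → Fml N) : Fml N
  | allDom (c : N) (φ : N → Fml N) : Fml N

namespace Fml

variable {N : Type u}

infixr:30 " ⟹ " => Fml.imp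

def neg (φ : Fml N) : Fml N := φ ⟹ bot
def and (φ ψ : Fml N) : Fml N := (φ ⟹ ψ ⟹ bot) ⟹ bot
def or (φ ψ : Fml N) : Fml N := (φ ⟹ bot) ⟹ (ψ ⟹ bot) ⟹ bot
def iff (φ ψ : Fml N) : Fml N := and (φ ⟹ ψ) (ψ ⟹ φ)
def ex (φ : N → Fml N) : Fml N := (all fun x => φ x ⟹ bot) ⟹ bot
/-- `∃ x^c φ(x)` -/
def exDom (c : N) (φ : N → Fml N) : Fml N := (allDom c fun x => φ x ⟹ bot) ⟹ bot
/-- `a ε b` -/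
def eps (a b : N) : Fml N := neps a b ⟹ bot
/-- `a ∈ b` -/
def mem (a b : N) : Fml N := nin a b ⟹ bot
/-- `a = b` -/
def eq (a b : N) : Fml N := ne a b ⟹ bot
/-- `a ≃ b` -/
def sim (a b : N) : Fml N := and (sub a b) (sub b a)
/-- `∀ x ε a, φ(x)` -/
def allEps (a : N) (φ : N → Fml N) : Fml N := all fun x => eps x a ⟹ φ x
/-- `∃ x ε a, φ(x)` -/
def exEps (a : N) (φ : N → Fml N) : Fml N := (all fun x => φ x ⟹ neps x a) ⟹ bot
/-- `∀ x ∈ a, φ(x)` -/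
def allMem (a : N) (φ : N → Fml N) : Fml N := all fun x => mem x a ⟹ φ x
/-- `∃ x ∈ a, φ(x)` -/
def exMem (a : N) (φ : N → Fml N) : Fml N := ex fun x => and (mem x a) (φ x)

/-! ### Formulas of ordinary set theory, i.e. in `∈` and `≃` -/

/-- `p` is the unordered pair `{x, y}`, extensionally. -/
def isUPair (p x y : N) : Fml N := all fun z => iff (mem z p) (or (sim z x) (sim z y))

/-- `p` is the Wiener ordered pair `{{{x}, 0}, {{y}}}`, extensionally. -/
def isOPair (p x y : N) : Fml N :=
  ex fun e => ex fun sx => ex fun l => ex fun sy => ex fun r =>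
    and (all fun z => nin z e) <|
    and (isUPair sx x x) <|
    and (isUPair l sx e) <|
    and (isUPair sy y y) <|
    and (isUPair r sy sy) <|
    isUPair p l r

/-- `f(x, y)` in the sense of `∈`: the ordered pair of `x` and `y` is an `∈`-element of `f`. -/
def relMem (f x y : N) : Fml N := exMem f fun p => isOPair p x y

/-- `a` is an `∈`-ordinal. -/
def isOrdMem (a : N) : Fml N :=
  and (allMem a fun x => allMem x fun y => mem y a)
    (allMem a fun x => allMem x fun y => allMem y fun z => mem z x)

/-- `f` is an `∈`-function with domain `b`, taking its values in `a`. -/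
def isFunMem (f b a : N) : Fml N :=
  and (allMem b fun x => ex fun y => relMem f x y) <|
  and (allMem b fun x => all fun y => all fun y' =>
    and (relMem f x y) (relMem f x y') ⟹ sim y y') <|
  allMem b fun x => all fun y => relMem f x y ⟹ mem y a

/-- `a` is an `∈`-cardinal: an `∈`-ordinal such that no `∈`-function from an `∈`-element of `a`
to `a` is surjective. -/
def isCardMem (a : N) : Fml N :=
  and (isOrdMem a) <|
  allMem a fun b => all fun f =>
    isFunMem f b a ⟹ neg (allMem a fun y => exMem b fun x => relMem f x y)

/-- `a` is a regular `∈`-cardinal: an infinite `∈`-cardinal such that every `∈`-function from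
an `∈`-element of `a` to `a` is bounded in `a`.
(A cardinal is infinite iff it is nonempty without largest element.) -/
def isRegularMem (a : N) : Fml N :=
  and (isCardMem a) <|
  and (and (exMem a fun _ => top) (allMem a fun x => exMem a fun y => mem x y)) <|
  allMem a fun b => all fun f =>
    isFunMem f b a ⟹ exMem a fun c => allMem b fun x => all fun y => relMem f x y ⟹ mem y c

/-! ### Formulas about `ε`-functions, for a given pairing function `op` -/

/-- `f` satisfies `ε-Fun(f, a)`: it is functional on `a`, up to strict equality. -/
def epsFun (op : N → N → N) (f a : N) : Fml N :=
  allEps a fun x => all fun y => all fun y' =>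
    and (eps (op x y) f) (eps (op x y') f) ⟹ eq y y'

/-- `f` is an `ε`-function with domain `a`, taking its values in `d`. -/
def isEpsFunction (op : N → N → N) (f a d : N) : Fml N :=
  and (allEps a fun x => ex fun y => eps (op x y) f) <|
  and (epsFun op f a) <|
  allEps a fun x => all fun y => eps (op x y) f ⟹ eps y d

/-- Every `ε`-function from some `a ε d` into `d` is bounded in `d`. -/
def epsFunctionsBounded (op : N → N → N) (d : N) : Fml N :=
  all fun f => allEps d fun a => isEpsFunction op f a d ⟹
    exEps d fun b => allEps a fun y => all fun z => eps (op y z) f ⟹ eps z b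

/-- The Non-extensional Axiom of Choice. -/
def NEAC (op : N → N → N) : Fml N :=
  all fun r => ex fun f =>
    and (all fun x => all fun y => all fun y' =>
      and (eps (op x y) f) (eps (op x y') f) ⟹ eq y y') <|
    and (all fun z => eps z f ⟹ eps z r) <|
    all fun x => all fun y => ex fun y' => eps (op x y) r ⟹ eps (op x y') f

end Fml

/-! ## Names and the realizability interpretation -/

namespace RealizabilityAlgebra

variable {M : Type u} [setLang.Structure M] [ModelZF M] (𝒜 : RealizabilityAlgebra M)

/-- The set `Λ` of closed `λ_c`-terms. -/
noncomputable def Terms : M := Lam 𝒜.A 𝒜.B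

/-- The set `Π` of stacks. -/
noncomputable def Stacks : M := Stk 𝒜.A 𝒜.B

/-- The class `N` of names: the sets which are hereditarily sets of pairs (name, stack). By
foundation this is the union of the hierarchy `N_α = ⋃_{β < α} 𝒫(N_β × Π)`. -/
def IsName (a : M) : Prop :=
  ∃ T : M, a ∊ T ∧ ∀ b z, b ∊ T → z ∊ b → ∃ c π, c ∊ T ∧ π ∊ 𝒜.Stacks ∧ z = pair c π

/-- `y` is the value at `x` of the recursively defined function
`ℸx = {(ℸw, π) | w ∈ x, π ∈ Π}`, as witnessed by a set-sized approximation `g`. -/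
def IsReish (x y : M) : Prop :=
  ∃ g : M, pair x y ∊ g ∧ ∀ v v', pair v v' ∊ g →
    (∀ w, w ∊ v → ∃ w', pair w w' ∊ g) ∧
    ∀ z, z ∊ v' ↔ ∃ w w' π, w ∊ v ∧ pair w w' ∊ g ∧ π ∊ 𝒜.Stacks ∧ z = pair w' π

/-- The name `ℸx` (reish of `x`). -/
noncomputable def reish (x : M) : M :=
  haveI := nonempty_model M
  Classical.epsilon fun y => 𝒜.IsReish x y

/-- The Church numeral `λu.λv.v`. -/
noncomputable def church0 : M := tLam (tLam (tVar (num 0)))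

/-- The Church numeral `λu.λv.uv`. -/
noncomputable def church1 : M := tLam (tLam (tApp (tVar (num 1)) (tVar (num 0))))

/-- `sng(a) = {a} × Π` -/
noncomputable def sng (a : M) : M :=
  compr fun z => ∃ π, π ∊ 𝒜.Stacks ∧ z = pair a π

/-- `up(a, b) = {(a, 0.π) | π ∈ Π} ∪ {(b, 1.π) | π ∈ Π}` -/
noncomputable def up (a b : M) : M :=
  compr fun z => ∃ π, π ∊ 𝒜.Stacks ∧
    (z = pair a (sPush church0 π) ∨ z = pair b (sPush church1 π))

/-- `op(a, b) = up(up(sng(a), ℸ0), sng(sng(b)))` -/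
noncomputable def op (a b : M) : M :=
  𝒜.up (𝒜.up (𝒜.sng a) (𝒜.reish empty)) (𝒜.sng (𝒜.sng b))

/-- `(T, F, G)` is a set-sized approximation of the simultaneous recursive definition of
`‖a ∉ b‖ = {π | ⟨a, b, π⟩ ∊ F}` and `‖a ⊆ b‖ = {π | ⟨a, b, π⟩ ∊ G}`, for `a, b ∊ T`, where
`T` contains with every name the elements of its domain. -/
def AtomicApprox (T F G : M) : Prop :=
  (∀ a c π, a ∊ T → pair c π ∊ a → c ∊ T) ∧
  ∀ a b, a ∊ T → b ∊ T →
    (∀ ρ, triple a b ρ ∊ F ↔ ∃ c t t' π, π ∊ 𝒜.Stacks ∧ pair c π ∊ b ∧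
      t ∊ 𝒜.Terms ∧ (∀ σ, triple a c σ ∊ G → pair t σ ∊ 𝒜.pole) ∧
      t' ∊ 𝒜.Terms ∧ (∀ σ, triple c a σ ∊ G → pair t' σ ∊ 𝒜.pole) ∧
      ρ = sPush t (sPush t' π)) ∧
    (∀ ρ, triple a b ρ ∊ G ↔ ∃ c t π, π ∊ 𝒜.Stacks ∧ pair c π ∊ a ∧
      t ∊ 𝒜.Terms ∧ (∀ σ, triple c b σ ∊ F → pair t σ ∊ 𝒜.pole) ∧
      ρ = sPush t π)

/-- The falsity value `‖φ‖`, a class of stacks. -/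
def falsity : Fml M → Set M
  | .top => ∅
  | .bot => {π | π ∊ 𝒜.Stacks}
  | .neps a b => {π | π ∊ 𝒜.Stacks ∧ pair a π ∊ b}
  | .ne a b => {π | π ∊ 𝒜.Stacks ∧ a = b}
  | .nin a b => {π | ∃ T F G, 𝒜.AtomicApprox T F G ∧ a ∊ T ∧ b ∊ T ∧ triple a b π ∊ F}
  | .sub a b => {π | ∃ T F G, 𝒜.AtomicApprox T F G ∧ a ∊ T ∧ b ∊ T ∧ triple a b π ∊ G}
  | .imp φ ψ => {ρ | ∃ t π, t ∊ 𝒜.Terms ∧ (∀ σ ∈ falsity φ, pair t σ ∊ 𝒜.pole) ∧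
      π ∈ falsity ψ ∧ ρ = sPush t π}
  | .all φ => {π | ∃ a, 𝒜.IsName a ∧ π ∈ falsity (φ a)}
  | .allDom c φ => {π | ∃ a, (∃ σ, pair a σ ∊ c) ∧ π ∈ falsity (φ a)}

/-- The truth value `|φ|`; `t ∈ |φ|` is read "`t` realizes `φ`". -/
def verity (φ : Fml M) : Set M :=
  {t | t ∊ 𝒜.Terms ∧ ∀ π ∈ 𝒜.falsity φ, pair t π ∊ 𝒜.pole}

/-- `φ` holds in the realizability model (`φ` belongs to the realizability theory of `𝒜`):
some closed `λ_c`-term without continuation constants realizes `φ`. -/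
def Forces (φ : Fml M) : Prop :=
  ∃ t, IsRealizer 𝒜.A t ∧ t ∈ 𝒜.verity φ

end RealizabilityAlgebra

end ClassicalRealizability

open ClassicalRealizability

/-! The heart of the matter is a counting argument with realizers. Let $f$ be a name and $a=ℸ\alpha$
with $\alpha\in\delta$. For $\gamma\in\alpha$ and $s\in\Lambda$ there may be exactly one
$\eta\in\delta$ such that $s$ realizes $\mathtt{op}(ℸ\gamma,ℸ\eta)\,\varepsilon\, f$. As
$|\Lambda|<\delta$ and $\delta$ is regular, all $\eta$ arising in this way lie below some
$\beta\in\delta$ (`exists_bound`), and $b=ℸ\beta$ works.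

Indeed, let $s$ realize $\mathtt{op}(ℸ\gamma,ℸ\eta)\,\varepsilon\, f$. Either $\eta$ is the only
such ordinal, and $\eta\in\beta$; or the same $s$ serves a second $\eta'\neq\eta$. In the latter
case a realizer of $\varepsilon\text{-}\mathrm{Fun}(f,a)$, fed $s$ twice, realizes $ℸ\eta=ℸ\eta'$,
which is as good as a contradiction. One term covers both cases (`exists_bound_term`), whence the
first claim (`exists_epsBounded`). The second claim rewrites the quantifiers over $ℸ\delta$.

For the third claim, every $\in$-element of $ℸ\delta$ is $\simeq$ to some $ℸ\beta$ with
$\beta\in\delta$. An $\in$-function $F$ on $ℸ\beta$ is turned into the $\varepsilon$-relation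
`relName`; it is functional only up to $\simeq$, and NEAC thins it out to an $\varepsilon$-function
$g$ still meeting every fibre. A bound for $g$ bounds $F$ (`exists_memBounded`). Boundedness
excludes surjectivity because $\in$ is irreflexive.

Two devices support this. The ground model satisfies only first-order ZF, so each use of Separation,
Replacement or induction requires definability; the classes `Dfn`, `DfnF`, `DFml` let instance
search supply it. Realizers come from a typing relation `Ty`, whose rules are sound for
realizability, so that a formal derivation determines its term. -/

namespace ClassicalRealizability

/-! ## First-order definability with parameters -/

section Definability

open FirstOrder FirstOrder.Language

variable {M : Type*} [setLang.Structure M]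

/-- `P` is first-order definable with parameters, `v i` being the value of the `i`-th variable. -/
class Dfn (P : (ℕ → M) → Prop) : Prop where
  out : (Set.univ : Set M).Definable setLang {v : ℕ → M | P v}

/-- The operation `F` has a definable graph. -/
class DfnF (F : (ℕ → M) → M) : Prop where
  out : Dfn fun v : ℕ → M => v 0 = F fun i => v (i + 1)

theorem Dfn.congr {P Q : (ℕ → M) → Prop} (h : Dfn P) (e : ∀ v, Q v ↔ P v) : Dfn Q :=
  ⟨by simpa only [e] using h.out⟩

instance Dfn.and {P Q : (ℕ → M) → Prop} [hP : Dfn P] [hQ : Dfn Q] : Dfn fun v => P v ∧ Q v :=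
  ⟨hP.out.inter hQ.out⟩

instance Dfn.or {P Q : (ℕ → M) → Prop} [hP : Dfn P] [hQ : Dfn Q] : Dfn fun v => P v ∨ Q v :=
  ⟨hP.out.union hQ.out⟩

instance Dfn.not {P : (ℕ → M) → Prop} [hP : Dfn P] : Dfn fun v => ¬ P v :=
  ⟨hP.out.compl⟩

instance Dfn.const {p : Prop} : Dfn fun _ : ℕ → M => p := by
  have key : ∀ {s t : Set (ℕ → M)}, (Set.univ : Set M).Definable setLang s → t = s →
      (Set.univ : Set M).Definable setLang t := fun h e => e ▸ h
  by_cases h : p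
  · exact ⟨key Set.definable_univ (by ext; simp [h])⟩
  · exact ⟨key Set.definable_empty (by ext; simp [h])⟩

instance Dfn.imp {P Q : (ℕ → M) → Prop} [hP : Dfn P] [hQ : Dfn Q] : Dfn fun v => P v → Q v :=
  Dfn.congr (P := fun v => ¬ P v ∨ Q v) inferInstance fun _ => imp_iff_not_or

instance Dfn.iff {P Q : (ℕ → M) → Prop} [hP : Dfn P] [hQ : Dfn Q] : Dfn fun v => P v ↔ Q v :=
  Dfn.congr (P := fun v => (P v → Q v) ∧ (Q v → P v)) inferInstance fun _ => iff_def

theorem Dfn.relabel {P : (ℕ → M) → Prop} (h : Dfn P) (g : ℕ → ℕ) :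
    Dfn fun v => P fun i => v (g i) :=
  ⟨h.out.preimage_comp g⟩

/-- The environment `v` extended by `x` in front. -/
def scons (x : M) (v : ℕ → M) : ℕ → M
  | 0 => x
  | n + 1 => v n

/-- Variable $0$ of the formula becomes the quantified one and all others move down by one. -/
theorem Dfn.exists_scons {P : (ℕ → M) → Prop} (h : Dfn P) : Dfn fun v => ∃ x, P (scons x v) := by
  obtain ⟨φ, hφ⟩ := h.out
  have hφ' : ∀ v, P v ↔ φ.Realize v := fun v => by
    have := congrArg (v ∈ ·) hφ
    simpa using this
  let g : ℕ → ℕ ⊕ Unit := fun n => Nat.casesOn n (Sum.inr ()) Sum.inl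
  refine ⟨(φ.relabel g).iExs Unit, ?_⟩
  ext v
  simp only [Set.mem_ofPred_eq, Formula.realize_iExs, Formula.realize_relabel, hφ']
  have key : ∀ i : Unit → M, Sum.elim v i ∘ g = scons (i ()) v := fun i => by
    funext n; cases n <;> rfl
  constructor
  · rintro ⟨x, hx⟩; exact ⟨fun _ => x, by rw [key]; exact hx⟩
  · rintro ⟨i, hi⟩; exact ⟨i (), by rw [key] at hi; exact hi⟩

/-- This shape lets instance search pass under a binder: the bound variable is read as `v 0` and the
old environment is shifted by one. -/
instance Dfn.exists {P : (ℕ → M) → M → Prop} [h : Dfn fun v => P (fun i => v (i + 1)) (v 0)] :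
    Dfn fun v => ∃ x, P v x :=
  h.exists_scons

instance Dfn.forall {P : (ℕ → M) → M → Prop} [h : Dfn fun v => P (fun i => v (i + 1)) (v 0)] :
    Dfn fun v => ∀ x, P v x :=
  Dfn.congr (P := fun v => ¬ ∃ x, ¬ P v x) inferInstance fun _ => not_exists_not.symm

theorem Dfn.mem_var (i j : ℕ) : Dfn fun v : ℕ → M => v i ∊ v j := by
  refine ⟨⟨Relations.formula (L := setLang[[(Set.univ : Set M)]]) (n := 2) (Sum.inl SetRel.mem)
    ![Term.var i, Term.var j], ?_⟩⟩
  ext v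
  simp only [Set.mem_ofPred_eq]
  refine Iff.trans ?_ Formula.realize_rel.symm
  have : (fun k => Term.realize v ((![Term.var i, Term.var j] :
      Fin 2 → setLang[[(Set.univ : Set M)]].Term ℕ) k)) = ![v i, v j] := by
    funext k; fin_cases k <;> rfl
  rw [this]
  rfl

theorem Dfn.eq_var (i j : ℕ) : Dfn fun v : ℕ → M => v i = v j := by
  refine ⟨⟨Term.equal (Term.var i) (Term.var j), ?_⟩⟩
  ext v
  simp [Formula.realize_equal]

theorem Dfn.eq_const (i : ℕ) (c : M) : Dfn fun v : ℕ → M => v i = c := by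
  refine ⟨⟨Term.equal (Term.var i)
    (Constants.term (setLang.con (⟨c, trivial⟩ : (Set.univ : Set M)))), ?_⟩⟩
  ext v
  simp [Formula.realize_equal]

instance DfnF.var {i : ℕ} : DfnF fun v : ℕ → M => v i := ⟨Dfn.eq_var 0 (i + 1)⟩

instance DfnF.const {c : M} : DfnF fun _ : ℕ → M => c := ⟨Dfn.eq_const 0 c⟩

theorem DfnF.shift {F : (ℕ → M) → M} (h : DfnF F) : DfnF fun v => F fun i => v (i + 1) :=
  ⟨h.out.relabel fun i => Nat.casesOn i 0 fun j => j + 2⟩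

/-- The language has no function symbols, so a definable operation is substituted by quantifying
over its value. -/
theorem Dfn.comp1 {P : M → Prop} (h : Dfn fun v => P (v 0)) {F : (ℕ → M) → M} (hF : DfnF F) :
    Dfn fun v => P (F v) :=
  haveI := hF.out
  Dfn.congr (P := fun v => ∃ x, x = F v ∧ P x) inferInstance fun _ => by simp

theorem Dfn.comp2 {P : M → M → Prop} (h : Dfn fun v => P (v 0) (v 1)) {F G : (ℕ → M) → M}
    (hF : DfnF F) (hG : DfnF G) : Dfn fun v => P (F v) (G v) :=
  haveI := hF.out
  haveI := hG.shift.out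
  haveI : Dfn fun v => P (v 1) (v 0) := h.relabel fun i => 1 - i
  Dfn.congr (P := fun v => ∃ x, x = F v ∧ ∃ y, y = G v ∧ P x y) inferInstance
    fun _ => by simp

theorem Dfn.comp3 {P : M → M → M → Prop} (h : Dfn fun v => P (v 0) (v 1) (v 2))
    {F G H : (ℕ → M) → M} (hF : DfnF F) (hG : DfnF G) (hH : DfnF H) :
    Dfn fun v => P (F v) (G v) (H v) :=
  haveI := hF.out
  haveI := hG.shift.out
  haveI := hH.shift.shift.out
  haveI : Dfn fun v => P (v 2) (v 1) (v 0) := h.relabel fun i => 2 - i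
  Dfn.congr (P := fun v => ∃ x, x = F v ∧ ∃ y, y = G v ∧ ∃ z, z = H v ∧ P x y z)
    inferInstance fun _ => by simp

instance Dfn.mem {F G : (ℕ → M) → M} [hF : DfnF F] [hG : DfnF G] : Dfn fun v => F v ∊ G v :=
  Dfn.comp2 (P := fun x y => x ∊ y) (Dfn.mem_var 0 1) hF hG

instance Dfn.eq {F G : (ℕ → M) → M} [hF : DfnF F] [hG : DfnF G] : Dfn fun v => F v = G v :=
  Dfn.comp2 (P := fun x y => x = y) (Dfn.eq_var 0 1) hF hG

instance Dfn.existsUnique {P : (ℕ → M) → M → Prop}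
    [h : Dfn fun v => P (fun i => v (i + 1)) (v 0)] : Dfn fun v => ∃! x, P v x := by
  have : Dfn fun v => P (fun i => v (i + 1 + 1)) (v 0) :=
    Dfn.relabel h fun i => Nat.casesOn i 0 fun j => j + 2
  exact inferInstanceAs (Dfn fun v => ∃ x, P v x ∧ ∀ y, P v y → y = x)

/-- An operation given by a definable graph. -/
theorem DfnF.of_graph {F : (ℕ → M) → M} {R : (ℕ → M) → M → Prop} (e : ∀ v y, y = F v ↔ R v y)
    (h : Dfn fun v => R (fun i => v (i + 1)) (v 0)) : DfnF F :=
  ⟨h.congr fun _ => e _ _⟩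

theorem DfnF.comp1 {f : M → M} (h : DfnF fun v => f (v 0)) {F : (ℕ → M) → M} (hF : DfnF F) :
    DfnF fun v => f (F v) :=
  haveI : Dfn fun v => v 0 = f (v 1) := h.out
  ⟨Dfn.comp2 (P := fun y x => y = f x) this DfnF.var hF.shift⟩

theorem DfnF.comp2 {f : M → M → M} (h : DfnF fun v => f (v 0) (v 1)) {F G : (ℕ → M) → M}
    (hF : DfnF F) (hG : DfnF G) : DfnF fun v => f (F v) (G v) :=
  haveI : Dfn fun v => v 0 = f (v 1) (v 2) := h.out
  ⟨Dfn.comp3 (P := fun y x z => y = f x z) this DfnF.var hF.shift hG.shift⟩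

end Definability

/-! ## Set theory inside a model of ZF -/

section SetTheory

variable {M : Type*} [setLang.Structure M] [ModelZF M]

theorem set_ext {x y : M} (h : ∀ z, z ∊ x ↔ z ∊ y) : x = y := ModelZF.extensionality x y h

theorem exists_sep (D : M → Prop) [h : Dfn fun v => D (v 0)] (x : M) :
    ∃ y : M, ∀ z, z ∊ y ↔ z ∊ x ∧ D z := by
  refine ModelZF.separation {z | D z} ?_ x
  -- All variables are identified with the single one; this is harmless because only variable $0$
  -- matters.
  exact Set.Definable.preimage_comp (fun _ : ℕ => (0 : Fin 1)) h.out

theorem exists_repl (R : M → M → Prop) [h : Dfn fun v => R (v 0) (v 1)] (x : M)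
    (hx : ∀ y, y ∊ x → ∃! z, R y z) : ∃ w : M, ∀ z, z ∊ w ↔ ∃ y, y ∊ x ∧ R y z := by
  refine ModelZF.replacement {p | R p.1 p.2} ?_ x hx
  have := Set.Definable.preimage_comp
    (fun i : ℕ => if i = 0 then (0 : Fin 2) else 1) h.out
  exact this

/-- `compr` is meaningful only for classes that are sets; by Separation, any set containing the
class suffices. -/
theorem mem_compr_of_bound {D : M → Prop} [Dfn fun v => D (v 0)] (U : M)
    (hU : ∀ x, D x → x ∊ U) (x : M) : x ∊ compr D ↔ D x := by
  obtain ⟨y, hy⟩ := exists_sep D U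
  exact mem_compr ⟨y, fun z => (hy z).trans ⟨fun h => h.2, fun h => ⟨hU z h, h⟩⟩⟩ x

theorem not_mem_empty (x : M) : ¬ x ∊ (empty : M) := by
  obtain ⟨x0⟩ := nonempty_model M
  exact fun h => (mem_compr_of_bound (D := fun _ : M => False) x0 (fun _ h => h.elim) x).1 h

theorem eq_empty {x : M} (h : ∀ z, ¬ z ∊ x) : x = empty :=
  set_ext fun z => iff_of_false (h z) (not_mem_empty z)

theorem mem_upair {x y w : M} : w ∊ upair x y ↔ w = x ∨ w = y := mem_compr (ModelZF.pairing x y) w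

instance {F G : (ℕ → M) → M} [hF : DfnF F] [hG : DfnF G] : DfnF fun v => upair (F v) (G v) :=
  DfnF.comp2 (f := upair) (DfnF.of_graph (R := fun v y => ∀ w, w ∊ y ↔ w = v 0 ∨ w = v 1)
    (fun v y => ⟨fun h w => by rw [h, mem_upair], fun h => set_ext fun w => by rw [h, mem_upair]⟩)
    inferInstance) hF hG

instance {F G : (ℕ → M) → M} [hF : DfnF F] [hG : DfnF G] : DfnF fun v => pair (F v) (G v) := by
  unfold pair; infer_instance

instance {F G H : (ℕ → M) → M} [hF : DfnF F] [hG : DfnF G] [DfnF H] :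
    DfnF fun v => triple (F v) (G v) (H v) := by
  unfold triple; infer_instance

end SetTheory
-- Pairs, natural numbers, universes and ordinals in the ground model
section SetTheory

variable {M : Type*} [setLang.Structure M] [ModelZF M]

theorem upair_self_inj {x y : M} (h : upair x x = upair y y) : x = y := by
  have : x ∊ upair y y := h ▸ mem_upair.2 (Or.inl rfl)
  simpa [mem_upair] using this

theorem pair_inj {x y x' y' : M} : pair x y = pair x' y' ↔ x = x' ∧ y = y' := by
  refine ⟨fun h => ?_, fun h => by rw [h.1, h.2]⟩
  have key : ∀ {a b c d : M}, pair a b = pair c d → a = c := by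
    intro a b c d h
    have h1 : upair c c ∊ pair a b := by rw [h]; exact mem_upair.2 (Or.inl rfl)
    have h2 : c ∊ upair c c := mem_upair.2 (Or.inl rfl)
    rcases mem_upair.1 h1 with h1 | h1
    · exact (upair_self_inj h1).symm
    · have : a ∊ upair c c := h1 ▸ mem_upair.2 (Or.inl rfl)
      simpa [mem_upair] using this
  have hx := key h
  subst hx
  refine ⟨rfl, ?_⟩
  have key2 : ∀ {a b d : M}, pair a b = pair a d → b = a ∨ b = d := by
    intro a b d h
    have h1 : upair a b ∊ pair a d := by rw [← h]; exact mem_upair.2 (Or.inr rfl)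
    have h2 : b ∊ upair a b := mem_upair.2 (Or.inr rfl)
    rcases mem_upair.1 h1 with h1 | h1 <;> rw [h1, mem_upair] at h2
    · exact Or.inl (h2.elim id id)
    · exact h2
  rcases key2 h with h1 | h1
  · rcases key2 h.symm with h2 | h2
    · rw [h1, h2]
    · exact h2.symm
  · exact h1

theorem triple_inj {x y z x' y' z' : M} :
    triple x y z = triple x' y' z' ↔ x = x' ∧ y = y' ∧ z = z' := by
  simp [triple, pair_inj]

theorem not_mem_self (x : M) : ¬ x ∊ x := by
  obtain ⟨y, hy, h⟩ := ModelZF.foundation (upair x x) ⟨x, mem_upair.2 (Or.inl rfl)⟩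
  obtain rfl : y = x := by simpa [mem_upair] using hy
  exact fun h' => h y h' hy

theorem not_mem_cycle {x y : M} (h1 : x ∊ y) : ¬ y ∊ x := by
  intro h2
  obtain ⟨z, hz, h⟩ := ModelZF.foundation (upair x y) ⟨x, mem_upair.2 (Or.inl rfl)⟩
  rcases mem_upair.1 hz with rfl | rfl
  · exact h y h2 (mem_upair.2 (Or.inr rfl))
  · exact h x h1 (mem_upair.2 (Or.inl rfl))

theorem exists_union2 (x y : M) : ∃ v : M, ∀ w, w ∊ v ↔ w ∊ x ∨ w ∊ y := by
  obtain ⟨v, hv⟩ := ModelZF.union (upair x y)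
  exact ⟨v, fun w => by simp [hv, mem_upair]⟩

theorem mem_succ {x z : M} : z ∊ succ x ↔ z ∊ x ∨ z = x := by
  refine mem_compr (D := fun z => z ∊ x ∨ z = x) ?_ z
  obtain ⟨v, hv⟩ := exists_union2 x (upair x x)
  exact ⟨v, fun w => by simp [hv, mem_upair]⟩

instance {F : (ℕ → M) → M} [hF : DfnF F] : DfnF fun v => succ (F v) :=
  DfnF.comp1 (f := succ) (DfnF.of_graph (R := fun v y => ∀ w, w ∊ y ↔ w ∊ v 0 ∨ w = v 0)
    (fun v y => ⟨fun h w => by rw [h, mem_succ], fun h => set_ext fun w => by rw [h, mem_succ]⟩)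
    inferInstance) hF

theorem succ_ne_empty (x : M) : succ x ≠ empty := fun h =>
  not_mem_empty x (h ▸ mem_succ.2 (Or.inr rfl))

theorem succ_inj {x y : M} (h : succ x = succ y) : x = y := by
  have h1 : x ∊ succ y := h ▸ mem_succ.2 (Or.inr rfl)
  have h2 : y ∊ succ x := h ▸ mem_succ.2 (Or.inr rfl)
  rcases mem_succ.1 h1 with h1 | h1
  · rcases mem_succ.1 h2 with h2 | h2
    · exact (not_mem_cycle h1 h2).elim
    · exact h2.symm
  · exact h1

/-! ### Natural numbers -/

instance {F : (ℕ → M) → M} [hF : DfnF F] : Dfn fun v => IsNat (F v) :=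
  Dfn.comp1 (by unfold IsNat; infer_instance) hF

theorem isNat_empty : IsNat (empty : M) := fun _ h _ => h

theorem IsNat.succ {n : M} (h : IsNat n) : IsNat (succ n) := fun S h0 hs => hs n (h S h0 hs)

theorem isNat_num (k : ℕ) : IsNat (num k : M) := by
  induction k with
  | zero => exact isNat_empty
  | succ k ih => exact ih.succ

variable (M) in
theorem exists_omega : ∃ w : M, ∀ n, n ∊ w ↔ IsNat n := by
  obtain ⟨x, ⟨e, he, he0⟩, hs⟩ := ModelZF.infinity (M := M)
  obtain ⟨w, hw⟩ := exists_sep (fun n : M => IsNat n) x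
  refine ⟨w, fun n => (hw n).trans ⟨fun h => h.2, fun h => ⟨h x ?_ ?_, h⟩⟩⟩
  · rwa [← eq_empty he0]
  · intro y hy
    obtain ⟨s, hs1, hs2⟩ := hs y hy
    have : s = ClassicalRealizability.succ y := set_ext fun z => by rw [hs2, mem_succ]
    rwa [← this]

theorem nat_induction (P : M → Prop) [Dfn fun v => P (v 0)] (h0 : P empty)
    (hs : ∀ n, IsNat n → P n → P (succ n)) {n : M} (hn : IsNat n) : P n := by
  obtain ⟨w, hw⟩ := exists_omega M
  obtain ⟨S, hS⟩ := exists_sep P w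
  refine ((hS n).1 (hn S ((hS _).2 ⟨(hw _).2 isNat_empty, h0⟩) fun x hx => ?_)).2
  obtain ⟨h1, h2⟩ := (hS x).1 hx
  exact (hS _).2 ⟨(hw _).2 ((hw x).1 h1).succ, hs x ((hw x).1 h1) h2⟩

theorem mem_num_of_lt {j k : ℕ} (h : j < k) : (num j : M) ∊ num k := by
  induction k with
  | zero => omega
  | succ k ih =>
    refine mem_succ.2 ?_
    rcases Nat.lt_succ_iff_lt_or_eq.1 h with h | rfl
    · exact Or.inl (ih h)
    · exact Or.inr rfl

theorem IsNat.mem_trans {n j k : M} (hn : IsNat n) (hk : k ∊ n) (hj : j ∊ k) : j ∊ n := by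
  refine nat_induction (fun n => ∀ k, k ∊ n → ∀ j, j ∊ k → j ∊ n)
    (fun k hk => (not_mem_empty k hk).elim) (fun n _ ih k hk j hj => ?_) hn k hk j hj
  rcases mem_succ.1 hk with hk | rfl
  · exact mem_succ.2 (Or.inl (ih k hk j hj))
  · exact mem_succ.2 (Or.inl hj)

theorem IsNat.succ_mem_succ {n k : M} (hn : IsNat n) (hk : k ∊ n) :
    ClassicalRealizability.succ k ∊ ClassicalRealizability.succ n := by
  refine nat_induction (fun n => ∀ k, k ∊ n →
    ClassicalRealizability.succ k ∊ ClassicalRealizability.succ n)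
    (fun k hk => (not_mem_empty k hk).elim) (fun n _ ih k hk => ?_) hn k hk
  rcases mem_succ.1 hk with hk | rfl
  · exact mem_succ.2 (Or.inl (ih k hk))
  · exact mem_succ.2 (Or.inr rfl)

theorem IsNat.eq_empty_or_mem {n : M} (hn : IsNat n) : n = empty ∨ empty ∊ n := by
  refine nat_induction (fun n => n = empty ∨ empty ∊ n) (Or.inl rfl) (fun n _ ih => ?_) hn
  exact Or.inr (mem_succ.2 (ih.elim (fun h => Or.inr h.symm) Or.inl))

/-! ### Iteration of an operation along the natural numbers -/

/-- `y` is the value at `n` of the function defined by iterating `G` from `x`. -/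
def IsIterate (G : M → M) (x n y : M) : Prop :=
  ∃ g, pair n y ∊ g ∧ ∀ m z, pair m z ∊ g → (m = empty ∧ z = x) ∨
    ∃ m' z', pair m' z' ∊ g ∧ m = succ m' ∧ z = G z'

section Iterate

variable {G : M → M} [hG : DfnF fun v => G (v 0)] {x : M}

omit [ModelZF M] in
theorem DfnF.app (F : (ℕ → M) → M) [hF : DfnF F] : DfnF fun v => G (F v) := DfnF.comp1 hG hF

instance {F H : (ℕ → M) → M} [hF : DfnF F] [hH : DfnF H] :
    Dfn fun v => IsIterate G x (F v) (H v) := by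
  have : ∀ i, DfnF fun v => G (v i) := fun i => DfnF.app _
  exact Dfn.comp2 (by unfold IsIterate; infer_instance) hF hH

omit hG in
theorem isIterate_empty : IsIterate G x empty x :=
  ⟨upair (pair empty x) (pair empty x), mem_upair.2 (Or.inl rfl), fun m z h => by
    simpa [mem_upair, pair_inj] using Or.inl h⟩

omit hG in
theorem IsIterate.succ {n y : M} (h : IsIterate G x n y) :
    IsIterate G x (ClassicalRealizability.succ n) (G y) := by
  obtain ⟨g, hg, H⟩ := h
  obtain ⟨g', hg'⟩ := exists_union2 g (upair (pair (ClassicalRealizability.succ n) (G y))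
    (pair (ClassicalRealizability.succ n) (G y)))
  refine ⟨g', (hg' _).2 (Or.inr (mem_upair.2 (Or.inl rfl))), fun m z hmz => ?_⟩
  rcases (hg' _).1 hmz with h | h
  · rcases H m z h with h | ⟨m', z', h, h'⟩
    · exact Or.inl h
    · exact Or.inr ⟨m', z', (hg' _).2 (Or.inl h), h'⟩
  · have : m = ClassicalRealizability.succ n ∧ z = G y := by
      simpa [mem_upair, pair_inj] using h
    exact Or.inr ⟨n, y, (hg' _).2 (Or.inl hg), this⟩

omit hG in
theorem IsIterate.cases {n y : M} (h : IsIterate G x n y) : (n = empty ∧ y = x) ∨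
    ∃ m z, IsIterate G x m z ∧ n = ClassicalRealizability.succ m ∧ y = G z := by
  obtain ⟨g, hg, H⟩ := h
  rcases H n y hg with h | ⟨m, z, hm, e⟩
  · exact Or.inl h
  · exact Or.inr ⟨m, z, ⟨g, hm, H⟩, e⟩

/-- The witnesses of `IsIterate` are only closed under predecessors, not assumed functional.
Uniqueness comes from induction and the injectivity of the successor. -/
theorem existsUnique_isIterate {n : M} (hn : IsNat n) : ∃! y, IsIterate G x n y := by
  refine nat_induction (fun n => ∃! y, IsIterate G x n y) ?_ (fun n _ ih => ?_) hn
  · refine ⟨x, isIterate_empty, fun y hy => ?_⟩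
    rcases hy.cases with h | ⟨m, z, _, h, _⟩
    · exact h.2
    · exact (succ_ne_empty m h.symm).elim
  · obtain ⟨y, hy, hu⟩ := ih
    refine ⟨G y, hy.succ, fun y' hy' => ?_⟩
    rcases hy'.cases with h | ⟨m, z, hz, h, rfl⟩
    · exact (succ_ne_empty n h.1).elim
    · obtain rfl := succ_inj h
      rw [hu z hz]

end Iterate

/-! ### Transitive sets closed under pairing -/

/-- `x ∪ ⋃ x ∪ 𝒫 x` -/
noncomputable def enlarge (x : M) : M :=
  compr fun w => w ∊ x ∨ (∃ y, y ∊ x ∧ w ∊ y) ∨ ∀ z, z ∊ w → z ∊ x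

theorem mem_enlarge {x w : M} :
    w ∊ enlarge x ↔ w ∊ x ∨ (∃ y, y ∊ x ∧ w ∊ y) ∨ ∀ z, z ∊ w → z ∊ x := by
  obtain ⟨a, ha⟩ := ModelZF.union x
  obtain ⟨b, hb⟩ := ModelZF.powerset x
  obtain ⟨c, hc⟩ := exists_union2 a b
  obtain ⟨d, hd⟩ := exists_union2 x c
  exact mem_compr (D := fun w => w ∊ x ∨ (∃ y, y ∊ x ∧ w ∊ y) ∨ ∀ z, z ∊ w → z ∊ x)
    ⟨d, fun w => by rw [hd, hc, ha, hb]⟩ w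

theorem enlarge_mono {x y : M} (h : ∀ z, z ∊ x → z ∊ y) {w : M} (hw : w ∊ enlarge x) :
    w ∊ enlarge y := by
  rcases mem_enlarge.1 hw with hw | ⟨v, hv, hw⟩ | hw
  · exact mem_enlarge.2 (Or.inl (h w hw))
  · exact mem_enlarge.2 (Or.inr (Or.inl ⟨v, h v hv, hw⟩))
  · exact mem_enlarge.2 (Or.inr (Or.inr fun z hz => h z (hw z hz)))

instance : DfnF fun v : ℕ → M => enlarge (v 0) :=
  DfnF.of_graph (R := fun v y => ∀ w, w ∊ y ↔ w ∊ v 0 ∨ (∃ y, y ∊ v 0 ∧ w ∊ y) ∨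
    ∀ z, z ∊ w → z ∊ v 0)
    (fun v y => ⟨fun h w => by rw [h, mem_enlarge], fun h => set_ext fun w => by
      rw [h, mem_enlarge]⟩) inferInstance

/-- A transitive set closed under pairing. -/
structure IsUniverse (U : M) : Prop where
  trans : ∀ y z, y ∊ U → z ∊ y → z ∊ U
  upair_mem : ∀ a b, a ∊ U → b ∊ U → upair a b ∊ U

namespace IsUniverse

variable {U : M} (hU : IsUniverse U)
include hU

theorem pair_mem {a b : M} (ha : a ∊ U) (hb : b ∊ U) : pair a b ∊ U :=
  hU.upair_mem _ _ (hU.upair_mem _ _ ha ha) (hU.upair_mem _ _ ha hb)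

theorem of_pair_mem {a b : M} (h : pair a b ∊ U) : a ∊ U ∧ b ∊ U := by
  have : upair a b ∊ U := hU.trans _ _ h (mem_upair.2 (Or.inr rfl))
  exact ⟨hU.trans _ _ this (mem_upair.2 (Or.inl rfl)),
    hU.trans _ _ this (mem_upair.2 (Or.inr rfl))⟩

theorem triple_mem {a b c : M} (ha : a ∊ U) (hb : b ∊ U) (hc : c ∊ U) : triple a b c ∊ U :=
  hU.pair_mem ha (hU.pair_mem hb hc)

end IsUniverse

/-- Take the union of the iterates of `enlarge` on $\{x\}$: the summand $\bigcup x$ makes it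
transitive, the summand $\mathcal P x$ provides unordered pairs. -/
theorem exists_universe_mem (x : M) : ∃ U : M, x ∊ U ∧ IsUniverse U := by
  obtain ⟨w, hw⟩ := exists_omega M
  let R : M → M → Prop := IsIterate enlarge (upair x x)
  obtain ⟨V, hV⟩ := exists_repl R w fun n hn => existsUnique_isIterate ((hw n).1 hn)
  obtain ⟨U, hU⟩ := ModelZF.union V
  have hU' : ∀ z, z ∊ U ↔ ∃ n y, IsNat n ∧ R n y ∧ z ∊ y := fun z => by
    rw [hU]
    constructor
    · rintro ⟨y, hy, hz⟩
      obtain ⟨n, hn, hR⟩ := (hV y).1 hy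
      exact ⟨n, y, (hw n).1 hn, hR, hz⟩
    · rintro ⟨n, y, hn, hR, hz⟩
      exact ⟨y, (hV y).2 ⟨n, (hw n).2 hn, hR⟩, hz⟩
  have base : ∀ n, IsNat n → ∀ y, R n y → x ∊ y := fun n hn => by
    refine nat_induction (fun n => ∀ y, R n y → x ∊ y) ?_ ?_ hn
    · intro y hy
      rw [(existsUnique_isIterate isNat_empty).unique hy isIterate_empty]
      exact mem_upair.2 (Or.inl rfl)
    · intro n hn ih y hy
      obtain ⟨z, hz, -⟩ := existsUnique_isIterate (G := enlarge) (x := upair x x) hn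
      rw [(existsUnique_isIterate hn.succ).unique hy hz.succ]
      exact mem_enlarge.2 (Or.inl (ih z hz))
  -- The stages are directed, which avoids comparing $n$ with $m$: enlarging a common upper bound
  -- for the stages $n$ and $m$ gives one for $n+1$ and $m$.
  have dir : ∀ n, IsNat n → ∀ m y z, IsNat m → R n y → R m z →
      ∃ k u, IsNat k ∧ R k u ∧ (∀ t, t ∊ y → t ∊ u) ∧ ∀ t, t ∊ z → t ∊ u := fun n hn => by
    refine nat_induction (fun n => ∀ m y z, IsNat m → R n y → R m z →
      ∃ k u, IsNat k ∧ R k u ∧ (∀ t, t ∊ y → t ∊ u) ∧ ∀ t, t ∊ z → t ∊ u) ?_ ?_ hn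
    · intro m y z hm hy hz
      refine ⟨m, z, hm, hz, fun t ht => ?_, fun t ht => ht⟩
      rw [(existsUnique_isIterate isNat_empty).unique hy isIterate_empty] at ht
      obtain rfl : t = x := by simpa [mem_upair] using ht
      exact base m hm z hz
    · intro n hn ih m y z hm hy hz
      obtain ⟨y0, hy0, -⟩ := existsUnique_isIterate (G := enlarge) (x := upair x x) hn
      have ey := (existsUnique_isIterate hn.succ).unique hy hy0.succ
      obtain ⟨k, u, hk, hu, h1, h2⟩ := ih m y0 z hm hy0 hz
      exact ⟨succ k, enlarge u, hk.succ, hu.succ, fun t ht => enlarge_mono h1 (ey ▸ ht),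
        fun t ht => mem_enlarge.2 (Or.inl (h2 t ht))⟩
  refine ⟨U, (hU' x).2 ⟨empty, _, isNat_empty, isIterate_empty, mem_upair.2 (Or.inl rfl)⟩, ?_, ?_⟩
  · intro y z hy hz
    obtain ⟨n, u, hn, hu, hy⟩ := (hU' y).1 hy
    exact (hU' z).2 ⟨succ n, _, hn.succ, hu.succ, mem_enlarge.2 (Or.inr (Or.inl ⟨y, hy, hz⟩))⟩
  · intro a b ha hb
    obtain ⟨n, y, hn, hy, ha⟩ := (hU' a).1 ha
    obtain ⟨m, z, hm, hz, hb⟩ := (hU' b).1 hb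
    obtain ⟨k, u, hk, hu, h1, h2⟩ := dir n hn m y z hm hy hz
    refine (hU' _).2 ⟨succ k, _, hk.succ, hu.succ, mem_enlarge.2 (Or.inr (Or.inr fun t ht => ?_))⟩
    rcases mem_upair.1 ht with rfl | rfl
    · exact h1 _ ha
    · exact h2 _ hb

theorem exists_universe (l : List M) :
    ∃ U : M, IsUniverse U ∧ (∀ x ∈ l, x ∊ U) ∧ ∀ n, IsNat n → n ∊ U := by
  -- The list and $\omega$ are coded as one iterated pair, whose components belong to every universe
  -- containing it.
  suffices ∀ w : M, ∃ x : M, ∀ U, IsUniverse U → x ∊ U → w ∊ U ∧ ∀ x ∈ l, x ∊ U by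
    obtain ⟨w, hw⟩ := exists_omega M
    obtain ⟨x, hx⟩ := this w
    obtain ⟨U, hxU, hU⟩ := exists_universe_mem x
    obtain ⟨h1, h2⟩ := hx U hU hxU
    exact ⟨U, hU, h2, fun n hn => hU.trans _ _ h1 ((hw n).2 hn)⟩
  intro w
  induction l with
  | nil => exact ⟨w, fun U _ h => ⟨h, by simp⟩⟩
  | cons a l ih =>
    obtain ⟨x, hx⟩ := ih
    refine ⟨pair a x, fun U hU h => ?_⟩
    obtain ⟨h1, h2⟩ := hx U hU (hU.of_pair_mem h).2
    exact ⟨h1, by simpa using ⟨(hU.of_pair_mem h).1, h2⟩⟩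

/-! ### Ordinals -/

theorem exists_minimal (D : M → Prop) [Dfn fun v => D (v 0)] (X : M) (h : ∃ x, x ∊ X ∧ D x) :
    ∃ x, x ∊ X ∧ D x ∧ ∀ y, y ∊ x → y ∊ X → ¬ D y := by
  obtain ⟨S, hS⟩ := exists_sep D X
  obtain ⟨x, hx, hx'⟩ := ModelZF.foundation S (h.imp fun x hx => (hS x).2 hx)
  exact ⟨x, ((hS x).1 hx).1, ((hS x).1 hx).2, fun y hy hyX hD => hx' y hy ((hS y).2 ⟨hyX, hD⟩)⟩

/-- Choose a minimal $a$ incomparable with something, then a minimal $b$ incomparable with $a$;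
minimality forces $a$ and $b$ to have the same elements. -/
theorem IsOrd.trichotomy {δ : M} (hδ : IsOrd δ) {a b : M} (ha : a ∊ δ) (hb : b ∊ δ) :
    a ∊ b ∨ a = b ∨ b ∊ a := by
  by_contra hab
  obtain ⟨a, ha, ⟨b, hb, hab⟩, hmin⟩ := exists_minimal
    (fun a => ∃ b, b ∊ δ ∧ ¬ (a ∊ b ∨ a = b ∨ b ∊ a)) δ ⟨a, ha, b, hb, hab⟩
  obtain ⟨b, hb, hab, hmin'⟩ := exists_minimal
    (fun b => ¬ (a ∊ b ∨ a = b ∨ b ∊ a)) δ ⟨b, hb, hab⟩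
  refine hab (Or.inr (Or.inl (set_ext fun z => ⟨fun hz => ?_, fun hz => ?_⟩)))
  · have hzδ := hδ.1 a z ha hz
    by_contra hzb
    refine hmin z hz hzδ ⟨b, hb, ?_⟩
    rintro (h | rfl | h)
    · exact hzb h
    · exact hab (Or.inr (Or.inr hz))
    · exact hab (Or.inr (Or.inr (hδ.2 a z b ha hz h)))
  · have hzδ := hδ.1 b z hb hz
    by_contra hza
    refine hmin' z hz hzδ ?_
    rintro (h | rfl | h)
    · exact hab (Or.inl (hδ.2 b z a hb hz h))
    · exact hab (Or.inl hz)
    · exact hza h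

/-- Least witnesses replace choice, which is not available in ZF. -/
theorem IsOrd.existsUnique_least {δ : M} (hδ : IsOrd δ) (D : M → Prop) [Dfn fun v => D (v 0)]
    (h : ∃ x, x ∊ δ ∧ D x) : ∃! x, x ∊ δ ∧ D x ∧ ∀ y, y ∊ x → ¬ D y := by
  obtain ⟨x, hx, hD, hmin⟩ := exists_minimal D δ h
  refine ⟨x, ⟨hx, hD, fun y hy => hmin y hy (hδ.1 x y hx hy)⟩, fun y ⟨hy, hDy, hy'⟩ => ?_⟩
  rcases hδ.trichotomy hx hy with h | h | h
  · exact (hy' x h hD).elim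
  · exact h.symm
  · exact (hmin y h hy hDy).elim

end SetTheory
section Terms

variable {M : Type*} [setLang.Structure M] [ModelZF M]

/-! ## Closed terms and stacks -/

section Instances

variable {F G : (ℕ → M) → M} [hF : DfnF F] [hG : DfnF G]

instance : DfnF fun v => tVar (F v) := by unfold tVar; infer_instance
instance : DfnF fun v => tApp (F v) (G v) := by unfold tApp; infer_instance
instance : DfnF fun v => tLam (F v) := by unfold tLam; infer_instance
instance : DfnF fun v => tCont (F v) := by unfold tCont; infer_instance
instance : DfnF fun v => tInstr (F v) := by unfold tInstr; infer_instance
instance : DfnF fun v => sBottom (F v) := by unfold sBottom; infer_instance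
instance : DfnF fun v => sPush (F v) (G v) := by unfold sPush; infer_instance

instance {A B : M} : Dfn fun v => GrammarClosed A B (F v) (G v) :=
  Dfn.comp2 (by unfold GrammarClosed PureTermClosed; infer_instance) hF hG

end Instances

/-- `t` is a `λ_c`-term whose free variables have index less than `n`. -/
def IsTerm (A B n t : M) : Prop := ∀ T P, GrammarClosed A B T P → pair n t ∊ T

instance {A B : M} {F G : (ℕ → M) → M} [hF : DfnF F] [hG : DfnF G] :
    Dfn fun v => IsTerm A B (F v) (G v) :=
  Dfn.comp2 (by unfold IsTerm; infer_instance) hF hG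

/-- Syntax is built by pairing with numerals, so a universe containing $A$ and $B$ is closed under
all formation rules. It bounds the classes $\Lambda$ and $\Pi$, which are therefore sets. -/
theorem exists_grammarClosed (A B : M) : ∃ U : M, IsUniverse U ∧ GrammarClosed A B U U := by
  obtain ⟨U, hU, hl, hn⟩ := exists_universe [A, B]
  have hA : ∀ α, α ∊ A → α ∊ U := fun α h => hU.trans _ _ (hl A (by simp)) h
  have hB : ∀ β, β ∊ B → β ∊ U := fun α h => hU.trans _ _ (hl B (by simp)) h
  have tag : ∀ (k : ℕ) {x : M}, x ∊ U → pair (num k) x ∊ U := fun k x hx =>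
    hU.pair_mem (hn _ (isNat_num k)) hx
  refine ⟨U, hU, ⟨fun n k hn' hk => hU.pair_mem (hn n hn') (tag 0 (hU.trans n k (hn n hn') hk)),
    fun n t s h1 h2 => hU.pair_mem (hU.of_pair_mem h1).1
      (tag 1 (hU.pair_mem (hU.of_pair_mem h1).2 (hU.of_pair_mem h2).2)),
    fun n t hn' h => hU.pair_mem (hn n hn') (tag 2 (hU.of_pair_mem h).2),
    fun n hn' => hU.pair_mem (hn n hn') (tag 3 (hn _ isNat_empty)),
    fun n α hn' h => hU.pair_mem (hn n hn') (tag 5 (hA α h))⟩,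
    fun n π hn' h => hU.pair_mem (hn n hn') (tag 4 h), fun β h => tag 6 (hB β h),
    fun t π h1 h2 => tag 7 (hU.pair_mem (hU.of_pair_mem h1).2 h2)⟩

theorem mem_Lam {A B t : M} : t ∊ Lam A B ↔ IsTerm A B empty t := by
  obtain ⟨U, hU, hg⟩ := exists_grammarClosed A B
  exact mem_compr_of_bound (D := fun t => ∀ T P, GrammarClosed A B T P → pair empty t ∊ T) U
    (fun t h => (hU.of_pair_mem (h U U hg)).2) t

theorem mem_Stk {A B π : M} : π ∊ Stk A B ↔ ∀ T P, GrammarClosed A B T P → π ∊ P := by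
  obtain ⟨U, hU, hg⟩ := exists_grammarClosed A B
  exact mem_compr_of_bound (D := fun π => ∀ T P, GrammarClosed A B T P → π ∊ P) U
    (fun t h => h U U hg) π

section Grammar

variable {A B n t s π : M}

theorem IsTerm.var {k : M} (hn : IsNat n) (hk : k ∊ n) : IsTerm A B n (tVar k) :=
  fun _ _ h => h.1.1 n k hn hk

theorem IsTerm.app (ht : IsTerm A B n t) (hs : IsTerm A B n s) : IsTerm A B n (tApp t s) :=
  fun T P h => h.1.2.1 n t s (ht T P h) (hs T P h)

theorem IsTerm.lam (hn : IsNat n) (ht : IsTerm A B (succ n) t) : IsTerm A B n (tLam t) :=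
  fun T P h => h.1.2.2.1 n t hn (ht T P h)

theorem IsTerm.cc (hn : IsNat n) : IsTerm A B n tCC := fun _ _ h => h.1.2.2.2.1 n hn

theorem IsTerm.instr {α : M} (hn : IsNat n) (hα : α ∊ A) : IsTerm A B n (tInstr α) :=
  fun _ _ h => h.1.2.2.2.2 n α hn hα

theorem IsTerm.cont (hn : IsNat n) (hπ : π ∊ Stk A B) : IsTerm A B n (tCont π) :=
  fun T P h => h.2.1 n π hn (mem_Stk.1 hπ T P h)

theorem sBottom_mem {β : M} (hβ : β ∊ B) : sBottom β ∊ Stk A B :=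
  mem_Stk.2 fun _ _ h => h.2.2.1 β hβ

theorem sPush_mem (ht : t ∊ Lam A B) (hπ : π ∊ Stk A B) : sPush t π ∊ Stk A B :=
  mem_Stk.2 fun T P h => h.2.2.2 t π (mem_Lam.1 ht T P h) (mem_Stk.1 hπ T P h)

end Grammar

/-- Closed terms are terms in every context, and substitution leaves them unchanged. -/
theorem closed_weaken_and_subst {A B s S t : M} (hS : SubstClosed A B s S) (ht : t ∊ Lam A B)
    {k : M} (hk : IsNat k) : IsTerm A B k t ∧ triple k t t ∊ S := by
  obtain ⟨U, hU, hg⟩ := exists_grammarClosed A B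
  -- Induction on terms: the set of judgements with the desired property is closed under the
  -- grammar. The property must speak of all larger contexts $k$ in order to pass under
  -- abstractions.
  obtain ⟨T, hT⟩ := exists_sep (fun p : M => ∃ n t : M, p = pair n t ∧ IsNat n ∧ IsTerm A B n t ∧
    ∀ k : M, IsNat k → (n = k ∨ n ∊ k) → IsTerm A B k t ∧ triple k t t ∊ S) U
  have hT' : ∀ n t, pair n t ∊ T ↔ IsNat n ∧ IsTerm A B n t ∧
      ∀ k, IsNat k → (n = k ∨ n ∊ k) → IsTerm A B k t ∧ triple k t t ∊ S := by
    intro n t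
    rw [hT]
    constructor
    · rintro ⟨-, n', t', e, h⟩
      obtain ⟨rfl, rfl⟩ := pair_inj.1 e
      exact h
    · exact fun h => ⟨h.2.1 U U hg, n, t, rfl, h⟩
  have hgr : GrammarClosed A B T (Stk A B) := by
    refine ⟨⟨fun n k hn hk => ?_, fun n t s h1 h2 => ?_, fun n t hn h => ?_, fun n hn => ?_,
      fun n α hn hα => ?_⟩, fun n π hn hπ => ?_, fun β hβ => sBottom_mem hβ,
      fun t π h hπ => sPush_mem (mem_Lam.2 ((hT' _ _).1 h).2.1) hπ⟩ <;> rw [hT'] at *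
    · refine ⟨hn, .var hn hk, fun k' hk' h => ?_⟩
      have : k ∊ k' := by
        rcases h with rfl | h
        · exact hk
        · exact hk'.mem_trans h hk
      exact ⟨.var hk' this, hS.2.1 k' k hk' this⟩
    · exact ⟨h1.1, h1.2.1.app h2.2.1, fun k hk h => ⟨(h1.2.2 k hk h).1.app (h2.2.2 k hk h).1,
        hS.2.2.1 _ _ _ _ _ (h1.2.2 k hk h).2 (h2.2.2 k hk h).2⟩⟩
    · refine ⟨hn, h.2.1.lam hn, fun k hk hnk => ?_⟩
      obtain ⟨h1, h2⟩ := h.2.2 (succ k) hk.succ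
        (hnk.imp (fun e => by rw [e]) fun h => hk.succ_mem_succ h)
      exact ⟨h1.lam hk, hS.2.2.2.1 _ _ _ hk h2⟩
    · exact ⟨hn, .cc hn, fun k hk _ => ⟨.cc hk, hS.2.2.2.2.1 k hk⟩⟩
    · exact ⟨hn, .instr hn hα, fun k hk _ => ⟨.instr hk hα, hS.2.2.2.2.2.2 k α hk hα⟩⟩
    · exact ⟨hn, .cont hn hπ, fun k hk _ => ⟨.cont hk hπ, hS.2.2.2.2.2.1 k π hk hπ⟩⟩
  exact ((hT' _ _).1 (mem_Lam.1 ht T _ hgr)).2.2 k hk (hk.eq_empty_or_mem.imp Eq.symm id)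

theorem exists_substClosed (A B s : M) : ∃ S, SubstClosed A B s S := by
  obtain ⟨U, hU, hl, hn⟩ := exists_universe [A, Stk A B, s]
  have hs : s ∊ U := hl s (by simp)
  have hA : ∀ α, α ∊ A → α ∊ U := fun α h => hU.trans _ _ (hl A (by simp)) h
  have hπ : ∀ α, α ∊ Stk A B → α ∊ U := fun α h => hU.trans _ _ (hl (Stk A B) (by simp)) h
  have tag : ∀ (k : ℕ) {x : M}, x ∊ U → pair (num k) x ∊ U := fun k x hx =>
    hU.pair_mem (hn _ (isNat_num k)) hx
  have inv : ∀ {a b c : M}, triple a b c ∊ U → a ∊ U ∧ b ∊ U ∧ c ∊ U := fun h =>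
    ⟨(hU.of_pair_mem h).1, hU.of_pair_mem (hU.of_pair_mem h).2⟩
  refine ⟨U, fun k hk => hU.triple_mem (hn k hk) (tag 0 (hn k hk)) hs, fun k j hk hj => ?_,
    fun k t r t' r' h1 h2 => hU.triple_mem (inv h1).1
      (tag 1 (hU.pair_mem (inv h1).2.1 (inv h2).2.1))
      (tag 1 (hU.pair_mem (inv h1).2.2 (inv h2).2.2)),
    fun k t r hk h => hU.triple_mem (hn k hk) (tag 2 (inv h).2.1) (tag 2 (inv h).2.2),
    fun k hk => hU.triple_mem (hn k hk) (tag 3 (hn _ isNat_empty)) (tag 3 (hn _ isNat_empty)),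
    fun k π hk h => hU.triple_mem (hn k hk) (tag 4 (hπ π h)) (tag 4 (hπ π h)),
    fun k α hk h => hU.triple_mem (hn k hk) (tag 5 (hA α h)) (tag 5 (hA α h))⟩
  have := hU.trans _ _ (hn k hk) hj
  exact hU.triple_mem (hn k hk) (tag 0 this) (tag 0 this)

theorem IsTerm.weaken {A B t k : M} (ht : t ∊ Lam A B) (hk : IsNat k) : IsTerm A B k t :=
  let ⟨_, hS⟩ := exists_substClosed A B t
  (closed_weaken_and_subst hS ht hk).1

/-! ## Standard terms -/

/-- De Bruijn terms; `close t` is `t` regarded as a closed term. -/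
inductive Tm : Type
  | var (n : ℕ)
  | app (s t : Tm)
  | lam (t : Tm)
  | cc
  | close (t : Tm)

/-- The code in `M` of the term `t` under `d` abstractions, where the remaining free variables are
replaced by the closed terms `ts`, and by `cc` if there are too few of these. -/
noncomputable def code (ts : List M) : ℕ → Tm → M
  | d, .var j => if j < d then tVar (num j) else ts.getD (j - d) tCC
  | d, .app s t => tApp (code ts d s) (code ts d t)
  | d, .lam t => tLam (code ts (d + 1) t)
  | _, .cc => tCC
  | _, .close t => code [] 0 t

theorem tCC_mem (A B : M) : tCC ∊ Lam A B := mem_Lam.2 (.cc isNat_empty)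

theorem getD_mem {A B : M} {ts : List M} (hts : ∀ s ∈ ts, s ∊ Lam A B) (j : ℕ) :
    ts.getD j tCC ∊ Lam A B := by
  rw [List.getD_eq_getElem?_getD]
  cases h : ts[j]? with
  | none => exact tCC_mem A B
  | some s => exact hts s (List.mem_of_getElem? h)

theorem code_isTerm {A B : M} (t : Tm) : ∀ {ts : List M} (_ : ∀ s ∈ ts, s ∊ Lam A B) (d : ℕ),
    IsTerm A B (num d) (code ts d t) := by
  induction t with
  | var j =>
    intro ts hts d
    by_cases h : j < d
    · simpa only [code, h, if_true] using IsTerm.var (isNat_num d) (mem_num_of_lt h)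
    · simpa only [code, h, if_false] using IsTerm.weaken (getD_mem hts _) (isNat_num d)
  | app s t ihs iht => exact fun hts d => (ihs hts d).app (iht hts d)
  | lam t ih => exact fun hts d => (ih hts (d + 1)).lam (isNat_num d)
  | cc => exact fun _ d => .cc (isNat_num d)
  | close t ih => exact fun _ d => IsTerm.weaken (mem_Lam.2 (ih (ts := []) (by simp) 0)) (isNat_num d)

theorem code_mem {A B : M} (t : Tm) {ts : List M} (hts : ∀ s ∈ ts, s ∊ Lam A B) :
    code ts 0 t ∊ Lam A B :=
  mem_Lam.2 (code_isTerm t hts 0)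

/-- Two depths are needed for `close`: its body is coded at depth $0$ but occurs in a context of
size $e$. -/
theorem code_pure {A T : M} (hT : PureTermClosed A T) (t : Tm) : ∀ {d e : ℕ}, d ≤ e →
    pair (num e) (code [] d t) ∊ T := by
  induction t with
  | var j =>
    intro d e hde
    by_cases h : j < d
    · simpa only [code, h, if_true] using hT.1 _ _ (isNat_num e) (mem_num_of_lt (h.trans_le hde))
    · simpa [code, h] using hT.2.2.2.1 _ (isNat_num e)
  | app s t ihs iht => exact fun h => hT.2.1 _ _ _ (ihs h) (iht h)
  | lam t ih => exact fun h => hT.2.2.1 _ _ (isNat_num _) (ih (Nat.succ_le_succ h))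
  | cc => exact fun {d e} _ => hT.2.2.2.1 _ (isNat_num e)
  | close t ih => exact fun {d e} _ => ih (Nat.zero_le e)

theorem code_isRealizer (A : M) (t : Tm) : IsRealizer A (code [] 0 t) :=
  fun _ hT => code_pure hT t (d := 0) le_rfl

/-- Substituting for the variable of index $d$ amounts to prepending $s$ to the list of closed terms
that fill the free variables. -/
theorem code_subst {A B s S : M} (hS : SubstClosed A B s S) (t : Tm) :
    ∀ {ts : List M} (_ : ∀ s ∈ ts, s ∊ Lam A B) (d : ℕ),
    triple (num d) (code ts (d + 1) t) (code (s :: ts) d t) ∊ S := by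
  induction t with
  | var j =>
    intro ts hts d
    rcases lt_trichotomy j d with h | rfl | h
    · simpa only [code, h, Nat.lt_succ_of_lt h, if_true] using
        hS.2.1 _ _ (isNat_num d) (mem_num_of_lt h)
    · simpa [code] using hS.1 _ (isNat_num j)
    -- Beyond $d$ the variable already stands for an entry of `ts`, which is closed and hence
    -- unaffected; prepending $s$ compensates the decrease of the depth.
    · obtain ⟨i, rfl⟩ : ∃ i, j = d + 1 + i := ⟨j - (d + 1), by omega⟩
      have h1 : ¬ d + 1 + i < d := by omega
      have h2 : d + 1 + i - d = i + 1 := by omega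
      simp only [code, h1, h2, if_false, List.getD_cons_succ, Nat.not_lt.2 (Nat.le_add_right _ i),
        Nat.add_sub_cancel_left]
      exact (closed_weaken_and_subst hS (getD_mem hts i) (isNat_num d)).2
  | app s t ihs iht => exact fun hts d => hS.2.2.1 _ _ _ _ _ (ihs hts d) (iht hts d)
  | lam t ih => exact fun hts d => hS.2.2.2.1 _ _ _ (isNat_num d) (ih hts (d + 1))
  | cc => exact fun _ d => hS.2.2.2.2.1 _ (isNat_num d)
  | close t ih =>
    exact fun _ d => (closed_weaken_and_subst hS (code_mem t (by simp)) (isNat_num d)).2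

end Terms

/-! ## Typing and its adequacy -/

namespace RealizabilityAlgebra

variable {M : Type*} [setLang.Structure M] [ModelZF M] (𝒜 : RealizabilityAlgebra M)

theorem falsity_subset (φ : Fml M) : ∀ {π : M}, π ∈ 𝒜.falsity φ → π ∊ 𝒜.Stacks := by
  induction φ with
  | top => exact fun h => h.elim
  | bot => exact fun h => h
  | neps a b => exact fun h => h.1
  | ne a b => exact fun h => h.1
  | nin a b =>
    rintro π ⟨T, F, G, h, ha, hb, hF⟩
    obtain ⟨c, t, t', π, hπ, -, ht, -, ht', -, rfl⟩ := ((h.2 a b ha hb).1 π).1 hF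
    exact sPush_mem ht (sPush_mem ht' hπ)
  | sub a b =>
    rintro π ⟨T, F, G, h, ha, hb, hF⟩
    obtain ⟨c, t, π, hπ, -, ht, -, rfl⟩ := ((h.2 a b ha hb).2 π).1 hF
    exact sPush_mem ht hπ
  | imp φ ψ _ ih =>
    rintro _ ⟨t, π, ht, -, hπ, rfl⟩
    exact sPush_mem ht (ih hπ)
  | all φ ih =>
    rintro π ⟨a, -, h⟩
    exact ih a h
  | allDom c φ ih =>
    rintro π ⟨a, -, h⟩
    exact ih a h

theorem mem_pole_lam {ts : List M} (hts : ∀ s ∈ ts, s ∊ 𝒜.Terms) {t : Tm} {s π : M}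
    (hs : s ∊ 𝒜.Terms) (hπ : π ∊ 𝒜.Stacks) (h : pair (code (s :: ts) 0 t) π ∊ 𝒜.pole) :
    pair (code ts 0 (.lam t)) (sPush s π) ∊ 𝒜.pole :=
  𝒜.pole_up _ _ (𝒜.red_grab _ s _ π (code_mem (.lam t) hts) hs hπ
    fun _ hS => code_subst hS t hts 0) h

theorem mem_pole_app {s t π : M} (hs : s ∊ 𝒜.Terms) (ht : t ∊ 𝒜.Terms) (hπ : π ∊ 𝒜.Stacks)
    (h : pair s (sPush t π) ∊ 𝒜.pole) : pair (tApp s t) π ∊ 𝒜.pole :=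
  𝒜.pole_up _ _ (𝒜.red_push s t π hs ht hπ) h

theorem tApp_mem {s t : M} (hs : s ∊ 𝒜.Terms) (ht : t ∊ 𝒜.Terms) : tApp s t ∊ 𝒜.Terms :=
  mem_Lam.2 ((mem_Lam.1 hs).app (mem_Lam.1 ht))

theorem tCont_mem {π : M} (hπ : π ∊ 𝒜.Stacks) : tCont π ∊ 𝒜.Terms :=
  mem_Lam.2 (.cont isNat_empty hπ)

theorem verity_app {φ ψ : Fml M} {s t : M} (hs : s ∈ 𝒜.verity (φ ⟹ ψ)) (ht : t ∈ 𝒜.verity φ) :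
    tApp s t ∈ 𝒜.verity ψ :=
  ⟨𝒜.tApp_mem hs.1 ht.1, fun π hπ => 𝒜.mem_pole_app hs.1 ht.1 (𝒜.falsity_subset ψ hπ)
    (hs.2 _ ⟨t, π, ht.1, ht.2, hπ, rfl⟩)⟩

/-- For $\pi\in\|\varphi\|$ the continuation $k_\pi$ realizes $\varphi\to\psi$: it discards its
stack and runs its argument against $\pi$. -/
theorem verity_cc (φ ψ : Fml M) : tCC ∈ 𝒜.verity (((φ ⟹ ψ) ⟹ φ) ⟹ φ) := by
  refine ⟨tCC_mem _ _, ?_⟩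
  rintro _ ⟨t, π, ht, h, hπ, rfl⟩
  have hπ' := 𝒜.falsity_subset φ hπ
  refine 𝒜.pole_up _ _ (𝒜.red_save t π ht hπ') (h _ ⟨tCont π, π, 𝒜.tCont_mem hπ', ?_, hπ, rfl⟩)
  rintro _ ⟨s, σ, hs, hs', hσ, rfl⟩
  exact 𝒜.pole_up _ _ (𝒜.red_restore s σ π hs (𝒜.falsity_subset ψ hσ) hπ') (hs' π hπ)

/-- The term `t` realizes `φ` whenever realizers of the formulas `Γ` are substituted for its
free variables. -/
def Ty (Γ : List (Fml M)) (t : Tm) (φ : Fml M) : Prop :=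
  ∀ ts : List M, List.Forall₂ (fun s ψ => s ∈ 𝒜.verity ψ) ts Γ → code ts 0 t ∈ 𝒜.verity φ

variable {𝒜}

theorem terms_of_forall₂ {ts : List M} {Γ : List (Fml M)}
    (h : List.Forall₂ (fun s ψ => s ∈ 𝒜.verity ψ) ts Γ) : ∀ s ∈ ts, s ∊ 𝒜.Terms := by
  induction h with
  | nil => simp
  | cons h _ ih => simpa using ⟨h.1, ih⟩

namespace Ty

variable {Γ : List (Fml M)} {s t : Tm} {φ ψ χ : Fml M}

theorem forces (h : 𝒜.Ty [] t φ) : 𝒜.Forces φ :=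
  ⟨_, code_isRealizer _ t, h [] .nil⟩

/-- Subtyping: a smaller falsity value is realized by the same term. This is how facts of the ground
model enter derivations at no cost to the term. -/
theorem of_falsity_subset (h : 𝒜.Ty Γ t φ) (e : 𝒜.falsity ψ ⊆ 𝒜.falsity φ) : 𝒜.Ty Γ t ψ :=
  fun ts hts => ⟨(h ts hts).1, fun π hπ => (h ts hts).2 π (e hπ)⟩

theorem of_falsity_eq_empty (e : 𝒜.falsity φ = ∅) : 𝒜.Ty Γ t φ :=
  fun _ hts => ⟨code_mem t (terms_of_forall₂ hts), fun π hπ => by simp [e] at hπ⟩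

theorem var (n : ℕ) (h : Γ[n]? = some φ) : 𝒜.Ty Γ (.var n) φ := by
  intro ts hts
  have : ∀ {ts : List M} {Γ : List (Fml M)}, List.Forall₂ (fun s ψ => s ∈ 𝒜.verity ψ) ts Γ →
      ∀ n, Γ[n]? = some φ → ts.getD n tCC ∈ 𝒜.verity φ := by
    intro ts Γ h
    induction h with
    | nil => simp
    | cons hs _ ih =>
      intro n
      cases n with
      | zero => simp only [List.getElem?_cons_zero, Option.some.injEq, List.getD_cons_zero]
                rintro rfl; exact hs
      | succ n => simpa using ih n
  simpa [code] using this hts n h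

theorem app (hs : 𝒜.Ty Γ s (φ ⟹ ψ)) (ht : 𝒜.Ty Γ t φ) : 𝒜.Ty Γ (.app s t) ψ :=
  fun ts hts => 𝒜.verity_app (hs ts hts) (ht ts hts)

theorem lam (h : 𝒜.Ty (φ :: Γ) t ψ) : 𝒜.Ty Γ (.lam t) (φ ⟹ ψ) := by
  intro ts hts
  have hts' := terms_of_forall₂ hts
  refine ⟨code_mem (.lam t) hts', ?_⟩
  rintro _ ⟨s, π, hs, hs', hπ, rfl⟩
  exact 𝒜.mem_pole_lam hts' hs (𝒜.falsity_subset ψ hπ) ((h (s :: ts) (.cons ⟨hs, hs'⟩ hts)).2 π hπ)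

theorem cc : 𝒜.Ty Γ .cc (((φ ⟹ ψ) ⟹ φ) ⟹ φ) := fun _ _ => 𝒜.verity_cc φ ψ

theorem close (h : 𝒜.Ty [] t φ) : 𝒜.Ty Γ (.close t) φ := fun _ _ => h [] .nil

/-- One term must serve all names. For this reason the realizability lemmas below take the form `∃
t, ∀ a, ...`, with the term chosen before the parameters. -/
theorem allI {φ : M → Fml M} (h : ∀ a, 𝒜.IsName a → 𝒜.Ty Γ t (φ a)) : 𝒜.Ty Γ t (.all φ) :=
  fun ts hts => ⟨code_mem t (terms_of_forall₂ hts), fun π ⟨a, ha, hπ⟩ => (h a ha ts hts).2 π hπ⟩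

theorem allE {φ : M → Fml M} (h : 𝒜.Ty Γ t (.all φ)) {a : M} (ha : 𝒜.IsName a) :
    𝒜.Ty Γ t (φ a) :=
  h.of_falsity_subset fun _ hπ => ⟨a, ha, hπ⟩

theorem allDomI {c : M} {φ : M → Fml M} (h : ∀ a, (∃ σ, pair a σ ∊ c) → 𝒜.Ty Γ t (φ a)) :
    𝒜.Ty Γ t (.allDom c φ) :=
  fun ts hts => ⟨code_mem t (terms_of_forall₂ hts), fun π ⟨a, ha, hπ⟩ => (h a ha ts hts).2 π hπ⟩

theorem allDomE {c : M} {φ : M → Fml M} (h : 𝒜.Ty Γ t (.allDom c φ)) {a : M}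
    (ha : ∃ σ, pair a σ ∊ c) : 𝒜.Ty Γ t (φ a) :=
  h.of_falsity_subset fun _ hπ => ⟨a, ha, hπ⟩

theorem exfalso (h : 𝒜.Ty Γ t .bot) : 𝒜.Ty Γ t φ :=
  h.of_falsity_subset fun _ hπ => 𝒜.falsity_subset φ hπ

theorem top : 𝒜.Ty Γ t .top := of_falsity_eq_empty rfl

theorem byContra (h : 𝒜.Ty ((φ ⟹ .bot) :: Γ) t .bot) : 𝒜.Ty Γ (.app .cc (.lam t)) φ :=
  app cc (lam h.exfalso)

theorem v0 : 𝒜.Ty (φ :: Γ) (.var 0) φ := var 0 rfl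
theorem v1 {a : Fml M} : 𝒜.Ty (a :: φ :: Γ) (.var 1) φ := var 1 rfl
theorem v2 {a b : Fml M} : 𝒜.Ty (a :: b :: φ :: Γ) (.var 2) φ := var 2 rfl
theorem v3 {a b c : Fml M} : 𝒜.Ty (a :: b :: c :: φ :: Γ) (.var 3) φ := var 3 rfl
theorem v4 {a b c d : Fml M} : 𝒜.Ty (a :: b :: c :: d :: φ :: Γ) (.var 4) φ := var 4 rfl
theorem v5 {a b c d e : Fml M} : 𝒜.Ty (a :: b :: c :: d :: e :: φ :: Γ) (.var 5) φ := var 5 rfl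
theorem v6 {a b c d e f : Fml M} : 𝒜.Ty (a :: b :: c :: d :: e :: f :: φ :: Γ) (.var 6) φ :=
  var 6 rfl
theorem v7 {a b c d e f g : Fml M} :
    𝒜.Ty (a :: b :: c :: d :: e :: f :: g :: φ :: Γ) (.var 7) φ := var 7 rfl

end Ty
end RealizabilityAlgebra

set_option synthInstance.maxSize 10000
set_option synthInstance.maxHeartbeats 400000

/-! ### Membership induction and bounded comprehension -/

section Induction

variable {M : Type*} [setLang.Structure M] [ModelZF M]

/-- A minimal counterexample exists inside a transitive set containing $x$. -/
theorem mem_induction (P : M → Prop) [Dfn fun v => P (v 0)] (h : ∀ x, (∀ y, y ∊ x → P y) → P x)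
    (x : M) : P x := by
  by_contra hx
  obtain ⟨U, hxU, hU⟩ := exists_universe_mem x
  obtain ⟨y, hy, hP, hmin⟩ := exists_minimal (fun x => ¬ P x) U ⟨x, hxU, hx⟩
  exact hP (h y fun z hz => not_not.1 (hmin z hz (hU.trans y z hy hz)))

theorem mem_compr_of_list {D : M → Prop} [Dfn fun v => D (v 0)] (l : List M)
    (h : ∀ U : M, IsUniverse U → (∀ x ∈ l, x ∊ U) → (∀ k : ℕ, num k ∊ U) → ∀ x, D x → x ∊ U)
    (x : M) : x ∊ compr D ↔ D x := by
  obtain ⟨U, hU, hl, hn⟩ := exists_universe l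
  exact mem_compr_of_bound U (h U hU hl fun k => hn _ (isNat_num k)) x

theorem exists_set_of_list {D : M → Prop} [Dfn fun v => D (v 0)] (l : List M)
    (h : ∀ U : M, IsUniverse U → (∀ x ∈ l, x ∊ U) → (∀ k : ℕ, num k ∊ U) → ∀ x, D x → x ∊ U) :
    ∃ s : M, ∀ x, x ∊ s ↔ D x :=
  ⟨compr D, mem_compr_of_list l h⟩

theorem IsUniverse.sPush_mem {U t π : M} (hU : IsUniverse U) (hn : ∀ k : ℕ, (num k : M) ∊ U)
    (ht : t ∊ U) (hπ : π ∊ U) : sPush t π ∊ U :=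
  hU.pair_mem (hn 7) (hU.pair_mem ht hπ)

end Induction

namespace RealizabilityAlgebra

variable {M : Type*} [setLang.Structure M] [ModelZF M] (𝒜 : RealizabilityAlgebra M)

/-! ## Names -/

instance {F : (ℕ → M) → M} [hF : DfnF F] : Dfn fun v => 𝒜.IsName (F v) :=
  Dfn.comp1 (by unfold IsName; infer_instance) hF

variable {𝒜} in
theorem IsName.of_mem {a c π : M} (h : 𝒜.IsName a) (hc : pair c π ∊ a) :
    𝒜.IsName c ∧ π ∊ 𝒜.Stacks := by
  obtain ⟨T, ha, hT⟩ := h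
  obtain ⟨c', π', hc', hπ', e⟩ := hT a _ ha hc
  obtain ⟨rfl, rfl⟩ := pair_inj.1 e
  exact ⟨⟨T, hc', hT⟩, hπ'⟩

theorem isName_of_forall {a : M}
    (h : ∀ z, z ∊ a → ∃ c π, 𝒜.IsName c ∧ π ∊ 𝒜.Stacks ∧ z = pair c π) : 𝒜.IsName a := by
  obtain ⟨U, haU, hU⟩ := exists_universe_mem a
  obtain ⟨T, hT⟩ := exists_sep
    (fun b => ∀ z : M, z ∊ b → ∃ c π : M, 𝒜.IsName c ∧ π ∊ 𝒜.Stacks ∧ z = pair c π) U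
  refine ⟨T, (hT a).2 ⟨haU, h⟩, fun b z hb hz => ?_⟩
  obtain ⟨hbU, hb⟩ := (hT b).1 hb
  obtain ⟨c, π, hc, hπ, rfl⟩ := hb z hz
  refine ⟨c, π, (hT c).2 ⟨(hU.of_pair_mem (hU.trans _ _ hbU hz)).1, fun z' hz' => ?_⟩, hπ, rfl⟩
  obtain ⟨T', hc', hT'⟩ := hc
  obtain ⟨c', π', h1, h2, h3⟩ := hT' c z' hc' hz'
  exact ⟨c', π', ⟨T', h1, hT'⟩, h2, h3⟩

theorem dom_induction (P : M → Prop) [Dfn fun v => P (v 0)]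
    (h : ∀ a, (∀ c π, pair c π ∊ a → P c) → P a) (a : M) : P a := by
  -- With Kuratowski pairs, $c$ lies three membership steps below a set containing $(c,\pi)$, so the
  -- induction carries the property two levels down.
  suffices ∀ x : M, P x ∧ ∀ y, y ∊ x → P y ∧ ∀ z, z ∊ y → P z from (this a).1
  refine mem_induction (fun x : M => P x ∧ ∀ y, y ∊ x → P y ∧ ∀ z, z ∊ y → P z) fun x hx => ?_
  refine ⟨h x fun c π hc => ?_, fun y hy => ⟨(hx y hy).1, fun z hz => ((hx y hy).2 z hz).1⟩⟩
  exact ((hx _ hc).2 (upair c c) (mem_upair.2 (Or.inl rfl))).2 c (mem_upair.2 (Or.inl rfl))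

/-- Induction along the domains of names. -/
theorem name_induction (P : M → Prop) [Dfn fun v => P (v 0)]
    (h : ∀ a, 𝒜.IsName a → (∀ c π, pair c π ∊ a → P c) → P a) {a : M} (ha : 𝒜.IsName a) : P a :=
  dom_induction (fun a => 𝒜.IsName a → P a)
    (fun a ih ha => h a ha fun c π hc => ih c π hc (ha.of_mem hc).1) a ha

/-! ## The atomic formulas -/

/-- One step of the recursive definition of `‖a ⊆ b‖`. -/
def SubStep (Q : M → M → M → Prop) (a b ρ : M) : Prop :=
  ∃ c t π, π ∊ 𝒜.Stacks ∧ pair c π ∊ a ∧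
    t ∊ 𝒜.Terms ∧ (∀ σ, Q c b σ → pair t σ ∊ 𝒜.pole) ∧ ρ = sPush t π

/-- One step of the recursive definition of `‖a ∉ b‖`. -/
def NinStep (Q : M → M → M → Prop) (a b ρ : M) : Prop :=
  ∃ c t t' π, π ∊ 𝒜.Stacks ∧ pair c π ∊ b ∧
    t ∊ 𝒜.Terms ∧ (∀ σ, Q a c σ → pair t σ ∊ 𝒜.pole) ∧
    t' ∊ 𝒜.Terms ∧ (∀ σ, Q c a σ → pair t' σ ∊ 𝒜.pole) ∧ ρ = sPush t (sPush t' π)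

variable {𝒜}

/-- The step is antitone in `Q`, since `Q` bounds a universal quantifier over stacks. The composite
of the two steps is therefore monotone. -/
theorem SubStep.mono {Q Q' : M → M → M → Prop} {a b ρ : M}
    (h : ∀ c π, pair c π ∊ a → ∀ σ, Q' c b σ → Q c b σ) (H : 𝒜.SubStep Q a b ρ) :
    𝒜.SubStep Q' a b ρ := by
  obtain ⟨c, t, π, hπ, hc, ht, ht', rfl⟩ := H
  exact ⟨c, t, π, hπ, hc, ht, fun σ hσ => ht' σ (h c π hc σ hσ), rfl⟩

theorem NinStep.mono {Q Q' : M → M → M → Prop} {a b ρ : M}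
    (h : ∀ c π, pair c π ∊ b → ∀ σ, (Q' a c σ → Q a c σ) ∧ (Q' c a σ → Q c a σ))
    (H : 𝒜.NinStep Q a b ρ) : 𝒜.NinStep Q' a b ρ := by
  obtain ⟨c, t, t', π, hπ, hc, ht, ht', hs, hs', rfl⟩ := H
  exact ⟨c, t, t', π, hπ, hc, ht, fun σ hσ => ht' σ ((h c π hc σ).1 hσ), hs,
    fun σ hσ => hs' σ ((h c π hc σ).2 hσ), rfl⟩

instance {F G H : (ℕ → M) → M} [hF : DfnF F] [hG : DfnF G] [hH : DfnF H] :
    Dfn fun v => 𝒜.AtomicApprox (F v) (G v) (H v) :=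
  Dfn.comp3 (by unfold AtomicApprox; infer_instance) hF hG hH

variable (𝒜) in
-- A fixed point in the style of Knaster and Tarski replaces recursion: $F$ is the least set closed
-- under the monotone operator `NinStep ∘ SubStep`, and $G$ is obtained from $F$ by one further
-- step.
theorem exists_atomicApprox {T : M} (hT : ∀ a c π, a ∊ T → pair c π ∊ a → c ∊ T) :
    ∃ F G, 𝒜.AtomicApprox T F G := by
  obtain ⟨U, hU, hl, hn⟩ := exists_universe [T, 𝒜.Terms, 𝒜.Stacks]
  have hn' : ∀ k : ℕ, (num k : M) ∊ U := fun k => hn _ (isNat_num k)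
  have hTU : ∀ a, a ∊ T → a ∊ U := fun a => hU.trans _ _ (hl T (by simp))
  have htU : ∀ a, a ∊ 𝒜.Terms → a ∊ U := fun a => hU.trans _ _ (hl _ (by simp))
  have hsU : ∀ a, a ∊ 𝒜.Stacks → a ∊ U := fun a => hU.trans _ _ (hl _ (by simp))
  let m : M → M → M → M → Prop := fun F a b ρ => triple a b ρ ∊ F
  have subU : ∀ {Q a b ρ}, a ∊ T → b ∊ T → 𝒜.SubStep Q a b ρ → triple a b ρ ∊ U := by
    rintro Q a b ρ ha hb ⟨c, t, π, hπ, hc, ht, ht', rfl⟩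
    exact hU.triple_mem (hTU a ha) (hTU b hb) (hU.sPush_mem hn' (htU t ht) (hsU π hπ))
  have ninU : ∀ {Q a b ρ}, a ∊ T → b ∊ T → 𝒜.NinStep Q a b ρ → triple a b ρ ∊ U := by
    rintro Q a b ρ ha hb ⟨c, t, t', π, hπ, hc, ht, -, ht', -, rfl⟩
    exact hU.triple_mem (hTU a ha) (hTU b hb) (hU.sPush_mem hn' (htU t ht)
      (hU.sPush_mem hn' (htU t' ht') (hsU π hπ)))
  have mono : ∀ {F F' a b ρ}, (∀ z, z ∊ F → z ∊ F') → 𝒜.NinStep (𝒜.SubStep (m F)) a b ρ →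
      𝒜.NinStep (𝒜.SubStep (m F')) a b ρ := fun h =>
    NinStep.mono fun c π hc σ => ⟨SubStep.mono fun _ _ _ _ => h _, SubStep.mono fun _ _ _ _ => h _⟩
  let Pre : M → Prop := fun F => ∀ a b ρ : M, a ∊ T → b ∊ T →
    𝒜.NinStep (𝒜.SubStep (m F)) a b ρ → triple a b ρ ∊ F
  have hPreU : Pre U := fun a b ρ ha hb h => ninU ha hb h
  have : Dfn fun v => Pre (v 0) := by
    simp only [Pre, NinStep, SubStep, m]; infer_instance
  have : ∀ {i}, Dfn fun v => Pre (v i) := fun {i} => Dfn.comp1 this DfnF.var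
  obtain ⟨F, hF⟩ := exists_sep (fun z : M => ∀ F : M, Pre F → z ∊ F) U
  have hF' : ∀ z, z ∊ F ↔ ∀ F : M, Pre F → z ∊ F := fun z =>
    (hF z).trans ⟨fun h => h.2, fun h => ⟨h U hPreU, h⟩⟩
  have hPreF : Pre F := fun a b ρ ha hb h => (hF' _).2 fun F' hF'' =>
    hF'' a b ρ ha hb (mono (fun z hz => (hF' z).1 hz F' hF'') h)
  -- The image $F_1$ of $F$ is itself closed, so by minimality $F\subseteq F_1$, which is the other
  -- half of the fixed-point equation.
  obtain ⟨F₁, hF₁⟩ := exists_sep (fun z : M => ∃ a b ρ : M, z = triple a b ρ ∧ a ∊ T ∧ b ∊ T ∧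
    𝒜.NinStep (𝒜.SubStep (m F)) a b ρ) U (h := by simp only [NinStep, SubStep, m]; infer_instance)
  have hF₁F : ∀ z, z ∊ F₁ → z ∊ F := by
    intro z hz
    obtain ⟨-, a, b, ρ, rfl, ha, hb, h⟩ := (hF₁ z).1 hz
    exact hPreF a b ρ ha hb h
  have hPreF₁ : Pre F₁ := fun a b ρ ha hb h =>
    (hF₁ _).2 ⟨ninU ha hb h, a, b, ρ, rfl, ha, hb, mono hF₁F h⟩
  have fix : ∀ a b ρ, a ∊ T → b ∊ T →
      (triple a b ρ ∊ F ↔ 𝒜.NinStep (𝒜.SubStep (m F)) a b ρ) := by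
    intro a b ρ ha hb
    refine ⟨fun h => ?_, hPreF a b ρ ha hb⟩
    obtain ⟨-, a', b', ρ', e, -, -, h'⟩ := (hF₁ _).1 ((hF' _).1 h F₁ hPreF₁)
    obtain ⟨rfl, rfl, rfl⟩ := triple_inj.1 e
    exact h'
  obtain ⟨G, hG⟩ := exists_sep (fun z : M => ∃ a b ρ : M, z = triple a b ρ ∧ a ∊ T ∧ b ∊ T ∧
    𝒜.SubStep (m F) a b ρ) U (h := by simp only [SubStep, m]; infer_instance)
  have hG' : ∀ a b ρ, a ∊ T → b ∊ T → (triple a b ρ ∊ G ↔ 𝒜.SubStep (m F) a b ρ) := by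
    intro a b ρ ha hb
    rw [hG]
    constructor
    · rintro ⟨-, a', b', ρ', e, -, -, h'⟩
      obtain ⟨rfl, rfl, rfl⟩ := triple_inj.1 e
      exact h'
    · exact fun h => ⟨subU ha hb h, a, b, ρ, rfl, ha, hb, h⟩
  refine ⟨F, G, hT, fun a b ha hb => ⟨fun ρ => ?_, fun ρ => hG' a b ρ ha hb⟩⟩
  rw [fix a b ρ ha hb]
  change _ ↔ 𝒜.NinStep (m G) a b ρ
  have key : ∀ c π, pair c π ∊ b → ∀ σ,
      (m G a c σ ↔ 𝒜.SubStep (m F) a c σ) ∧ (m G c a σ ↔ 𝒜.SubStep (m F) c a σ) :=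
    fun c π hc σ => ⟨hG' a c σ ha (hT b c π hb hc), hG' c a σ (hT b c π hb hc) ha⟩
  exact ⟨NinStep.mono fun c π hc σ => ⟨(key c π hc σ).1.1, (key c π hc σ).2.1⟩,
    NinStep.mono fun c π hc σ => ⟨(key c π hc σ).1.2, (key c π hc σ).2.2⟩⟩

section Approx

variable {T F G T' F' G' : M}

theorem AtomicApprox.nin_iff (h : 𝒜.AtomicApprox T F G) {a b ρ : M} (ha : a ∊ T) (hb : b ∊ T) :
    triple a b ρ ∊ F ↔ 𝒜.NinStep (fun a b σ => triple a b σ ∊ G) a b ρ := (h.2 a b ha hb).1 ρ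

theorem AtomicApprox.sub_iff (h : 𝒜.AtomicApprox T F G) {a b ρ : M} (ha : a ∊ T) (hb : b ∊ T) :
    triple a b ρ ∊ G ↔ 𝒜.SubStep (fun a b σ => triple a b σ ∊ F) a b ρ := (h.2 a b ha hb).2 ρ

/-- Nested induction on $a$ and $b$. Both orders of the arguments are treated together because
$a\notin b$ refers to $a\subseteq c$ and to $c\subseteq a$. -/
theorem AtomicApprox.unique (h : 𝒜.AtomicApprox T F G) (h' : 𝒜.AtomicApprox T' F' G') (a : M) :
    a ∊ T → a ∊ T' → ∀ b, b ∊ T → b ∊ T' → ∀ ρ,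
      ((triple a b ρ ∊ F ↔ triple a b ρ ∊ F') ∧ (triple a b ρ ∊ G ↔ triple a b ρ ∊ G')) ∧
      ((triple b a ρ ∊ F ↔ triple b a ρ ∊ F') ∧ (triple b a ρ ∊ G ↔ triple b a ρ ∊ G')) := by
  refine dom_induction (fun a : M => a ∊ T → a ∊ T' → ∀ b : M, b ∊ T → b ∊ T' → ∀ ρ : M,
      ((triple a b ρ ∊ F ↔ triple a b ρ ∊ F') ∧ (triple a b ρ ∊ G ↔ triple a b ρ ∊ G')) ∧
      ((triple b a ρ ∊ F ↔ triple b a ρ ∊ F') ∧ (triple b a ρ ∊ G ↔ triple b a ρ ∊ G')))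
      ?_ a
  intro a iha ha ha' b
  refine dom_induction (fun b : M => b ∊ T → b ∊ T' → ∀ ρ : M,
      ((triple a b ρ ∊ F ↔ triple a b ρ ∊ F') ∧ (triple a b ρ ∊ G ↔ triple a b ρ ∊ G')) ∧
      ((triple b a ρ ∊ F ↔ triple b a ρ ∊ F') ∧ (triple b a ρ ∊ G ↔ triple b a ρ ∊ G')))
      ?_ b
  intro b ihb hb hb' ρ
  have ea := fun c π (hc : pair c π ∊ a) σ =>
    iha c π hc (h.1 a c π ha hc) (h'.1 a c π ha' hc) b hb hb' σ
  have eb := fun c π (hc : pair c π ∊ b) σ => ihb c π hc (h.1 b c π hb hc) (h'.1 b c π hb' hc) σ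
  rw [h.nin_iff ha hb, h'.nin_iff ha' hb', h.sub_iff ha hb, h'.sub_iff ha' hb',
    h.nin_iff hb ha, h'.nin_iff hb' ha', h.sub_iff hb ha, h'.sub_iff hb' ha']
  refine ⟨⟨⟨?_, ?_⟩, ?_, ?_⟩, ⟨?_, ?_⟩, ?_, ?_⟩
  · exact NinStep.mono fun c π hc σ => ⟨(eb c π hc σ).1.2.2, (eb c π hc σ).2.2.2⟩
  · exact NinStep.mono fun c π hc σ => ⟨(eb c π hc σ).1.2.1, (eb c π hc σ).2.2.1⟩
  · exact SubStep.mono fun c π hc σ => (ea c π hc σ).1.1.2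
  · exact SubStep.mono fun c π hc σ => (ea c π hc σ).1.1.1
  · exact NinStep.mono fun c π hc σ => ⟨(ea c π hc σ).2.2.2, (ea c π hc σ).1.2.2⟩
  · exact NinStep.mono fun c π hc σ => ⟨(ea c π hc σ).2.2.1, (ea c π hc σ).1.2.1⟩
  · exact SubStep.mono fun c π hc σ => (eb c π hc σ).2.1.2
  · exact SubStep.mono fun c π hc σ => (eb c π hc σ).2.1.1

theorem AtomicApprox.mem_nin (h : 𝒜.AtomicApprox T F G) {a b : M} (ha : a ∊ T) (hb : b ∊ T)
    (ρ : M) : ρ ∈ 𝒜.falsity (.nin a b) ↔ triple a b ρ ∊ F :=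
  ⟨fun ⟨_, _, _, h', ha', hb', hρ⟩ => (h'.unique h a ha' ha b hb' hb ρ).1.1.1 hρ,
    fun hρ => ⟨T, F, G, h, ha, hb, hρ⟩⟩

theorem AtomicApprox.mem_sub (h : 𝒜.AtomicApprox T F G) {a b : M} (ha : a ∊ T) (hb : b ∊ T)
    (ρ : M) : ρ ∈ 𝒜.falsity (.sub a b) ↔ triple a b ρ ∊ G :=
  ⟨fun ⟨_, _, _, h', ha', hb', hρ⟩ => (h'.unique h a ha' ha b hb' hb ρ).1.2.1 hρ,
    fun hρ => ⟨T, F, G, h, ha, hb, hρ⟩⟩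

end Approx

theorem exists_approx {a b : M} (ha : 𝒜.IsName a) (hb : 𝒜.IsName b) :
    ∃ T F G, 𝒜.AtomicApprox T F G ∧ a ∊ T ∧ b ∊ T := by
  obtain ⟨T₁, ha, h₁⟩ := ha
  obtain ⟨T₂, hb, h₂⟩ := hb
  obtain ⟨T, hT⟩ := exists_union2 T₁ T₂
  have key : ∀ {T₀ : M}, (∀ b z, b ∊ T₀ → z ∊ b → ∃ c π, c ∊ T₀ ∧ π ∊ 𝒜.Stacks ∧ z = pair c π) →
      ∀ a c π, a ∊ T₀ → pair c π ∊ a → c ∊ T₀ := by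
    intro T₀ h a c π ha hc
    obtain ⟨c', π', hc', -, e⟩ := h a _ ha hc
    exact (pair_inj.1 e).1 ▸ hc'
  obtain ⟨F, G, h⟩ := 𝒜.exists_atomicApprox (T := T) fun a c π ha hc => (hT c).2
    (((hT a).1 ha).imp (fun ha => key h₁ a c π ha hc) fun ha => key h₂ a c π ha hc)
  exact ⟨T, F, G, h, (hT a).2 (Or.inl ha), (hT b).2 (Or.inr hb)⟩

theorem falsity_sub {a b : M} (ha : 𝒜.IsName a) (hb : 𝒜.IsName b) :
    𝒜.falsity (.sub a b) = 𝒜.falsity (.all fun c => .nin c b ⟹ .neps c a) := by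
  obtain ⟨T, F, G, h, haT, hbT⟩ := exists_approx ha hb
  ext ρ
  rw [h.mem_sub haT hbT, h.sub_iff haT hbT]
  constructor
  · rintro ⟨c, t, π, hπ, hc, ht, ht', rfl⟩
    exact ⟨c, (ha.of_mem hc).1, t, π, ht, fun σ hσ =>
      ht' σ ((h.mem_nin (h.1 a c π haT hc) hbT σ).1 hσ), ⟨hπ, hc⟩, rfl⟩
  · rintro ⟨c, -, t, π, ht, ht', ⟨hπ, hc⟩, rfl⟩
    exact ⟨c, t, π, hπ, hc, ht, fun σ hσ =>
      ht' σ ((h.mem_nin (h.1 a c π haT hc) hbT σ).2 hσ), rfl⟩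

theorem falsity_nin {a b : M} (ha : 𝒜.IsName a) (hb : 𝒜.IsName b) :
    𝒜.falsity (.nin a b) =
      𝒜.falsity (.all fun c => .sub a c ⟹ .sub c a ⟹ .neps c b) := by
  obtain ⟨T, F, G, h, haT, hbT⟩ := exists_approx ha hb
  ext ρ
  rw [h.mem_nin haT hbT, h.nin_iff haT hbT]
  constructor
  · rintro ⟨c, t, t', π, hπ, hc, ht, ht', hs, hs', rfl⟩
    have hcT := h.1 b c π hbT hc
    exact ⟨c, (hb.of_mem hc).1, t, _, ht, fun σ hσ => ht' σ ((h.mem_sub haT hcT σ).1 hσ),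
      ⟨t', π, hs, fun σ hσ => hs' σ ((h.mem_sub hcT haT σ).1 hσ), ⟨hπ, hc⟩, rfl⟩, rfl⟩
  · rintro ⟨c, -, t, _, ht, ht', ⟨t', π, hs, hs', ⟨hπ, hc⟩, rfl⟩, rfl⟩
    have hcT := h.1 b c π hbT hc
    exact ⟨c, t, t', π, hπ, hc, ht, fun σ hσ => ht' σ ((h.mem_sub haT hcT σ).2 hσ), hs,
      fun σ hσ => hs' σ ((h.mem_sub hcT haT σ).2 hσ), rfl⟩

/-! ## Definability of falsity values -/

variable (𝒜) in
/-- The falsity values of the formulas `φ v` form a definable family. -/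
class DFml (φ : (ℕ → M) → Fml M) : Prop where
  out : Dfn fun v => v 0 ∈ 𝒜.falsity (φ fun i => v (i + 1))

instance {F : (ℕ → M) → M} {φ : (ℕ → M) → Fml M} [hF : DfnF F] [hφ : 𝒜.DFml φ] :
    Dfn fun v => F v ∈ 𝒜.falsity (φ v) :=
  haveI := hF.out
  haveI := hφ.out
  Dfn.congr (P := fun v => ∃ x, x = F v ∧ x ∈ 𝒜.falsity (φ v)) inferInstance fun _ => by simp

instance {F : (ℕ → M) → M} {φ : (ℕ → M) → Fml M} [hF : DfnF F] [hφ : 𝒜.DFml φ] :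
    Dfn fun v => F v ∈ 𝒜.verity (φ v) := by
  have h1 : Dfn fun v => v 0 ∈ 𝒜.falsity (φ fun i => v (i + 1)) := hφ.out
  have h2 := hF.shift
  exact inferInstanceAs
    (Dfn fun v => F v ∊ 𝒜.Terms ∧ ∀ π, π ∈ 𝒜.falsity (φ v) → pair (F v) π ∊ 𝒜.pole)

namespace DFml

variable {F G : (ℕ → M) → M} [hF : DfnF F] [hG : DfnF G] {φ ψ : (ℕ → M) → Fml M}

instance bot : 𝒜.DFml fun _ => .bot := ⟨inferInstanceAs (Dfn fun v => v 0 ∊ 𝒜.Stacks)⟩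

instance neps : 𝒜.DFml fun v => .neps (F v) (G v) :=
  haveI := hF.shift
  haveI := hG.shift
  ⟨inferInstanceAs (Dfn fun v => v 0 ∊ 𝒜.Stacks ∧
    pair (F fun i => v (i + 1)) (v 0) ∊ G fun i => v (i + 1))⟩

instance nin : 𝒜.DFml fun v => .nin (F v) (G v) := by
  have : Dfn fun v : ℕ → M => v 0 ∈ 𝒜.falsity (.nin (v 1) (v 2)) :=
    inferInstanceAs (Dfn fun v => ∃ T F G : M, 𝒜.AtomicApprox T F G ∧ v 1 ∊ T ∧ v 2 ∊ T ∧
      triple (v 1) (v 2) (v 0) ∊ F)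
  exact ⟨Dfn.comp3 (P := fun π a b => π ∈ 𝒜.falsity (.nin a b)) this DfnF.var hF.shift hG.shift⟩

instance sub : 𝒜.DFml fun v => .sub (F v) (G v) := by
  have : Dfn fun v : ℕ → M => v 0 ∈ 𝒜.falsity (.sub (v 1) (v 2)) :=
    inferInstanceAs (Dfn fun v => ∃ T F G : M, 𝒜.AtomicApprox T F G ∧ v 1 ∊ T ∧ v 2 ∊ T ∧
      triple (v 1) (v 2) (v 0) ∊ G)
  exact ⟨Dfn.comp3 (P := fun π a b => π ∈ 𝒜.falsity (.sub a b)) this DfnF.var hF.shift hG.shift⟩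

theorem relabel (h : 𝒜.DFml φ) (g : ℕ → ℕ) : 𝒜.DFml fun v => φ fun i => v (g i) :=
  ⟨h.out.relabel fun i => Nat.casesOn i 0 fun j => g j + 1⟩

instance imp [hφ : 𝒜.DFml φ] [hψ : 𝒜.DFml ψ] : 𝒜.DFml fun v => φ v ⟹ ψ v := by
  have h1 := hφ.relabel fun i => i + 3
  have h2 := hψ.relabel fun i => i + 3
  refine ⟨?_⟩
  change Dfn fun v => ∃ t π : M, t ∊ 𝒜.Terms ∧
    (∀ σ : M, σ ∈ 𝒜.falsity (φ fun i => v (i + 1)) → pair t σ ∊ 𝒜.pole) ∧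
    π ∈ 𝒜.falsity (ψ fun i => v (i + 1)) ∧ v 0 = sPush t π
  have h1 : Dfn fun v => v 0 ∈ 𝒜.falsity (φ fun i => v (i + 1 + 1 + 1 + 1)) :=
    hφ.out.relabel fun i => Nat.casesOn i 0 fun j => j + 4
  have h2 : Dfn fun v => v 0 ∈ 𝒜.falsity (ψ fun i => v (i + 1 + 1 + 1)) :=
    hψ.out.relabel fun i => Nat.casesOn i 0 fun j => j + 3
  infer_instance

instance all {φ : (ℕ → M) → M → Fml M} [h : 𝒜.DFml fun v => φ (fun i => v (i + 1)) (v 0)] :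
    𝒜.DFml fun v => .all (φ v) := by
  refine ⟨?_⟩
  change Dfn fun v => ∃ a : M, 𝒜.IsName a ∧ v 0 ∈ 𝒜.falsity (φ (fun i => v (i + 1)) a)
  have h1 : Dfn fun v => v (0 + 1) ∈ 𝒜.falsity (φ (fun i => v (i + 1 + 1)) (v 0)) :=
    h.out.relabel fun i => Nat.casesOn i 1 fun j => Nat.casesOn j 0 fun k => k + 2
  infer_instance

instance and [𝒜.DFml φ] [𝒜.DFml ψ] : 𝒜.DFml fun v => .and (φ v) (ψ v) := by
  unfold Fml.and; infer_instance

instance or [𝒜.DFml φ] [𝒜.DFml ψ] : 𝒜.DFml fun v => .or (φ v) (ψ v) := by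
  unfold Fml.or; infer_instance

instance iff [𝒜.DFml φ] [𝒜.DFml ψ] : 𝒜.DFml fun v => .iff (φ v) (ψ v) := by
  unfold Fml.iff; infer_instance

instance ex {φ : (ℕ → M) → M → Fml M} [h : 𝒜.DFml fun v => φ (fun i => v (i + 1)) (v 0)] :
    𝒜.DFml fun v => .ex (φ v) := by
  unfold Fml.ex; infer_instance

instance eps : 𝒜.DFml fun v => .eps (F v) (G v) := by unfold Fml.eps; infer_instance

instance mem : 𝒜.DFml fun v => .mem (F v) (G v) := by unfold Fml.mem; infer_instance

instance sim : 𝒜.DFml fun v => .sim (F v) (G v) := by unfold Fml.sim; infer_instance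

end DFml

/-! ## Recursive names -/

instance {F G : (ℕ → M) → M} [hF : DfnF F] [hG : DfnF G] : Dfn fun v => 𝒜.IsReish (F v) (G v) :=
  Dfn.comp2 (by unfold IsReish; infer_instance) hF hG

theorem IsReish.mem_iff {x y : M} (h : 𝒜.IsReish x y) (z : M) :
    z ∊ y ↔ ∃ w w' π, w ∊ x ∧ 𝒜.IsReish w w' ∧ π ∊ 𝒜.Stacks ∧ z = pair w' π := by
  revert z
  refine mem_induction (fun x : M => ∀ y : M, 𝒜.IsReish x y → ∀ z : M, z ∊ y ↔
    ∃ w w' π : M, w ∊ x ∧ 𝒜.IsReish w w' ∧ π ∊ 𝒜.Stacks ∧ z = pair w' π) ?_ x y h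
  rintro x ih y ⟨g, hxy, hg⟩ z
  obtain ⟨h1, h2⟩ := hg x y hxy
  rw [h2]
  constructor
  · rintro ⟨w, w', π, hw, hww, hπ, rfl⟩
    exact ⟨w, w', π, hw, ⟨g, hww, hg⟩, hπ, rfl⟩
  · rintro ⟨w, w', π, hw, hww, hπ, rfl⟩
    obtain ⟨w'', hw''⟩ := h1 w hw
    refine ⟨w, w'', π, hw, hw'', hπ, ?_⟩
    rw [show w' = w'' from set_ext fun z => by rw [ih w hw _ hww, ih w hw _ ⟨g, hw'', hg⟩]]

theorem IsReish.unique {x y y' : M} (h : 𝒜.IsReish x y) (h' : 𝒜.IsReish x y') : y = y' :=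
  set_ext fun z => by rw [h.mem_iff, h'.mem_iff]

variable (𝒜) in
-- All values on a universe containing $x$ are collected by Replacement, and the pair for $x$ is
-- added.
theorem exists_isReish (x : M) : ∃ y, 𝒜.IsReish x y := by
  refine mem_induction (fun x => ∃ y, 𝒜.IsReish x y) (fun x ih => ?_) x
  -- If $x$ has no value yet, no existing approximation mentions $x$, so adding a pair for $x$
  -- leaves the old recursion clauses intact.
  by_contra hx
  obtain ⟨U, hxU, hU⟩ := exists_universe_mem x
  obtain ⟨S, hS⟩ := exists_sep (fun v => ∃ y, 𝒜.IsReish v y) U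
  obtain ⟨g, hg⟩ := exists_repl (fun v z => ∃ y : M, z = pair v y ∧ 𝒜.IsReish v y) S fun v hv => by
    obtain ⟨y, hy⟩ := ((hS v).1 hv).2
    refine ⟨_, ⟨y, rfl, hy⟩, ?_⟩
    rintro _ ⟨y', rfl, hy'⟩
    rw [hy.unique hy']
  have hg' : ∀ v y, pair v y ∊ g ↔ v ∊ U ∧ 𝒜.IsReish v y := by
    intro v y
    rw [hg]
    constructor
    · rintro ⟨v', hv, y', e, h⟩
      obtain ⟨rfl, rfl⟩ := pair_inj.1 e
      exact ⟨((hS v).1 hv).1, h⟩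
    · rintro ⟨hv, h⟩
      exact ⟨v, (hS v).2 ⟨hv, y, h⟩, y, rfl, h⟩
  obtain ⟨y, hy⟩ := exists_set_of_list (D := fun z : M => ∃ w w' π : M, w ∊ x ∧ pair w w' ∊ g ∧
      π ∊ 𝒜.Stacks ∧ z = pair w' π) [g, 𝒜.Stacks] (by
    rintro V hV hl - z ⟨w, w', π, -, h, hπ, rfl⟩
    exact hV.pair_mem (hV.of_pair_mem (hV.trans _ _ (hl g (by simp)) h)).2
      (hV.trans _ _ (hl _ (by simp)) hπ))
  obtain ⟨g₁, hg₁⟩ := exists_union2 g (upair (pair x y) (pair x y))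
  have hg₁' : ∀ v v', pair v v' ∊ g₁ ↔ pair v v' ∊ g ∨ (v = x ∧ v' = y) := fun v v' => by
    rw [hg₁, mem_upair, or_self, pair_inj]
  refine hx ⟨y, g₁, (hg₁' x y).2 (Or.inr ⟨rfl, rfl⟩), fun v v' hv => ?_⟩
  have lift : ∀ w, w ≠ x → ∀ w', (pair w w' ∊ g₁ ↔ pair w w' ∊ g) := fun w hw w' => by
    rw [hg₁', or_iff_left fun h => hw h.1]
  rcases (hg₁' v v').1 hv with hv | ⟨rfl, rfl⟩
  · obtain ⟨hvU, g₀, hv₀, hg₀⟩ := (hg' v v').1 hv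
    obtain ⟨h1, h2⟩ := hg₀ v v' hv₀
    have hne : ∀ w, w ∊ v → w ≠ x := by
      rintro w hw rfl
      obtain ⟨w', hw'⟩ := h1 w hw
      exact hx ⟨w', g₀, hw', hg₀⟩
    refine ⟨fun w hw => ?_, fun z => ?_⟩
    · obtain ⟨w', hw'⟩ := h1 w hw
      exact ⟨w', (hg₁' _ _).2 (Or.inl ((hg' _ _).2 ⟨hU.trans v w hvU hw, g₀, hw', hg₀⟩))⟩
    · rw [IsReish.mem_iff ⟨g₀, hv₀, hg₀⟩]
      refine exists_congr fun w => exists_congr fun w' => exists_congr fun π =>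
        and_congr_right fun hw => and_congr_left fun _ => ?_
      rw [lift w (hne w hw), hg']
      exact ⟨fun h => ⟨hU.trans v w hvU hw, h⟩, fun h => h.2⟩
  · refine ⟨fun w hw => ?_, fun z => ?_⟩
    · obtain ⟨w', hw'⟩ := ih w hw
      exact ⟨w', (hg₁' _ _).2 (Or.inl ((hg' _ _).2 ⟨hU.trans v w hxU hw, hw'⟩))⟩
    · rw [hy]
      refine exists_congr fun w => exists_congr fun w' => exists_congr fun π =>
        and_congr_right fun hw => and_congr_left fun _ => ?_
      rw [lift w]
      rintro rfl
      exact not_mem_self w hw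

theorem isReish_reish (x : M) : 𝒜.IsReish x (𝒜.reish x) :=
  Classical.epsilon_spec (𝒜.exists_isReish x)

theorem eq_reish {x y : M} : y = 𝒜.reish x ↔ 𝒜.IsReish x y :=
  ⟨fun h => h ▸ isReish_reish x, fun h => h.unique (isReish_reish x)⟩

instance {F : (ℕ → M) → M} [hF : DfnF F] : DfnF fun v => 𝒜.reish (F v) :=
  haveI := hF.shift
  DfnF.of_graph (R := fun v y => 𝒜.IsReish (F v) y) (fun _ _ => eq_reish) inferInstance

theorem mem_reish {x z : M} :
    z ∊ 𝒜.reish x ↔ ∃ w π, w ∊ x ∧ π ∊ 𝒜.Stacks ∧ z = pair (𝒜.reish w) π := by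
  rw [(isReish_reish x).mem_iff]
  constructor
  · rintro ⟨w, w', π, hw, h, hπ, rfl⟩
    exact ⟨w, π, hw, hπ, by rw [eq_reish.2 h]⟩
  · rintro ⟨w, π, hw, hπ, rfl⟩
    exact ⟨w, _, π, hw, isReish_reish w, hπ, rfl⟩

theorem pair_mem_reish {x a π : M} :
    pair a π ∊ 𝒜.reish x ↔ (∃ w, w ∊ x ∧ a = 𝒜.reish w) ∧ π ∊ 𝒜.Stacks := by
  rw [mem_reish]
  constructor
  · rintro ⟨w, π', hw, hπ, e⟩
    obtain ⟨rfl, rfl⟩ := pair_inj.1 e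
    exact ⟨⟨w, hw, rfl⟩, hπ⟩
  · rintro ⟨⟨w, hw, rfl⟩, hπ⟩
    exact ⟨w, π, hw, hπ, rfl⟩

variable (𝒜) in
theorem isName_reish (x : M) : 𝒜.IsName (𝒜.reish x) := by
  refine mem_induction (fun x => 𝒜.IsName (𝒜.reish x)) (fun x ih => ?_) x
  refine 𝒜.isName_of_forall fun z hz => ?_
  obtain ⟨w, π, hw, hπ, rfl⟩ := mem_reish.1 hz
  exact ⟨_, π, ih w hw, hπ, rfl⟩

variable (𝒜) in
theorem exists_stack : ∃ π, π ∊ 𝒜.Stacks :=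
  let ⟨_, hβ⟩ := 𝒜.nonempty_B
  ⟨_, sBottom_mem hβ⟩

theorem mem_dom_reish {x a : M} : (∃ σ, pair a σ ∊ 𝒜.reish x) ↔ ∃ w, w ∊ x ∧ a = 𝒜.reish w := by
  obtain ⟨π, hπ⟩ := 𝒜.exists_stack
  exact ⟨fun ⟨_, h⟩ => (pair_mem_reish.1 h).1, fun h => ⟨π, pair_mem_reish.2 ⟨h, hπ⟩⟩⟩

/-! ## Pairing of names -/

theorem church_mem (t : M) (ht : ∃ s : Tm, t = code [] 0 s) : t ∊ 𝒜.Terms := by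
  obtain ⟨s, rfl⟩ := ht
  exact code_mem s (by simp)

theorem church0_mem : church0 ∊ 𝒜.Terms := church_mem _ ⟨.lam (.lam (.var 0)), by simp [code, church0]⟩

theorem church1_mem : church1 ∊ 𝒜.Terms :=
  church_mem _ ⟨.lam (.lam (.app (.var 1) (.var 0))), by simp [code, church1]⟩

theorem church0_ne_church1 : (church0 : M) ≠ church1 := by
  simp only [church0, church1, tLam, tVar, tApp, ne_eq, pair_inj, true_and, not_and]
  exact fun h => (succ_ne_empty _ h.symm).elim

theorem sPush_inj {s t π σ : M} : sPush s π = sPush t σ ↔ s = t ∧ π = σ := by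
  simp [sPush, pair_inj]

theorem mem_sng {a z : M} : z ∊ 𝒜.sng a ↔ ∃ π, π ∊ 𝒜.Stacks ∧ z = pair a π := by
  refine mem_compr_of_list (D := fun z : M => ∃ π : M, π ∊ 𝒜.Stacks ∧ z = pair a π)
    [a, 𝒜.Stacks] ?_ z
  rintro U hU hl - z ⟨π, hπ, rfl⟩
  exact hU.pair_mem (hl a (by simp)) (hU.trans _ _ (hl 𝒜.Stacks (by simp)) hπ)

theorem mem_up {a b z : M} : z ∊ 𝒜.up a b ↔ ∃ π, π ∊ 𝒜.Stacks ∧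
    (z = pair a (sPush church0 π) ∨ z = pair b (sPush church1 π)) := by
  refine mem_compr_of_list (D := fun z : M => ∃ π : M, π ∊ 𝒜.Stacks ∧
    (z = pair a (sPush church0 π) ∨ z = pair b (sPush church1 π)))
    [a, b, 𝒜.Stacks] ?_ z
  rintro U hU hl hn z ⟨π, hπ, h⟩
  have hπ := hU.trans _ _ (hl 𝒜.Stacks (by simp)) hπ
  have ha := hl a (by simp)
  have hb := hl b (by simp)
  have hv : ∀ k : ℕ, (tVar (num k) : M) ∊ U := fun k => hU.pair_mem (hn 0) (hn k)
  rcases h with rfl | rfl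
  · exact hU.pair_mem ha (hU.sPush_mem hn
      (hU.pair_mem (hn 2) (hU.pair_mem (hn 2) (hv 0))) hπ)
  · exact hU.pair_mem hb (hU.sPush_mem hn (hU.pair_mem (hn 2) (hU.pair_mem (hn 2)
      (hU.pair_mem (hn 1) (hU.pair_mem (hv 1) (hv 0))))) hπ)

instance {F : (ℕ → M) → M} [hF : DfnF F] : DfnF fun v => 𝒜.sng (F v) :=
  haveI := hF.shift
  haveI := hF.shift.shift
  DfnF.comp1 (f := 𝒜.sng) (DfnF.of_graph
    (R := fun v y => ∀ z : M, z ∊ y ↔ ∃ π : M, π ∊ 𝒜.Stacks ∧ z = pair (v 0) π)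
    (fun v y => ⟨fun h z => by rw [h, mem_sng], fun h => set_ext fun z => by rw [h, mem_sng]⟩)
    inferInstance) hF

instance {F G : (ℕ → M) → M} [hF : DfnF F] [hG : DfnF G] : DfnF fun v => 𝒜.up (F v) (G v) :=
  DfnF.comp2 (f := 𝒜.up) (DfnF.of_graph
    (R := fun v y => ∀ z : M, z ∊ y ↔ ∃ π : M, π ∊ 𝒜.Stacks ∧
      (z = pair (v 0) (sPush church0 π) ∨ z = pair (v 1) (sPush church1 π)))
    (fun v y => ⟨fun h z => by rw [h, mem_up], fun h => set_ext fun z => by rw [h, mem_up]⟩)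
    inferInstance) hF hG

instance {F G : (ℕ → M) → M} [hF : DfnF F] [hG : DfnF G] : DfnF fun v => 𝒜.op (F v) (G v) := by
  unfold op; infer_instance

theorem IsName.sng {a : M} (ha : 𝒜.IsName a) : 𝒜.IsName (𝒜.sng a) :=
  𝒜.isName_of_forall fun z hz => by
    obtain ⟨π, hπ, rfl⟩ := mem_sng.1 hz
    exact ⟨a, π, ha, hπ, rfl⟩

theorem IsName.up {a b : M} (ha : 𝒜.IsName a) (hb : 𝒜.IsName b) : 𝒜.IsName (𝒜.up a b) :=
  𝒜.isName_of_forall fun z hz => by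
    obtain ⟨π, hπ, rfl | rfl⟩ := mem_up.1 hz
    · exact ⟨a, _, ha, sPush_mem church0_mem hπ, rfl⟩
    · exact ⟨b, _, hb, sPush_mem church1_mem hπ, rfl⟩

theorem IsName.op {a b : M} (ha : 𝒜.IsName a) (hb : 𝒜.IsName b) : 𝒜.IsName (𝒜.op a b) :=
  (ha.sng.up (𝒜.isName_reish _)).up hb.sng.sng

theorem sng_inj {a b : M} (h : 𝒜.sng a = 𝒜.sng b) : a = b := by
  obtain ⟨π, hπ⟩ := 𝒜.exists_stack
  have : pair a π ∊ 𝒜.sng b := h ▸ mem_sng.2 ⟨π, hπ, rfl⟩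
  obtain ⟨π', -, e⟩ := mem_sng.1 this
  exact (pair_inj.1 e).1

theorem up_inj {a b a' b' : M} (h : 𝒜.up a b = 𝒜.up a' b') : a = a' ∧ b = b' := by
  obtain ⟨π, hπ⟩ := 𝒜.exists_stack
  have h1 : pair a (sPush church0 π) ∊ 𝒜.up a' b' := h ▸ mem_up.2 ⟨π, hπ, Or.inl rfl⟩
  have h2 : pair b (sPush church1 π) ∊ 𝒜.up a' b' := h ▸ mem_up.2 ⟨π, hπ, Or.inr rfl⟩
  obtain ⟨π', -, e1⟩ := mem_up.1 h1
  obtain ⟨π'', -, e2⟩ := mem_up.1 h2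
  simp only [pair_inj, sPush_inj, church0_ne_church1, church0_ne_church1.symm, false_and,
    and_false, or_false, false_or] at e1 e2
  exact ⟨e1.1, e2.1⟩

/-- Equality in the ground model is meant: the tags `church0` and `church1` on the stacks separate
the two components of `up`. -/
theorem op_inj {a b a' b' : M} (h : 𝒜.op a b = 𝒜.op a' b') : a = a' ∧ b = b' :=
  ⟨sng_inj (up_inj (up_inj h).1).1, sng_inj (sng_inj (up_inj h).2)⟩

namespace Ty

variable {Γ : List (Fml M)} {r s t : Tm} {φ ψ χ : Fml M}

/-! ## Derived rules of classical logic -/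

theorem cut (hs : 𝒜.Ty Γ s φ) (ht : 𝒜.Ty (φ :: Γ) t ψ) : 𝒜.Ty Γ (.app (.lam t) s) ψ :=
  app (lam ht) hs

theorem andI (hs : 𝒜.Ty Γ s φ) (ht : 𝒜.Ty Γ t ψ) :
    𝒜.Ty Γ (.app (.app (.close (.lam (.lam (.lam (.app (.app (.var 0) (.var 2)) (.var 1)))))) s) t)
      (.and φ ψ) :=
  app (app (close (lam (lam (lam (app (app v0 v2) v1))))) hs) ht

theorem andL (h : 𝒜.Ty Γ t (.and φ ψ)) :
    𝒜.Ty Γ (.app (.close (.lam (.app .cc (.lam (.app (.var 1) (.lam (.lam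
      (.app (.var 2) (.var 1))))))))) t) φ :=
  app (close (lam (byContra (app v1 (lam (lam (app v2 v1))))))) h

theorem andR (h : 𝒜.Ty Γ t (.and φ ψ)) :
    𝒜.Ty Γ (.app (.close (.lam (.app .cc (.lam (.app (.var 1) (.lam (.lam
      (.app (.var 2) (.var 0))))))))) t) ψ :=
  app (close (lam (byContra (app v1 (lam (lam (app v2 v0))))))) h

theorem orL (h : 𝒜.Ty Γ t φ) :
    𝒜.Ty Γ (.app (.close (.lam (.lam (.lam (.app (.var 1) (.var 2)))))) t) (.or φ ψ) :=
  app (close (lam (lam (lam (app v1 v2))))) h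

theorem orE (h : 𝒜.Ty Γ r (.or φ ψ)) (hs : 𝒜.Ty (φ :: Γ) s χ) (ht : 𝒜.Ty (ψ :: Γ) t χ) :
    𝒜.Ty Γ (.app (.app (.app (.close (.lam (.lam (.lam (.app .cc (.lam (.app
      (.app (.var 3) (.lam (.app (.var 1) (.app (.var 3) (.var 0)))))
      (.lam (.app (.var 1) (.app (.var 2) (.var 0)))))))))))
      r) (.lam s)) (.lam t)) χ :=
  app (app (app (close (lam (lam (lam (byContra (app
    (app v3 (lam (app v1 (app v3 v0)))) (lam (app v1 (app v2 v0))))))))) h) (lam hs)) (lam ht)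

section Quantifiers

variable {Φ : M → Fml M} {a c : M}

theorem exI (ha : 𝒜.IsName a) (h : 𝒜.Ty Γ t (Φ a)) :
    𝒜.Ty Γ (.app (.close (.lam (.lam (.app (.var 0) (.var 1))))) t) (.ex Φ) :=
  app (close (lam (lam (app (allE (φ := fun a => Φ a ⟹ .bot) v0 ha) v1)))) h

theorem exE (h : 𝒜.Ty Γ s (.ex Φ)) (ht : ∀ a, 𝒜.IsName a → 𝒜.Ty (Φ a :: Γ) t χ) :
    𝒜.Ty Γ (.app (.app (.close (.lam (.lam (.app .cc (.lam (.app (.var 2)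
      (.lam (.app (.var 1) (.app (.var 2) (.var 0)))))))))) s) (.lam t)) χ :=
  app (app (ψ := (.all fun a => Φ a ⟹ χ) ⟹ χ) (close (lam (lam (byContra (app v2 (allI fun _ ha =>
    lam (app v1 (app (allE (φ := fun a => Φ a ⟹ χ) v2 ha) v0)))))))) h)
    (allI fun a ha => lam (ht a ha))

theorem exDomI (ha : ∃ σ, pair a σ ∊ c) (h : 𝒜.Ty Γ t (Φ a)) :
    𝒜.Ty Γ (.app (.close (.lam (.lam (.app (.var 0) (.var 1))))) t) (.exDom c Φ) :=
  app (close (lam (lam (app (allDomE (φ := fun a => Φ a ⟹ .bot) v0 ha) v1)))) h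

theorem exDomE (h : 𝒜.Ty Γ s (.exDom c Φ))
    (ht : ∀ a, (∃ σ, pair a σ ∊ c) → 𝒜.Ty (Φ a :: Γ) t χ) :
    𝒜.Ty Γ (.app (.app (.close (.lam (.lam (.app .cc (.lam (.app (.var 2)
      (.lam (.app (.var 1) (.app (.var 2) (.var 0)))))))))) s) (.lam t)) χ :=
  app (app (ψ := (.allDom c fun a => Φ a ⟹ χ) ⟹ χ) (close (lam (lam (byContra (app v2
    (allDomI fun _ ha => lam (app v1 (app (allDomE (φ := fun a => Φ a ⟹ χ) v2 ha) v0)))))))) h)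
    (allDomI fun a ha => lam (ht a ha))

end Quantifiers

/-! ## Atomic formulas -/

section Atomic

variable {a b c : M}

theorem subI (ha : 𝒜.IsName a) (hb : 𝒜.IsName b)
    (h : ∀ c, 𝒜.IsName c → 𝒜.Ty Γ t (.nin c b ⟹ .neps c a)) : 𝒜.Ty Γ t (.sub a b) :=
  (allI h).of_falsity_subset (falsity_sub ha hb).le

theorem subE (ha : 𝒜.IsName a) (hb : 𝒜.IsName b) (h : 𝒜.Ty Γ t (.sub a b)) (hc : 𝒜.IsName c) :
    𝒜.Ty Γ t (.nin c b ⟹ .neps c a) :=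
  allE (φ := fun c => .nin c b ⟹ .neps c a) (h.of_falsity_subset (falsity_sub ha hb).ge) hc

theorem ninI (ha : 𝒜.IsName a) (hb : 𝒜.IsName b)
    (h : ∀ c, 𝒜.IsName c → 𝒜.Ty Γ t (.sub a c ⟹ .sub c a ⟹ .neps c b)) :
    𝒜.Ty Γ t (.nin a b) :=
  (allI h).of_falsity_subset (falsity_nin ha hb).le

theorem ninE (ha : 𝒜.IsName a) (hb : 𝒜.IsName b) (h : 𝒜.Ty Γ t (.nin a b)) (hc : 𝒜.IsName c) :
    𝒜.Ty Γ t (.sub a c ⟹ .sub c a ⟹ .neps c b) :=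
  allE (φ := fun c => .sub a c ⟹ .sub c a ⟹ .neps c b)
    (h.of_falsity_subset (falsity_nin ha hb).ge) hc

end Atomic

end Ty

/-! ## Induction -/

/-- `λa.λf. f (λk. k (a a f))` -/
def turing : Tm :=
  .lam (.lam (.app (.var 0) (.lam (.app (.var 0) (.app (.app (.var 2) (.var 2)) (.var 1))))))

/-- The induction hypothesis for `φ` at `x`. -/
def indHyp (φ : M → Fml M) (x : M) : Fml M :=
  .all fun y => (φ y ⟹ .neps y x) ⟹ .neps y x

/-- With $D$ the term `turing`, $DDf$ evaluates to $f(\lambda k.\,k(DDf))$. A stack against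
$y\not\varepsilon\, x$ witnesses $y\in\mathrm{dom}(x)$, so by induction along domains $DDf$ realizes
$\varphi(y)$ and the argument of $f$ realizes the induction hypothesis. -/
theorem Ty.turing {φ : M → Fml M} [hφ : 𝒜.DFml fun v => φ (v 0)] :
    𝒜.Ty [] (.app turing turing) ((.all fun x => indHyp φ x ⟹ φ x) ⟹ .all φ) := by
  rintro _ ⟨⟩
  set D : M := code [] 0 RealizabilityAlgebra.turing with hD
  have hDt : D ∊ 𝒜.Terms := code_mem _ (by simp)
  have hnil : ∀ s ∈ ([] : List M), s ∊ 𝒜.Terms := by simp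
  refine ⟨𝒜.tApp_mem hDt hDt, ?_⟩
  rintro _ ⟨f, π, hf, hf', ⟨x, hx, hπ⟩, rfl⟩
  change pair (tApp D D) (sPush f π) ∊ 𝒜.pole
  have hfD : ∀ s ∈ [f, D], s ∊ 𝒜.Terms := by simp [hf, hDt]
  revert π
  have : ∀ i, 𝒜.DFml fun v => φ (v i) := fun i => hφ.relabel fun _ => i
  refine 𝒜.name_induction (fun x : M => ∀ π : M, π ∈ 𝒜.falsity (φ x) →
    pair (tApp D D) (sPush f π) ∊ 𝒜.pole) (fun x hx ih π hπ => ?_) hx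
  have hπs := 𝒜.falsity_subset _ hπ
  refine 𝒜.mem_pole_app hDt hDt (sPush_mem hf hπs) ?_
  refine 𝒜.mem_pole_lam hnil hDt (sPush_mem hf hπs) ?_
  refine 𝒜.mem_pole_lam (by simpa using hDt) hf hπs ?_
  have ef : code [f, D] 0 (.var 0) = f := by simp [code]
  refine 𝒜.mem_pole_app (ef ▸ hf) (code_mem _ hfD) hπs ?_
  rw [ef]
  refine hf' _ ⟨x, hx, _, π, code_mem _ hfD, ?_, hπ, rfl⟩
  rintro _ ⟨y, -, k, ρ, hk, hk', ⟨hρ, hy⟩, rfl⟩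
  have hDD : tApp (tApp D D) f ∊ 𝒜.Terms := 𝒜.tApp_mem (𝒜.tApp_mem hDt hDt) hf
  refine 𝒜.mem_pole_lam hfD hk hρ ?_
  refine 𝒜.mem_pole_app (by simpa [code] using hk) (by simpa [code] using hDD) hρ ?_
  simp only [code, Nat.not_lt_zero, if_false, Nat.sub_zero, List.getD_cons_zero,
    List.getD_cons_succ]
  exact hk' _ ⟨_, ρ, hDD, fun σ hσ => 𝒜.mem_pole_app (𝒜.tApp_mem hDt hDt) hf
    (𝒜.falsity_subset _ hσ) (ih y ρ hy σ hσ), ⟨hρ, hy⟩, rfl⟩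

theorem Ty.ind {φ : M → Fml M} [𝒜.DFml fun v => φ (v 0)] {t : Tm}
    (h : ∀ x, 𝒜.IsName x → 𝒜.Ty [indHyp φ x] t (φ x)) {x : M} (hx : 𝒜.IsName x) :
    𝒜.Ty [] (.app (.app RealizabilityAlgebra.turing RealizabilityAlgebra.turing) (.lam t)) (φ x) :=
  Ty.allE (Ty.app Ty.turing (Ty.allI fun x hx => Ty.lam (h x hx))) hx

theorem Ty.indHypE {φ : M → Fml M} {x y : M} {Γ : List (Fml M)} {t : Tm}
    (h : 𝒜.Ty Γ t (indHyp φ x)) (hy : 𝒜.IsName y) :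
    𝒜.Ty Γ t ((φ y ⟹ .neps y x) ⟹ .neps y x) :=
  Ty.allE (φ := fun y => (φ y ⟹ .neps y x) ⟹ .neps y x) h hy

/-! ### Reflexivity and transitivity of extensional inclusion -/

section Extensionality

open Ty

variable (𝒜)

theorem exists_sub_refl : ∃ t, ∀ a, 𝒜.IsName a → 𝒜.Ty [] t (.sub a a) :=
  ⟨_, fun _ ha => ind (φ := fun x => .sub x x) (fun _ hx => subI hx hx fun _ hc =>
    lam (app (indHypE v1 hc) (lam (app (app (ninE hc hx v1 hc) v0) v0)))) ha⟩

/-- Elements are matched up to $\simeq$, so inclusions both out of $a$ and into $a$ are needed at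
once. In either direction the induction hypothesis is used at an $\varepsilon$-element of $a$, the
first or the last in the chain of matched elements. -/
theorem exists_sub_trans : ∃ t, ∀ a, 𝒜.IsName a → 𝒜.Ty [] t
    (.all fun b => .all fun c => .and (.sub a b ⟹ .sub b c ⟹ .sub a c)
      (.sub c b ⟹ .sub b a ⟹ .sub c a)) := by
  set φ : M → Fml M := fun a => (.all fun b => .all fun c =>
      .and (.sub a b ⟹ .sub b c ⟹ .sub a c) (.sub c b ⟹ .sub b a ⟹ .sub c a)) with hφ
  have inst : 𝒜.DFml fun v => φ (v 0) := inferInstance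
  have e1 : ∀ {Γ t a b c}, 𝒜.IsName b → 𝒜.IsName c → 𝒜.Ty Γ t (φ a) → 𝒜.Ty Γ _ _ :=
    fun {Γ t a b c} hb hc h => andL (allE (φ := fun c => .and (.sub a b ⟹ .sub b c ⟹ .sub a c)
      (.sub c b ⟹ .sub b a ⟹ .sub c a)) (allE h hb) hc)
  have e2 : ∀ {Γ t a b c}, 𝒜.IsName b → 𝒜.IsName c → 𝒜.Ty Γ t (φ a) → 𝒜.Ty Γ _ _ :=
    fun {Γ t a b c} hb hc h => andR (allE (φ := fun c => .and (.sub a b ⟹ .sub b c ⟹ .sub a c)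
      (.sub c b ⟹ .sub b a ⟹ .sub c a)) (allE h hb) hc)
  exact ⟨_, fun a ha => ind (φ := φ) (fun x hx => allI fun b hb => allI fun c hc => andI
    (lam (lam (subI hx hc fun z hz => lam (app (indHypE v3 hz) (lam (app (subE hx hb v3 hz)
      (ninI hz hb fun w hw => lam (lam (app (subE hb hc v4 hw)
        (ninI hw hc fun v hv => lam (lam (app (app (ninE hz hc v5 hv)
          (app (app (e1 hw hv v4) v3) v1)) (app (app (e2 hw hv v4) v0) v2)))))))))))))
    (lam (lam (subI hc hx fun z hz => lam (app (subE hc hb v2 hz)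
      (ninI hz hb fun w hw => lam (lam (app (subE hb hx v3 hw)
        (ninI hw hx fun v hv => lam (lam (app (indHypE v7 hv) (lam (app (app (ninE hz hx v5 hv)
          (app (app (e2 hw hz v0) v4) v2)) (app (app (e1 hw hz v0) v1) v3)))))))))))))) ha⟩

end Extensionality

end RealizabilityAlgebra
section Regular

variable {M : Type*} [setLang.Structure M] [ModelZF M]

/-! ## Bounds below a regular cardinal -/

theorem IsRegularCardinal.bounded {δ κ : M} (hδ : IsRegularCardinal δ) (hκ : κ ∊ δ)
    (E : M → M → Prop) [Dfn fun v => E (v 0) (v 1)]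
    (hE : ∀ x y, E x y → y ∊ δ ∧ ∀ y', E x y' → y' = y) :
    ∃ β, β ∊ δ ∧ ∀ x y, x ∊ κ → E x y → y ∊ β := by
  have inst : ∀ i j, Dfn fun v => E (v i) (v j) := fun i j => Dfn.comp2 ‹_› DfnF.var DfnF.var
  -- The partial function `E` is made total by the default value $\emptyset$, an element of
  -- $\delta$.
  obtain ⟨f, hf⟩ := exists_set_of_list (D := fun z : M => ∃ x y : M, z = pair x y ∧ x ∊ κ ∧ y ∊ δ ∧
      (E x y ∨ (∀ y' : M, ¬ E x y') ∧ y = empty)) [κ, δ] (by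
    rintro U hU hl - _ ⟨x, y, rfl, hx, hy, -⟩
    exact hU.pair_mem (hU.trans _ _ (hl κ (by simp)) hx) (hU.trans _ _ (hl δ (by simp)) hy))
  have hf' : ∀ x y, pair x y ∊ f ↔ x ∊ κ ∧ y ∊ δ ∧
      (E x y ∨ (∀ y' : M, ¬ E x y') ∧ y = empty) := by
    intro x y
    rw [hf]
    constructor
    · rintro ⟨x', y', e, h⟩
      obtain ⟨rfl, rfl⟩ := pair_inj.1 e
      exact h
    · exact fun h => ⟨x, y, rfl, h⟩
  suffices IsFunction f κ δ by
    obtain ⟨β, hβ, h⟩ := hδ.2.2 κ f hκ this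
    exact ⟨β, hβ, fun x y hx hxy => h x y ((hf' x y).2 ⟨hx, (hE x y hxy).1, Or.inl hxy⟩)⟩
  refine ⟨fun z hz => ?_, fun x hx => ?_⟩
  · obtain ⟨x, y, rfl, hx, hy, -⟩ := (hf z).1 hz
    exact ⟨x, y, hx, hy, rfl⟩
  · by_cases hex : ∃ y, E x y
    · obtain ⟨y, hy⟩ := hex
      refine ⟨y, (hf' x y).2 ⟨hx, (hE x y hy).1, Or.inl hy⟩, fun y' hy' => ?_⟩
      rcases ((hf' x y').1 hy').2.2 with h | h
      · exact (hE x y hy).2 y' h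
      · exact (h.1 y hy).elim
    · rw [not_exists] at hex
      refine ⟨empty, (hf' x _).2 ⟨hx, hδ.2.1.1, Or.inr ⟨hex, rfl⟩⟩, fun y' hy' => ?_⟩
      rcases ((hf' x y').1 hy').2.2 with h | h
      · exact (hex y' h).elim
      · exact h.2

theorem IsRegularCardinal.bounded_of_cardLT {δ X : M} (hδ : IsRegularCardinal δ) (hX : CardLT X δ)
    (E : M → M → Prop) [Dfn fun v => E (v 0) (v 1)]
    (hE : ∀ x y, E x y → y ∊ δ ∧ ∀ y', E x y' → y' = y) :
    ∃ β, β ∊ δ ∧ ∀ x y, x ∊ X → E x y → y ∊ β := by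
  have inst : ∀ i j, Dfn fun v => E (v i) (v j) := fun i j => Dfn.comp2 ‹_› DfnF.var DfnF.var
  obtain ⟨κ, g, hκ, -, hg, hg'⟩ := hX
  have hgκ : ∀ x i, pair x i ∊ g → i ∊ κ := fun x i h => by
    obtain ⟨_, _, -, hi, e⟩ := hg.1 _ h
    rwa [(pair_inj.1 e).2]
  obtain ⟨β, hβ, h⟩ := hδ.bounded hκ (fun i y => ∃ x : M, pair x i ∊ g ∧ E x y) (by
    rintro i y ⟨x, hx, hxy⟩
    refine ⟨(hE x y hxy).1, ?_⟩
    rintro y' ⟨x', hx', hxy'⟩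
    rw [(hg' i (hgκ x i hx)).unique hx' hx] at hxy'
    exact (hE x y hxy).2 y' hxy')
  refine ⟨β, hβ, fun x y hx hxy => ?_⟩
  obtain ⟨i, hi, -⟩ := hg.2 x hx
  exact h i y (hgκ x i hi) ⟨x, hi, hxy⟩

end Regular

namespace RealizabilityAlgebra

variable {M : Type*} [setLang.Structure M] [ModelZF M] {𝒜 : RealizabilityAlgebra M}

theorem reish_inj {x y : M} (h : 𝒜.reish x = 𝒜.reish y) : x = y := by
  refine mem_induction (fun x => ∀ y : M, 𝒜.reish x = 𝒜.reish y → x = y) (fun x ih y h => ?_) x y h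
  refine set_ext fun w => ⟨fun hw => ?_, fun hw => ?_⟩
  · obtain ⟨w', hw', e⟩ := mem_dom_reish.1 (h ▸ mem_dom_reish.2 ⟨w, hw, rfl⟩)
    exact ih w hw w' e ▸ hw'
  · obtain ⟨w', hw', e⟩ := mem_dom_reish.1 (h ▸ mem_dom_reish.2 ⟨w, hw, rfl⟩)
    exact ih w' hw' w e.symm ▸ hw'

/-! ## Bounded quantifiers -/

namespace Ty

variable {Γ : List (Fml M)} {s t : Tm} {φ χ : Fml M}

/-- `allE`, with the instance as a separate argument (for unification). -/
theorem spec {φ : M → Fml M} {a : M} (h : 𝒜.Ty Γ t (.all φ)) (ha : 𝒜.IsName a) (e : φ a = χ) :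
    𝒜.Ty Γ t χ := e ▸ allE h ha

/-- `allDomE`, with the instance as a separate argument (for unification). -/
theorem specDom {c : M} {φ : M → Fml M} {a : M} (h : 𝒜.Ty Γ t (.allDom c φ))
    (ha : ∃ σ, pair a σ ∊ c) (e : φ a = χ) : 𝒜.Ty Γ t χ := e ▸ allDomE h ha

/-- Membership in `ℸx` is trivially realized. -/
theorem eps_reish {w x : M} (h : w ∊ x) : 𝒜.Ty Γ (.lam (.var 0)) (.eps (𝒜.reish w) (𝒜.reish x)) :=
  lam (v0.of_falsity_subset fun _ hπ => ⟨hπ, pair_mem_reish.2 ⟨⟨w, h, rfl⟩, hπ⟩⟩)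

theorem bot_of_neps_reish {w x : M} (hw : w ∊ x)
    (h : 𝒜.Ty Γ t (.neps (𝒜.reish w) (𝒜.reish x))) : 𝒜.Ty Γ t .bot :=
  h.of_falsity_subset fun _ hπ => ⟨hπ, pair_mem_reish.2 ⟨⟨w, hw, rfl⟩, hπ⟩⟩

/-- If $a\notin\mathrm{dom}(d)$, then $a\not\varepsilon\, d$ has empty falsity value and any term
realizes it, so the hypothesis is absurd. The same term works in both cases, which allows
$a\in\mathrm{dom}(d)$ to be assumed in the ground model. -/
theorem epsE {a d : M} (h : 𝒜.Ty Γ s (.eps a d)) (ht : (∃ σ, pair a σ ∊ d) → 𝒜.Ty Γ t χ) :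
    𝒜.Ty Γ (.app (.app (.close (.lam (.lam (.app .cc (.lam (.app (.var 2)
      (.app (.var 0) (.var 1)))))))) s) t) χ := by
  by_cases ha : ∃ σ, pair a σ ∊ d
  · exact app (app (close (lam (lam (byContra (app v2 (exfalso (app v0 v1))))))) h) (ht ha)
  · have : 𝒜.falsity (.neps a d) = ∅ := Set.eq_empty_of_forall_notMem fun σ hσ => ha ⟨σ, hσ.2⟩
    exact app (app (ψ := .top ⟹ χ) (close (lam (lam (byContra (app v2
      (of_falsity_eq_empty this)))))) h) top

end Ty

/-! ## `ε`-functions are bounded -/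

section Bounded

variable (𝒜)

/-- The term cannot know whether $z=z'$. It derives $ℸz=ℸz'$ from functionality and applies this to
the given refutation of $ℸz\,\varepsilon\,ℸ\beta$, used as a realizer of $ℸz\neℸz'$. -/
theorem exists_bound_term : ∃ t, ∀ f α β δ γ z z', 𝒜.IsName f → γ ∊ α → z ∊ δ → z' ∊ δ →
    (z = z' → z ∊ β) → 𝒜.Ty [] t (.epsFun 𝒜.op f (𝒜.reish α) ⟹
      .eps (𝒜.op (𝒜.reish γ) (𝒜.reish z)) f ⟹ .eps (𝒜.op (𝒜.reish γ) (𝒜.reish z')) f ⟹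
      .eps (𝒜.reish z) (𝒜.reish β)) := by
  exact ⟨_, fun f α β δ γ z z' hf hγ hz hz' H => .lam (.lam (.lam (.lam (by
    -- If $z\neq z'$ the left side is empty; if $z=z'$ then $z\in\beta$, and the right side is all
    -- of $\Pi$.
    have h1 : 𝒜.falsity (.ne (𝒜.reish z) (𝒜.reish z')) ⊆
        𝒜.falsity (.neps (𝒜.reish z) (𝒜.reish β)) := fun π hπ =>
      ⟨hπ.1, pair_mem_reish.2 ⟨⟨z, H (reish_inj hπ.2), rfl⟩, hπ.1⟩⟩
    have h2 := fun {Γ t} (h : 𝒜.Ty Γ t (.epsFun 𝒜.op f (𝒜.reish α))) =>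
      (Ty.app (Ty.allE h (𝒜.isName_reish γ)) (Ty.eps_reish hγ)).allE (𝒜.isName_reish z)
        |>.allE (𝒜.isName_reish z')
    exact .app (.app (h2 .v3) (.andI .v2 .v1)) (Ty.v0.of_falsity_subset h1)))))⟩

/-- Every `ε`-function with domain `a ε ℸδ` is bounded on the part of it with values in `ℸδ`. -/
noncomputable def epsBounded (δ : M) : Fml M :=
  .all fun f => .allDom (𝒜.reish δ) fun a => .exDom (𝒜.reish δ) fun b =>
    .epsFun 𝒜.op f a ⟹ .allDom a fun y => .allDom (𝒜.reish δ) fun z =>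
      .eps (𝒜.op y z) f ⟹ .eps z b

variable {𝒜}

/-- The pair $(\gamma,s)$ determines $\eta$ by uniqueness. Regularity is used twice: over
$s\in\Lambda$ for fixed $\gamma$, then over $\gamma\in\alpha$. -/
theorem exists_bound {δ : M} (hδ : IsRegularCardinal δ) (hΛ : CardLT 𝒜.Terms δ) {α : M}
    (hα : α ∊ δ) (f : M) : ∃ β, β ∊ δ ∧ ∀ γ s η, γ ∊ α → s ∊ 𝒜.Terms → η ∊ δ →
      s ∈ 𝒜.verity (.eps (𝒜.op (𝒜.reish γ) (𝒜.reish η)) f) →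
      (∀ η', η' ∊ δ → s ∈ 𝒜.verity (.eps (𝒜.op (𝒜.reish γ) (𝒜.reish η')) f) → η' = η) →
      η ∊ β := by
  let Z : M → M → M → Prop := fun γ s η => s ∈ 𝒜.verity (.eps (𝒜.op (𝒜.reish γ) (𝒜.reish η)) f)
  let R : M → M → M → Prop := fun γ s η => η ∊ δ ∧ Z γ s η ∧ ∀ η' : M, η' ∊ δ → Z γ s η' → η' = η
  have hR : Dfn fun v => R (v 0) (v 1) (v 2) := by unfold R Z; infer_instance
  have inst : ∀ {F G H : (ℕ → M) → M} [DfnF F] [DfnF G] [DfnF H],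
      Dfn fun v => R (F v) (G v) (H v) := fun {F G H} _ _ _ => Dfn.comp3 hR ‹_› ‹_› ‹_›
  let D : M → M → Prop := fun γ β => ∀ s η : M, s ∊ 𝒜.Terms → R γ s η → η ∊ β
  have hD : Dfn fun v => D (v 0) (v 1) := by unfold D; infer_instance
  have instD : ∀ {F G : (ℕ → M) → M} [DfnF F] [DfnF G], Dfn fun v => D (F v) (G v) :=
    fun {F G} _ _ => Dfn.comp2 hD ‹_› ‹_›
  have h1 : ∀ γ, ∃ β, β ∊ δ ∧ D γ β := fun γ =>
    hδ.bounded_of_cardLT hΛ (fun s η => R γ s η) fun s η h =>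
      ⟨h.1, fun η' h' => h.2.2 η' h'.1 h'.2.1⟩
  -- The least bound for each $\gamma$ makes the assignment of bounds a definable function, without
  -- choice.
  obtain ⟨β, hβ, h⟩ := hδ.bounded hα
    (fun γ β => β ∊ δ ∧ D γ β ∧ ∀ y : M, y ∊ β → ¬ D γ y) fun γ β h => ⟨h.1, fun β' h' =>
      (hδ.1.1.existsUnique_least (D γ) ⟨β, h.1, h.2.1⟩).unique h' h⟩
  refine ⟨β, hβ, fun γ s η hγ hs hη h2 h3 => ?_⟩
  obtain ⟨β', hβ', -⟩ := hδ.1.1.existsUnique_least (D γ) (h1 γ)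
  exact hδ.1.1.2 β β' η hβ (h γ β' hγ hβ') (hβ'.2.1 s η hs ⟨hη, h2, h3⟩)

theorem exists_epsBounded {δ : M} (hδ : IsRegularCardinal δ) (hΛ : CardLT 𝒜.Terms δ) :
    ∃ t, 𝒜.Ty [] t (𝒜.epsBounded δ) := by
  obtain ⟨T, hT⟩ := 𝒜.exists_bound_term
  refine ⟨.app (.close (.lam (.lam (.app (.var 0) (.var 1))))) (.lam (.lam
    (.app (.app (.app (.close T) (.var 1)) (.var 0)) (.var 0)))),
    Ty.allI fun f hf => Ty.allDomI fun a ha => ?_⟩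
  obtain ⟨α, hα, rfl⟩ := mem_dom_reish.1 ha
  obtain ⟨β, hβ, hb⟩ := exists_bound hδ hΛ hα f
  refine Ty.exDomI (mem_dom_reish.2 ⟨β, hβ, rfl⟩) (Ty.lam (Ty.allDomI fun y hy =>
    Ty.allDomI fun z hz => Ty.lam ?_))
  obtain ⟨γ, hγ, rfl⟩ := mem_dom_reish.1 hy
  obtain ⟨η, hη, rfl⟩ := mem_dom_reish.1 hz
  -- The typing rules are left here: the companion $\eta'$ depends on the actual realizer $s$, not
  -- merely on the formula it realizes.
  intro ts hts
  obtain ⟨s, _, hs, hts', rfl⟩ := List.forall₂_cons_right_iff.1 hts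
  obtain ⟨h, _, hh, hts'', rfl⟩ := List.forall₂_cons_right_iff.1 hts'
  obtain rfl := List.forall₂_nil_right_iff.1 hts''
  -- Take $\eta'\neq\eta$ if $s$ serves another ordinal; otherwise $\eta'=\eta$, and then
  -- $\eta\in\beta$ by the choice of $\beta$.
  obtain ⟨η', hη', hs', e⟩ : ∃ η', η' ∊ δ ∧
      s ∈ 𝒜.verity (.eps (𝒜.op (𝒜.reish γ) (𝒜.reish η')) f) ∧ (η = η' → η ∊ β) := by
    by_contra hne
    push Not at hne
    refine (hne η hη hs).2 (hb γ s η hγ hs.1 hη hs fun η' hη' hs' => ?_)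
    exact (hne η' hη' hs').1.symm
  exact 𝒜.verity_app (𝒜.verity_app (𝒜.verity_app
    (hT f α β δ γ η η' hf hγ hη hη' e [] .nil) hh) hs) hs'

theorem exists_epsFunctionsBounded {δ : M} (hδ : IsRegularCardinal δ) (hΛ : CardLT 𝒜.Terms δ) :
    ∃ t, 𝒜.Ty [] t (.epsFunctionsBounded 𝒜.op (𝒜.reish δ)) := by
  obtain ⟨T, hT⟩ := exists_epsBounded hδ hΛ
  exact ⟨_, .allI fun f hf => .allI fun a ha => .lam (.epsE .v0 fun haδ => .lam
    (.exDomE (.allDomE (.allE (.close hT) hf) haδ) fun b hb => .lam (by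
    obtain ⟨β, hβ, rfl⟩ := mem_dom_reish.1 hb
    -- The hypothesis in force is the negated existential: every bound fails to be an
    -- $\varepsilon$-element of $ℸ\delta$. For $ℸ\beta$ that formula has the falsity value of
    -- $\bot$.
    exact .bot_of_neps_reish hβ (.app (.allE .v0 (𝒜.isName_reish β))
      (.allI fun y hy => .lam (.epsE .v0 fun hya => .allI fun z hz => .lam
        (.epsE (d := 𝒜.reish δ) (a := z)
          (.app (.spec (.app (.spec (.andR (.andR .v4)) hy rfl) .v1) hz rfl) .v0) fun hzδ =>
            .app (.specDom (.specDom (.app .v3 (.andL (.andR .v4))) hya rfl) hzδ rfl) .v0)))))))⟩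

end Bounded

/-! ## The extensional relations -/

section Extensional

open Ty

variable (𝒜)

theorem exists_sub_trans' : ∃ t, ∀ a b c, 𝒜.IsName a → 𝒜.IsName b → 𝒜.IsName c →
    𝒜.Ty [] t (.sub a b ⟹ .sub b c ⟹ .sub a c) :=
  let ⟨_, hT⟩ := 𝒜.exists_sub_trans
  ⟨_, fun a _ _ ha hb hc => andL (spec (spec (hT a ha) hb rfl) hc rfl)⟩

/-- If $x\in x$, then $x\simeq z$ for some $z\,\varepsilon\, x$; since $x\subseteq z$, this gives
$z\in z$, against the induction hypothesis. -/
theorem exists_nin_irrefl : ∃ t, ∀ a, 𝒜.IsName a → 𝒜.Ty [] t (.nin a a) :=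
  ⟨_, fun _ ha => ind (φ := fun x => .nin x x) (fun _ hx => ninI hx hx fun _ hz =>
    lam (lam (app (indHypE v2 hz) (lam (app (subE hx hz v2 hz) v0))))) ha⟩

theorem exists_sim_refl : ∃ t, ∀ a, 𝒜.IsName a → 𝒜.Ty [] t (.sim a a) :=
  let ⟨_, hT⟩ := 𝒜.exists_sub_refl
  ⟨_, fun a ha => andI (hT a ha) (hT a ha)⟩

theorem exists_sim_symm : ∃ t, ∀ a b, 𝒜.Ty [] t (.sim a b ⟹ .sim b a) :=
  ⟨_, fun _ _ => lam (andI (andR v0) (andL v0))⟩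

theorem exists_sim_trans : ∃ t, ∀ a b c, 𝒜.IsName a → 𝒜.IsName b → 𝒜.IsName c →
    𝒜.Ty [] t (.sim a b ⟹ .sim b c ⟹ .sim a c) :=
  let ⟨_, hT⟩ := 𝒜.exists_sub_trans'
  ⟨_, fun a b c ha hb hc => lam (lam (andI
    (app (app (close (hT a b c ha hb hc)) (andL v1)) (andL v0))
    (app (app (close (hT c b a hc hb ha)) (andR v0)) (andR v1))))⟩

theorem exists_nin_congr_left : ∃ t, ∀ a a' b, 𝒜.IsName a → 𝒜.IsName a' → 𝒜.IsName b →
    𝒜.Ty [] t (.sim a a' ⟹ .nin a b ⟹ .nin a' b) :=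
  let ⟨_, hT⟩ := 𝒜.exists_sub_trans'
  ⟨_, fun a a' _ ha ha' hb => lam (lam (ninI ha' hb fun c hc => lam (lam
    (app (app (ninE ha hb v2 hc) (app (app (close (hT a a' c ha ha' hc)) (andL v3)) v1))
      (app (app (close (hT c a' a hc ha' ha)) v0) (andR v3))))))⟩

theorem exists_nin_of_sub : ∃ t, ∀ a b b', 𝒜.IsName a → 𝒜.IsName b → 𝒜.IsName b' →
    𝒜.Ty [] t (.sub b b' ⟹ .nin a b' ⟹ .nin a b) :=
  let ⟨_, hT⟩ := 𝒜.exists_nin_congr_left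
  ⟨_, fun a _ b' ha hb hb' => lam (lam (ninI ha hb fun c hc => lam (lam
    (app (subE hb hb' v3 hc) (app (app (close (hT a c b' ha hc hb')) (andI v1 v0)) v2)))))⟩

theorem exists_mem_congr : ∃ t, ∀ a a' b b', 𝒜.IsName a → 𝒜.IsName a' → 𝒜.IsName b →
    𝒜.IsName b' → 𝒜.Ty [] t (.sim a a' ⟹ .sim b b' ⟹ .mem a b ⟹ .mem a' b') :=
  let ⟨_, hT⟩ := 𝒜.exists_nin_congr_left
  let ⟨_, hT'⟩ := 𝒜.exists_nin_of_sub
  ⟨_, fun a a' b b' ha ha' hb hb' => lam (lam (lam (lam (app v1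
    (app (app (close (hT a' a b ha' ha hb)) (andI (andR v3) (andL v3)))
      (app (app (close (hT' a' b b' ha' hb hb')) (andL v2)) v0))))))⟩

theorem exists_mem_of_eps : ∃ t, ∀ a b, 𝒜.IsName a → 𝒜.IsName b →
    𝒜.Ty [] t (.eps a b ⟹ .mem a b) :=
  let ⟨_, hT⟩ := 𝒜.exists_sub_refl
  ⟨_, fun a _ ha hb => lam (lam (app v1
    (app (app (ninE ha hb v0 ha) (close (hT a ha))) (close (hT a ha)))))⟩

end Extensional

namespace Ty

variable {Γ : List (Fml M)} {r s t : Tm} {χ : Fml M} {a a' b b' c : M}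

/-- In this and the following rules the realizer is fixed once by `choose`, independently of the
names involved, so the rules may be used under quantifiers. -/
theorem simRefl (ha : 𝒜.IsName a) : 𝒜.Ty Γ (.close 𝒜.exists_sim_refl.choose) (.sim a a) :=
  close (𝒜.exists_sim_refl.choose_spec a ha)

theorem simSymm (h : 𝒜.Ty Γ t (.sim a b)) :
    𝒜.Ty Γ (.app (.close 𝒜.exists_sim_symm.choose) t) (.sim b a) :=
  app (close (𝒜.exists_sim_symm.choose_spec a b)) h

theorem simTrans (ha : 𝒜.IsName a) (hb : 𝒜.IsName b) (hc : 𝒜.IsName c)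
    (h : 𝒜.Ty Γ s (.sim a b)) (h' : 𝒜.Ty Γ t (.sim b c)) :
    𝒜.Ty Γ (.app (.app (.close 𝒜.exists_sim_trans.choose) s) t) (.sim a c) :=
  app (app (close (𝒜.exists_sim_trans.choose_spec a b c ha hb hc)) h) h'

theorem memCongr (ha : 𝒜.IsName a) (ha' : 𝒜.IsName a') (hb : 𝒜.IsName b) (hb' : 𝒜.IsName b')
    (h₁ : 𝒜.Ty Γ r (.sim a a')) (h₂ : 𝒜.Ty Γ s (.sim b b')) (h : 𝒜.Ty Γ t (.mem a b)) :
    𝒜.Ty Γ (.app (.app (.app (.close 𝒜.exists_mem_congr.choose) r) s) t) (.mem a' b') :=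
  app (app (app (close (𝒜.exists_mem_congr.choose_spec a a' b b' ha ha' hb hb')) h₁) h₂) h

theorem memOfEps (ha : 𝒜.IsName a) (hb : 𝒜.IsName b) (h : 𝒜.Ty Γ t (.eps a b)) :
    𝒜.Ty Γ (.app (.close 𝒜.exists_mem_of_eps.choose) t) (.mem a b) :=
  app (close (𝒜.exists_mem_of_eps.choose_spec a b ha hb)) h

theorem nepsI {d : M} (h : (∃ σ, pair a σ ∊ d) → 𝒜.Ty Γ t .bot) : 𝒜.Ty Γ t (.neps a d) := by
  by_cases ha : ∃ σ, pair a σ ∊ d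
  · exact exfalso (h ha)
  · exact of_falsity_eq_empty (Set.eq_empty_of_forall_notMem fun σ hσ => ha ⟨σ, hσ.2⟩)

theorem mem_reish_self {w x : M} (h : w ∊ x) :
    𝒜.Ty Γ (.app (.close 𝒜.exists_mem_of_eps.choose) (.lam (.var 0)))
      (.mem (𝒜.reish w) (𝒜.reish x)) :=
  memOfEps (𝒜.isName_reish w) (𝒜.isName_reish x) (eps_reish h)

end Ty

variable (𝒜) in
theorem exists_mem_reish_elim : ∃ t, ∀ a x χ, 𝒜.IsName a → 𝒜.Ty [] t
    (.mem a (𝒜.reish x) ⟹ (.allDom (𝒜.reish x) fun c => .sim a c ⟹ χ) ⟹ χ) :=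
  ⟨_, fun a x χ ha => .lam (.lam (.byContra (.app .v2 (.ninI ha (𝒜.isName_reish x) fun _ _ =>
    .lam (.lam (.nepsI fun hcx =>
      .app .v2 (.app (.allDomE (φ := fun c => .sim a c ⟹ χ) .v3 hcx) (.andI .v1 .v0))))))))⟩

/-- An `∈`-element of `ℸx` is `≃`-equal to some `ℸw`, `w ∊ x`. -/
theorem Ty.memReishE {Γ : List (Fml M)} {s t : Tm} {χ : Fml M} {a x : M} (ha : 𝒜.IsName a)
    (h : 𝒜.Ty Γ s (.mem a (𝒜.reish x)))
    (ht : ∀ w, w ∊ x → 𝒜.Ty (.sim a (𝒜.reish w) :: Γ) t χ) :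
    𝒜.Ty Γ (.app (.app (.close 𝒜.exists_mem_reish_elim.choose) s) (.lam t)) χ := by
  refine .app (.app (.close (𝒜.exists_mem_reish_elim.choose_spec a x χ ha)) h)
    (.allDomI fun c hc => .lam ?_)
  obtain ⟨w, hw, rfl⟩ := mem_dom_reish.1 hc
  exact ht w hw

/-! ## Congruence of the extensional pairing -/

section Pairing

open Ty

variable (𝒜)

theorem exists_isUPair_congr : ∃ t, ∀ p x x', 𝒜.IsName x → 𝒜.IsName x' →
    𝒜.Ty [] t (.sim x x' ⟹ .isUPair p x x ⟹ .isUPair p x' x') :=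
  ⟨_, fun _ _ _ hx hx' => lam (lam (allI fun _ hz => andI
    (lam (orE (app (andL (spec v1 hz rfl)) v0) (orL (simTrans hz hx hx' v0 v3))
      (orL (simTrans hz hx hx' v0 v3))))
    (lam (app (andR (spec v1 hz rfl))
      (orE v0 (orL (simTrans hz hx' hx v0 (simSymm v3)))
        (orL (simTrans hz hx' hx v0 (simSymm v3))))))))⟩

theorem exists_isOPair_congr : ∃ t, ∀ p x x' y y', 𝒜.IsName x → 𝒜.IsName x' → 𝒜.IsName y →
    𝒜.IsName y' →
    𝒜.Ty [] t (.sim x x' ⟹ .sim y y' ⟹ .isOPair p x y ⟹ .isOPair p x' y') :=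
  let ⟨_, hT⟩ := 𝒜.exists_isUPair_congr
  ⟨_, fun _ x x' y y' hx hx' hy hy' => lam (lam (lam (exE v0 fun _ he => exE v0 fun sx hsx =>
    exE v0 fun _ hl => exE v0 fun sy hsy => exE v0 fun _ hr =>
    exI he (exI hsx (exI hl (exI hsy (exI hr
      (andI (andL v0)
        (andI (app (app (close (hT sx x x' hx hx')) v7) (andL (andR v0)))
        (andI (andL (andR (andR v0)))
        (andI (app (app (close (hT sy y y' hy hy')) v6) (andL (andR (andR (andR v0)))))
          (andR (andR (andR (andR v0)))))))))))))))⟩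

theorem exists_relMem_congr : ∃ t, ∀ f x x' y y', 𝒜.IsName x → 𝒜.IsName x' → 𝒜.IsName y →
    𝒜.IsName y' →
    𝒜.Ty [] t (.sim x x' ⟹ .sim y y' ⟹ .relMem f x y ⟹ .relMem f x' y') :=
  let ⟨_, hT⟩ := 𝒜.exists_isOPair_congr
  ⟨_, fun _ x x' y y' hx hx' hy hy' => lam (lam (lam (exE v0 fun p hp => exI hp (andI (andL v0)
    (app (app (app (close (hT p x x' y y' hx hx' hy hy')) v3) v2) (andR v0))))))⟩

variable {𝒜}

theorem Ty.relMemCongr {Γ : List (Fml M)} {r s t : Tm} {f x x' y y' : M} (hx : 𝒜.IsName x)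
    (hx' : 𝒜.IsName x') (hy : 𝒜.IsName y) (hy' : 𝒜.IsName y')
    (h₁ : 𝒜.Ty Γ r (.sim x x')) (h₂ : 𝒜.Ty Γ s (.sim y y')) (h : 𝒜.Ty Γ t (.relMem f x y)) :
    𝒜.Ty Γ (.app (.app (.app (.close 𝒜.exists_relMem_congr.choose) r) s) t) (.relMem f x' y') :=
  app (app (app (close (𝒜.exists_relMem_congr.choose_spec f x x' y y' hx hx' hy hy')) h₁) h₂) h

end Pairing

/-! ## From `∈`-functions to `ε`-relations -/

section RelName

variable (𝒜)

/-- The elements of the name of the `ε`-relation `{op(x, y) | x ε ℸβ, y ε ℸδ, f(x, y)}`. -/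
def RelNameMem (f β δ z : M) : Prop :=
  ∃ γ η t π, γ ∊ β ∧ η ∊ δ ∧ t ∈ 𝒜.verity (.relMem f (𝒜.reish γ) (𝒜.reish η)) ∧
    π ∊ 𝒜.Stacks ∧ z = pair (𝒜.op (𝒜.reish γ) (𝒜.reish η)) (sPush t π)

/-- The name of the `ε`-relation `{op(x, y) | x ε ℸβ, y ε ℸδ, f(x, y)}`. -/
noncomputable def relName (f β δ : M) : M := compr (𝒜.RelNameMem f β δ)

/-- Universes are closed under pairing but not known to be closed under `reish` and `op`;
Replacement bounds the values occurring in `relName`. -/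
theorem exists_op_values (β δ : M) :
    ∃ X : M, ∀ γ η, γ ∊ β → η ∊ δ → 𝒜.op (𝒜.reish γ) (𝒜.reish η) ∊ X := by
  obtain ⟨P, hP⟩ := exists_set_of_list (D := fun z : M => ∃ γ η : M, γ ∊ β ∧ η ∊ δ ∧ z = pair γ η)
    [β, δ] (by
      rintro U hU hl - _ ⟨γ, η, hγ, hη, rfl⟩
      exact hU.pair_mem (hU.trans _ _ (hl β (by simp)) hγ) (hU.trans _ _ (hl δ (by simp)) hη))
  obtain ⟨X, hX⟩ := exists_repl (fun z x => ∃ γ η : M, z = pair γ η ∧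
      x = 𝒜.op (𝒜.reish γ) (𝒜.reish η)) P fun z hz => by
    obtain ⟨γ, η, -, -, rfl⟩ := (hP z).1 hz
    refine ⟨_, ⟨γ, η, rfl, rfl⟩, ?_⟩
    rintro _ ⟨γ', η', e, rfl⟩
    obtain ⟨rfl, rfl⟩ := pair_inj.1 e
    rfl
  exact ⟨X, fun γ η hγ hη => (hX _).2 ⟨_, (hP _).2 ⟨γ, η, hγ, hη, rfl⟩, γ, η, rfl, rfl⟩⟩

variable {𝒜}

theorem mem_relName {f β δ z : M} : z ∊ 𝒜.relName f β δ ↔ 𝒜.RelNameMem f β δ z := by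
  have h : Dfn fun v => v 0 ∈ 𝒜.verity (.relMem f (v 1) (v 2)) := by
    unfold Fml.relMem Fml.exMem Fml.isOPair Fml.isUPair; infer_instance
  have inst : ∀ {F G H : (ℕ → M) → M} [DfnF F] [DfnF G] [DfnF H],
      Dfn fun v => F v ∈ 𝒜.verity (.relMem f (G v) (H v)) := fun {F G H} _ _ _ =>
    Dfn.comp3 (P := fun t x y => t ∈ 𝒜.verity (.relMem f x y)) h ‹_› ‹_› ‹_›
  have : Dfn fun v => 𝒜.RelNameMem f β δ (v 0) := by unfold RelNameMem; infer_instance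
  obtain ⟨X, hX⟩ := 𝒜.exists_op_values β δ
  refine mem_compr_of_list [X, 𝒜.Terms, 𝒜.Stacks] ?_ z
  rintro U hU hl hn z ⟨γ, η, t, π, hγ, hη, ht, hπ, rfl⟩
  exact hU.pair_mem (hU.trans _ _ (hl X (by simp)) (hX γ η hγ hη)) (hU.sPush_mem hn
    (hU.trans _ _ (hl 𝒜.Terms (by simp)) ht.1) (hU.trans _ _ (hl 𝒜.Stacks (by simp)) hπ))

variable (𝒜) in
theorem isName_relName (f β δ : M) : 𝒜.IsName (𝒜.relName f β δ) :=
  𝒜.isName_of_forall fun z hz => by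
    obtain ⟨γ, η, t, π, -, -, ht, hπ, rfl⟩ := mem_relName.1 hz
    exact ⟨_, _, (𝒜.isName_reish γ).op (𝒜.isName_reish η), sPush_mem ht.1 hπ, rfl⟩

/-- The stacks in `relName` carry a realizer of the relation on top, so they are precisely the
stacks against its negation. Injectivity of `op` ensures that no other pair contributes. -/
theorem falsity_neps_relName {f β δ γ η : M} (hγ : γ ∊ β) (hη : η ∊ δ) :
    𝒜.falsity (.neps (𝒜.op (𝒜.reish γ) (𝒜.reish η)) (𝒜.relName f β δ)) =
      𝒜.falsity (.relMem f (𝒜.reish γ) (𝒜.reish η) ⟹ .bot) := by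
  ext ρ
  constructor
  · rintro ⟨-, h⟩
    obtain ⟨γ', η', t, π, -, -, ht, hπ, e⟩ := mem_relName.1 h
    obtain ⟨e', rfl⟩ := pair_inj.1 e
    obtain ⟨e1, e2⟩ := op_inj e'
    rw [← e1, ← e2] at ht
    exact ⟨t, π, ht.1, ht.2, hπ, rfl⟩
  · rintro ⟨t, π, ht, ht', hπ, rfl⟩
    exact ⟨sPush_mem ht hπ, mem_relName.2 ⟨γ, η, t, π, hγ, hη, ⟨ht, ht'⟩, hπ, rfl⟩⟩

namespace Ty

variable {Γ : List (Fml M)} {s t : Tm} {χ : Fml M} {f β δ γ η y : M}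

theorem epsRelNameI (hγ : γ ∊ β) (hη : η ∊ δ)
    (h : 𝒜.Ty Γ t (.relMem f (𝒜.reish γ) (𝒜.reish η))) :
    𝒜.Ty Γ (.app (.close (.lam (.lam (.app (.var 0) (.var 1))))) t)
      (.eps (𝒜.op (𝒜.reish γ) (𝒜.reish η)) (𝒜.relName f β δ)) :=
  app (close (lam (lam (app (v0.of_falsity_subset (falsity_neps_relName hγ hη).ge) v1)))) h

/-- As in `epsE`, a single term covers the degenerate case, so $y$ may be taken to be literally of
the form $ℸ\eta$. -/
theorem epsRelNameE (hγ : γ ∊ β) (h : 𝒜.Ty Γ s (.eps (𝒜.op (𝒜.reish γ) y) (𝒜.relName f β δ)))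
    (ht : ∀ η, η ∊ δ → y = 𝒜.reish η →
      𝒜.Ty (.relMem f (𝒜.reish γ) (𝒜.reish η) :: Γ) t χ) :
    𝒜.Ty Γ (.app (.app (.close (.lam (.lam (.app .cc (.lam (.app (.var 2)
      (.lam (.app (.var 1) (.app (.var 2) (.var 0)))))))))) s) (.lam t)) χ := by
  by_cases hy : ∃ η, η ∊ δ ∧ y = 𝒜.reish η
  · obtain ⟨η, hη, rfl⟩ := hy
    exact app (app (close (lam (lam (byContra (app v2
      ((lam (app v1 (app v2 v0))).of_falsity_subset (falsity_neps_relName hγ hη).le)))))) h)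
      (lam (ht η hη rfl))
  · have : 𝒜.falsity (.neps (𝒜.op (𝒜.reish γ) y) (𝒜.relName f β δ)) = ∅ := by
      refine Set.eq_empty_of_forall_notMem fun σ hσ => hy ?_
      obtain ⟨γ', η', t, π, -, hη, -, -, e⟩ := mem_relName.1 hσ.2
      exact ⟨η', hη, (op_inj (pair_inj.1 e).1).2⟩
    exact app (app (ψ := .top ⟹ χ) (close (lam (lam (byContra (app v2
      (of_falsity_eq_empty this)))))) h) top

end Ty

end RelName

end RealizabilityAlgebra
/-- Every `∈`-function from an `∈`-element of `a` to `a` is bounded. -/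
def Fml.memBounded {N : Type*} (a : N) : Fml N :=
  .allMem a fun b => .all fun f => .isFunMem f b a ⟹
    .exMem a fun c => .allMem b fun x => .all fun y => .relMem f x y ⟹ .mem y c

namespace RealizabilityAlgebra

variable {M : Type*} [setLang.Structure M] [ModelZF M] {𝒜 : RealizabilityAlgebra M}

/-! ## Regularity of `ℸδ` -/

section Regular

theorem exists_isOrdMem_reish {δ : M} (hδ : IsOrd δ) :
    ∃ t, 𝒜.Ty [] t (.isOrdMem (𝒜.reish δ)) := by
  have N := 𝒜.isName_reish
  have tr : ∃ t, 𝒜.Ty [] t (.allMem (𝒜.reish δ) fun x => .allMem x fun y =>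
      .mem y (𝒜.reish δ)) := ⟨_, .allI fun x hx => .lam (.memReishE hx .v0 fun β hβ =>
    .allI fun y hy => .lam (.memReishE hy (.memCongr hy hy hx (N β) (.simRefl hy) .v1 .v0)
      fun γ hγ => .memCongr (N γ) hy (N δ) (N δ) (.simSymm .v0) (.simRefl (N δ))
        (.mem_reish_self (hδ.1 β γ hβ hγ))))⟩
  obtain ⟨T, hT⟩ := tr
  exact ⟨_, .andI hT (.allI fun x hx => .lam (.memReishE hx .v0 fun β hβ =>
    .allI fun y hy => .lam (.memReishE hy (.memCongr hy hy hx (N β) (.simRefl hy) .v1 .v0)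
      fun γ hγ => .allI fun z hz => .lam (.memReishE hz
        (.memCongr hz hz hy (N γ) (.simRefl hz) .v1 .v0) fun ζ hζ =>
          .memCongr (N ζ) hz (N β) hx (.simSymm .v0) (.simSymm .v4)
            (.mem_reish_self (hδ.2 β γ ζ hβ hγ hζ))))))⟩

theorem exists_infinite_reish {δ : M} (h0 : empty ∊ δ) (hs : ∀ β, β ∊ δ → succ β ∊ δ) :
    ∃ t, 𝒜.Ty [] t (.and (.exMem (𝒜.reish δ) fun _ => .top)
      (.allMem (𝒜.reish δ) fun x => .exMem (𝒜.reish δ) fun y => .mem x y)) := by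
  have N := 𝒜.isName_reish
  exact ⟨_, .andI (.exI (N empty) (.andI (.mem_reish_self h0) (.top (t := .cc))))
    (.allI fun x hx => .lam (.memReishE hx .v0 fun β hβ => .exI (N (succ β))
      (.andI (.mem_reish_self (hs β hβ)) (.memCongr (N β) hx (N _) (N _) (.simSymm .v0)
        (.simRefl (N _)) (.mem_reish_self (mem_succ.2 (Or.inr rfl)))))))⟩

/-- The relation `relName` may relate $ℸ\gamma$ to several strictly different but $\simeq$-equal
values. NEAC selects one of them, the first claim bounds the selection by some $ℸ\xi$, and
functionality of $f$ up to $\simeq$ transfers the bound to all values. -/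
theorem exists_memBounded {δ : M} (hδ : IsRegularCardinal δ) (hΛ : CardLT 𝒜.Terms δ) :
    ∃ t, 𝒜.Ty [] t (.NEAC 𝒜.op ⟹ Fml.memBounded (𝒜.reish δ)) := by
  obtain ⟨T, hT⟩ := exists_epsBounded hδ hΛ
  have N := 𝒜.isName_reish
  exact ⟨_, .lam (.allI fun b hb => .lam (.memReishE hb .v0 fun β hβ => .allI fun f hf => .lam
    (.exE (.spec .v3 (𝒜.isName_relName f β δ) rfl) fun g hg =>
    .exDomE (.specDom (.allE (.close hT) hg) (mem_dom_reish.2 ⟨β, hβ, rfl⟩) rfl) fun c hc => by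
    obtain ⟨ξ, hξ, rfl⟩ := mem_dom_reish.1 hc
    exact .exI (N ξ) (.andI (.mem_reish_self hξ) (.allI fun x hx => .lam (.allI fun y hy => .lam
      (.memReishE hy (.app (.spec (.app (.spec (.andR (.andR .v4)) hx rfl) .v1) hy rfl) .v0)
      fun η hη => .memReishE hx (.memCongr hx hx hb (N β) (.simRefl hx) .v6 .v2) fun γ hγ =>
      -- The selected value $y'$ need not be $ℸ\eta$. As $g$ is contained in `relName`, it is some
      -- $ℸ\zeta$ related to $ℸ\gamma$ by $f$, hence $\simeq$ to $y$.
      .exE (.spec (.spec (.andR (.andR .v5)) (N γ) rfl) (N η) rfl) fun y' hy' =>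
      .cut (.app .v0 (.epsRelNameI hγ hη (.relMemCongr hx (N γ) hy (N η) .v1 .v2 .v3)))
      (.epsRelNameE hγ (.app (.spec (.andL (.andR .v7)) ((N γ).op hy') rfl) .v0)
        fun ζ hζ e => by
        subst e
        exact .memCongr (N ζ) hy (N ξ) (N ξ)
          (.app (.spec (.spec (.app (.spec (.andL (.andR (.var 9 rfl))) hx rfl) .v6) (N ζ) rfl) hy rfl)
            (.andI (.relMemCongr (N γ) hx (N ζ) (N ζ) (.simSymm .v3) (.simRefl (N ζ)) .v0) .v5))
          (.simRefl (N ξ))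
          (.memOfEps (N ζ) (N ξ) (.app (.specDom (.specDom (.app .v7
            -- NEAC provides functionality at all arguments; restricting it to $ℸ\beta$ costs one
            -- dummy abstraction.
            (.allI fun z hz => .lam (.spec (.andL (.var 9 rfl)) hz rfl)))
              (mem_dom_reish.2 ⟨γ, hγ, rfl⟩) rfl) (mem_dom_reish.2 ⟨ζ, hζ, rfl⟩) rfl) .v1))))))))))⟩

variable (𝒜) in
/-- Bounded `∈`-functions are not surjective, since `∈` is irreflexive. -/
theorem exists_not_surjective : ∃ t, ∀ d, 𝒜.IsName d → 𝒜.Ty [] t (.memBounded d ⟹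
    .allMem d fun b => .all fun f => .isFunMem f b d ⟹
      .neg (.allMem d fun y => .exMem b fun x => .relMem f x y)) :=
  let ⟨_, hT⟩ := 𝒜.exists_nin_irrefl
  ⟨_, fun _ _ => .lam (.allI fun _ hb => .lam (.allI fun _ hf => .lam (.lam
    (.exE (.app (.spec (.app (.spec .v3 hb rfl) .v2) hf rfl) .v1) fun c hc =>
    .exE (.app (.spec .v1 hc rfl) (.andL .v0)) fun _ hx =>
    .app (.app (.spec (.app (.spec (.andR .v1) hx rfl) (.andL .v0)) hc rfl) (.andR .v0))
      (.close (hT c hc))))))⟩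

theorem exists_isRegularMem {δ : M} (hδ : IsRegularCardinal δ) (hΛ : CardLT 𝒜.Terms δ) :
    ∃ t, 𝒜.Ty [] t (.NEAC 𝒜.op ⟹ .isRegularMem (𝒜.reish δ)) := by
  obtain ⟨_, h₁⟩ := exists_isOrdMem_reish (𝒜 := 𝒜) hδ.1.1
  obtain ⟨_, h₂⟩ := exists_infinite_reish (𝒜 := 𝒜) hδ.2.1.1 hδ.2.1.2
  obtain ⟨_, h₃⟩ := exists_memBounded hδ hΛ
  obtain ⟨_, h₄⟩ := 𝒜.exists_not_surjective
  exact ⟨_, .lam (.andI (.andI (.close h₁)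
    (.app (.close (h₄ _ (𝒜.isName_reish δ))) (.app (.close h₃) .v0)))
    (.andI (.close h₂) (.app (.close h₃) .v0)))⟩

end Regular

/-- The realizer of $\varphi$ is an arbitrary element of $\mathcal R$, possibly with special
instructions or of nonstandard size, so it need not be the code of a `Tm`. Closure of $\mathcal R$
under application is used instead. -/
theorem Ty.forces_of_forces {φ ψ : Fml M} {t : Tm} (h : 𝒜.Ty [] t (φ ⟹ ψ)) (hφ : 𝒜.Forces φ) :
    𝒜.Forces ψ :=
  let ⟨s, hs, hs'⟩ := hφ
  ⟨tApp (code [] 0 t) s, fun T hT => hT.2.1 _ _ _ (code_isRealizer _ t T hT) (hs T hT),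
    𝒜.verity_app (h [] .nil) hs'⟩

end RealizabilityAlgebra
end ClassicalRealizability

open ClassicalRealizability
theorem mainTheorem6 {M : Type*} [setLang.Structure M] [ModelZF M]
    (𝒜 : RealizabilityAlgebra M) (δ : M) (hδ : IsRegularCardinal δ) (hΛ : CardLT 𝒜.Terms δ) :
    𝒜.Forces (.all fun f => .allDom (𝒜.reish δ) fun a => .exDom (𝒜.reish δ) fun b =>
      .epsFun 𝒜.op f a ⟹
        .allDom a fun y => .allDom (𝒜.reish δ) fun z => .eps (𝒜.op y z) f ⟹ .eps z b) ∧
    𝒜.Forces (.epsFunctionsBounded 𝒜.op (𝒜.reish δ)) ∧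
    (𝒜.Forces (.NEAC 𝒜.op) → 𝒜.Forces (.isRegularMem (𝒜.reish δ))) := by
  obtain ⟨_, h₁⟩ := RealizabilityAlgebra.exists_epsBounded hδ hΛ
  obtain ⟨_, h₂⟩ := RealizabilityAlgebra.exists_epsFunctionsBounded hδ hΛ
  obtain ⟨_, h₃⟩ := RealizabilityAlgebra.exists_isRegularMem hδ hΛ
  exact ⟨h₁.forces, h₂.forces, h₃.forces_of_forces⟩
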